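/- \textbf{Setting.} Let $I=[-a,b]$ with $0<a,b<\infty$, or $I=\mathbb R$. Let $r:I\to\mathbb R^3$ be a simple $C^2$ curve parametrized by arc length, with a Frenet frame $T,N,B$, curvature $k\ge 0$ and torsion $\tau$ satisfying the Frenet equations $T'=kN$, $N'=-kT+\tau B$, $B'=-\tau N$. Let $\alpha:I\to\mathbb R$ be differentiable with $\alpha(0)=0$, and assume that $k,\tau,\alpha'$ are bounded. Let $S\subset\mathbb R^2$ be open, bounded, simply connected and nonempty, and let $\lambda_0$ be the lowest eigenvalue of the Dirichlet Laplacian in $S$, i.e. the infimum of $\int_S|\nabla u|^2/\int_S|u|^2$ over nonzero $u\in\mathcal H^1_0(S)$. Let $h:I\to(0,\infty)$ be continuous, $C^1$ on $I\setminus\{0\}$ with $h'/h$ bounded, such that $h(s)=M-s^2+O(|s|^3)$ as $s\to0$ with $M>0$, $h(s)<M$ for all $s\in I\setminus\{0\}$, and, if $I=\mathbb R$, $\limsup_{|s|\to\infty}h(s)<M$. Put $$\beta_\varepsilon(s,y)=1-\varepsilon h(s)k(s)\langle z_\alpha(s),y\rangle,\qquad z_\alpha=(\cos\alpha,-\sin\alpha),\qquad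 Ry=(y_2,-y_1),$$ $$Dv=\partial_s v-v\,\frac{h'}{h}+(\nabla_y v\cdot Ry)(\tau+\alpha')-(\nabla_y v\cdot y)\frac{h'}{h}.$$ For a constant $c>0$ consider the quadratic forms $$\hat g_\varepsilon(v)=\int_{I\times S}\Big(\frac{1}{\beta_\varepsilon}|Dv|^2+\frac{\beta_\varepsilon}{\varepsilon^2h^2}|\nabla_yv|^2-\frac{\lambda_0\beta_\varepsilon}{\varepsilon^2M^2}|v|^2+c\,\beta_\varepsilon|v|^2\Big)ds\,dy,$$ $$g_\varepsilon(v)=\int_{I\times S}\Big(|Dv|^2+\frac{\beta_\varepsilon}{\varepsilon^2h^2}|\nabla_yv|^2-\frac{\lambda_0\beta_\varepsilon}{\varepsilon^2M^2}|v|^2+c\,|v|^2\Big)ds\,dy,$$ both with domain $\{v\in\mathcal H^1_0(I\times S):\int_{I\times S} h^{-2}|\nabla_yv|^2<\infty\}$ (which is $\mathcal H_0^1(I\times S)$ if $\inf h>0$, in particular if $I$ is bounded), where functions are complex valued. \textbf{Theorem.} As $\varepsilon\to0^+$, $\beta_\varepsilon\to1$ uniformly on $I\times S$. Moreover, there are $\varepsilon_0>0$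 and $C>0$ such that for all $0<\varepsilon<\varepsilon_0$: $\beta_\varepsilon>0$ on $I\times S$; the form $g_\varepsilon$ is associated with a self-adjoint operator $G_\varepsilon$ in $L^2(I\times S)$, the form $\hat g_\varepsilon$ is associated with a self-adjoint operator $\hat G_\varepsilon$; these operators have bounded, everywhere defined inverses, and $$\big\|\hat G_\varepsilon^{-1}-G_\varepsilon^{-1}\big\|\le C\,\varepsilon .$$ This holds both when $\hat G_\varepsilon$ is taken as the operator of $\hat g_\varepsilon$ in $L^2(I\times S)$ and when it is taken as the operator of $\hat g_\varepsilon$ in the weighted space $L^2(I\times S,\beta_\varepsilon\,ds\,dy)$, the latter being identified with $L^2(I\times S)$ as a space of functions; in both cases the norm is the operator norm in $L^2(I\times S)$. -/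

import Mathlib

open MeasureTheory Set Filter Topology
open scoped ContDiff

noncomputable section

namespace ThinTube

/-- The plane that contains the cross section. -/
abbrev Plane := EuclideanSpace ℝ (Fin 2)

/-- The space that contains the reference curve. -/
abbrev Space := EuclideanSpace ℝ (Fin 3)

/-- The space of the coordinates `(s, y)`. -/
abbrev Coord := ℝ × Plane

/-! ### Sobolev functions with zero trace -/

/-- `u ∈ H¹₀(Ω)` with weak gradient `U` (as a field of real-linear maps): `(u, U)` lies in the
closure of `{(φ, φ') : φ ∈ C_c^∞(Ω; ℂ)}` in `L²(Ω) × L²(Ω)`. -/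
def MemH01 {E : Type*} [NormedAddCommGroup E] [NormedSpace ℝ E] [MeasureSpace E]
    (Ω : Set E) (u : E → ℂ) (U : E → E →L[ℝ] ℂ) : Prop :=
  MemLp u 2 (volume.restrict Ω) ∧ MemLp U 2 (volume.restrict Ω) ∧
    ∀ δ : ENNReal, 0 < δ → ∃ φ : E → ℂ, ContDiff ℝ ∞ φ ∧ HasCompactSupport φ ∧ tsupport φ ⊆ Ω ∧
      eLpNorm (u - φ) 2 (volume.restrict Ω) ≤ δ ∧
      eLpNorm (U - fderiv ℝ φ) 2 (volume.restrict Ω) ≤ δ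

/-- The lowest eigenvalue of the Dirichlet Laplacian of the cross section `S`, i.e. the infimum
of the Rayleigh quotients `∫_S |∇u|² / ∫_S |u|²` over nonzero `u ∈ H¹₀(S)`. -/
def firstEigenvalue (S : Set Plane) : ℝ :=
  sInf {ρ : ℝ | ∃ (u : Plane → ℂ) (U : Plane → Plane →L[ℝ] ℂ), MemH01 S u U ∧
    ¬ (u =ᵐ[volume.restrict S] 0) ∧
    ρ = (∫ y in S, ∑ i : Fin 2, ‖U y (EuclideanSpace.single i 1)‖ ^ 2) / ∫ y in S, ‖u y‖ ^ 2}

/-! ### The tube -/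

/-- `r` is a simple `C²` curve on `I`, parametrized by arc length, with a Frenet frame `T, N, B`,
curvature `k` and torsion `τ` that satisfy the Frenet equations. Where `k ≠ 0` this forces
`k = ‖T'‖` and `N = T' / k`. -/
structure IsFrenetCurve (I : Set ℝ) (r T N B : ℝ → Space) (k τ : ℝ → ℝ) : Prop where
  simple : InjOn r I
  contDiffOn : ContDiffOn ℝ 2 r I
  tangent : ∀ s ∈ I, HasDerivWithinAt r (T s) I s
  norm_tangent : ∀ s ∈ I, ‖T s‖ = 1
  norm_normal : ∀ s ∈ I, ‖N s‖ = 1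
  orthogonal : ∀ s ∈ I, inner ℝ (T s) (N s) = 0
  binormal : ∀ s ∈ I, B s = WithLp.toLp 2 (crossProduct (T s).ofLp (N s).ofLp)
  curvature_nonneg : ∀ s ∈ I, 0 ≤ k s
  frenet_tangent : ∀ s ∈ I, HasDerivWithinAt T (k s • N s) I s
  frenet_normal : ∀ s ∈ I, HasDerivWithinAt N (-(k s) • T s + τ s • B s) I s
  frenet_binormal : ∀ s ∈ I, HasDerivWithinAt B (-(τ s) • N s) I s

/-- `h` is an admissible deformation function on `I` with maximal value `M`. -/
structure IsDeformation (I : Set ℝ) (h : ℝ → ℝ) (M : ℝ) : Prop where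
  max_pos : 0 < M
  pos : ∀ s ∈ I, 0 < h s
  continuousOn : ContinuousOn h I
  contDiffOn : ContDiffOn ℝ 1 h (I \ {0})
  log_deriv_bounded : ∃ K : ℝ, ∀ s ∈ I \ {0}, |derivWithin h I s / h s| ≤ K
  expansion : (fun s => h s - (M - s ^ 2)) =O[𝓝 0] fun s => |s| ^ 3
  unique_max : ∀ s ∈ I, s ≠ 0 → h s < M
  limsup_lt : I = univ → limsup h (cocompact ℝ) < M

/-- The data of a family of deformed tubes: a curve over `I`, a cross section `S` that is rotated
by the angle `α`, and a deformation function `h`. -/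
structure DeformedTube where
  I : Set ℝ
  S : Set Plane
  r : ℝ → Space
  T : ℝ → Space
  N : ℝ → Space
  B : ℝ → Space
  k : ℝ → ℝ
  τ : ℝ → ℝ
  α : ℝ → ℝ
  h : ℝ → ℝ
  M : ℝ
  interval : (∃ a b : ℝ, 0 < a ∧ 0 < b ∧ I = Icc (-a) b) ∨ I = univ
  isOpen_section : IsOpen S
  isBounded_section : Bornology.IsBounded S
  simplyConnected_section : IsSimplyConnected S
  frenet : IsFrenetCurve I r T N B k τ
  curvature_bounded : ∃ K : ℝ, ∀ s ∈ I, |k s| ≤ K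
  torsion_bounded : ∃ K : ℝ, ∀ s ∈ I, |τ s| ≤ K
  angle_zero : α 0 = 0
  differentiableOn_angle : DifferentiableOn ℝ α I
  angle_deriv_bounded : ∃ K : ℝ, ∀ s ∈ I, |derivWithin α I s| ≤ K
  deformation : IsDeformation I h M

/-- The matrix `R = ((0, 1), (-1, 0))` applied to `y`. -/
def rot (y : Plane) : Plane := !₂[y 1, -(y 0)]

/-- `∇_y v · w`, where `V` is the gradient of `v` in the variables `(s, y)`. -/
def gradY (V : Coord → Coord →L[ℝ] ℂ) (z : Coord) (w : Plane) : ℂ := V z (0, w)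

/-- `conj (∇_y v) · ∇_y u`. -/
def gradYInner (V U : Coord → Coord →L[ℝ] ℂ) (z : Coord) : ℂ :=
  ∑ i : Fin 2, starRingEnd ℂ (gradY V z (EuclideanSpace.single i 1)) *
    gradY U z (EuclideanSpace.single i 1)

namespace DeformedTube

variable (X : DeformedTube)

/-- The open set `I × S` (without the end points of `I`). -/
def Ω : Set Coord := interior X.I ×ˢ X.S

/-- Lebesgue measure on `I × S`. -/
def μ : Measure Coord := volume.restrict X.Ω

/-- `z_α(s) = (cos α(s), - sin α(s))`. -/
def zα (s : ℝ) : Plane := !₂[Real.cos (X.α s), -Real.sin (X.α s)]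

/-- `β_ε(s, y) = 1 - ε h(s) k(s) ⟨z_α(s), y⟩`. -/
def beta (ε : ℝ) (z : Coord) : ℝ := 1 - ε * X.h z.1 * X.k z.1 * inner ℝ (X.zα z.1) z.2

/-- The measure `β_ε ds dy` on `I × S`. -/
def betaMeasure (ε : ℝ) : Measure Coord :=
  X.μ.withDensity fun z => ENNReal.ofReal (X.beta ε z)

/-- `∂_s v - v h'/h + (∇_y v · R y) (τ + α') - (∇_y v · y) h'/h`. -/
def longitudinal (v : Coord → ℂ) (V : Coord → Coord →L[ℝ] ℂ) (z : Coord) : ℂ :=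
  let q : ℝ := derivWithin X.h X.I z.1 / X.h z.1
  V z (1, 0) - v z * q + gradY V z (rot z.2) * ((X.τ z.1 + derivWithin X.α X.I z.1 : ℝ) : ℂ)
    - gradY V z z.2 * q

/-- The common domain of the forms: all `v ∈ H¹₀(I × S)` for which `∫ |∇_y v|² / h²` is finite.
This is all of `H¹₀(I × S)` if `inf h > 0`, in particular if `I` is bounded. -/
def FormDomain (v : Coord → ℂ) (V : Coord → Coord →L[ℝ] ℂ) : Prop :=
  MemH01 X.Ω v V ∧ Integrable (fun z => gradYInner V V z / (X.h z.1 : ℂ) ^ 2) X.μ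

/-- The sesquilinear form of the quadratic form
`ĝ_ε(v) = ∫ (1/β_ε) |∂_s v - v h'/h + ∇_y v · R y (τ + α') - ∇_y v · y h'/h|²
  + β_ε/(ε² h²) |∇_y v|² - λ₀ β_ε/(ε² M²) |v|² + c β_ε |v|²`. -/
def gHat (c ε : ℝ) (v : Coord → ℂ) (V : Coord → Coord →L[ℝ] ℂ)
    (u : Coord → ℂ) (U : Coord → Coord →L[ℝ] ℂ) : ℂ :=
  ∫ z, ((1 / X.beta ε z : ℝ) : ℂ) *
        (starRingEnd ℂ (X.longitudinal v V z) * X.longitudinal u U z)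
      + ((X.beta ε z / (ε ^ 2 * X.h z.1 ^ 2) : ℝ) : ℂ) * gradYInner V U z
      - ((firstEigenvalue X.S * X.beta ε z / (ε ^ 2 * X.M ^ 2) : ℝ) : ℂ) *
        (starRingEnd ℂ (v z) * u z)
      + ((c * X.beta ε z : ℝ) : ℂ) * (starRingEnd ℂ (v z) * u z) ∂X.μ

/-- The sesquilinear form of the quadratic form
`g_ε(v) = ∫ |∂_s v - v h'/h + ∇_y v · R y (τ + α') - ∇_y v · y h'/h|²
  + β_ε/(ε² h²) |∇_y v|² - λ₀ β_ε/(ε² M²) |v|² + c |v|²`. -/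
def g (c ε : ℝ) (v : Coord → ℂ) (V : Coord → Coord →L[ℝ] ℂ)
    (u : Coord → ℂ) (U : Coord → Coord →L[ℝ] ℂ) : ℂ :=
  ∫ z, starRingEnd ℂ (X.longitudinal v V z) * X.longitudinal u U z
      + ((X.beta ε z / (ε ^ 2 * X.h z.1 ^ 2) : ℝ) : ℂ) * gradYInner V U z
      - ((firstEigenvalue X.S * X.beta ε z / (ε ^ 2 * X.M ^ 2) : ℝ) : ℂ) *
        (starRingEnd ℂ (v z) * u z)
      + (c : ℂ) * (starRingEnd ℂ (v z) * u z) ∂X.μ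

/-- `A` is the operator in `L²(ν)` associated with the form `Q` (with domain `FormDomain`): `u` is
in its domain with `A u = f` if and only if `u` is in the form domain and `Q(v, u) = ⟨v, f⟩_ν` for
all `v` in the form domain. -/
def IsAssociated (ν : Measure Coord)
    (Q : (Coord → ℂ) → (Coord → Coord →L[ℝ] ℂ) → (Coord → ℂ) → (Coord → Coord →L[ℝ] ℂ) → ℂ)
    (A : Lp ℂ 2 ν →ₗ.[ℂ] Lp ℂ 2 ν) : Prop :=
  ∀ u f : Lp ℂ 2 ν, (u, f) ∈ A.graph ↔
    ∃ U : Coord → Coord →L[ℝ] ℂ, X.FormDomain u U ∧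
      ∀ (v : Coord → ℂ) (V : Coord → Coord →L[ℝ] ℂ), X.FormDomain v V →
        Q v V u U = ∫ z, starRingEnd ℂ (v z) * f z ∂ν

end DeformedTube

/-- The bounded, everywhere defined operator `R` is the inverse of `A`: `A u = f` if and only if
`u = R f`. -/
def IsBoundedInverse {H : Type*} [NormedAddCommGroup H] [NormedSpace ℂ H]
    (A : H →ₗ.[ℂ] H) (R : H →L[ℂ] H) : Prop :=
  ∀ u f : H, (u, f) ∈ A.graph ↔ u = R f

end ThinTube

end

/-! In the variables `(v, D v, ∇_y v / h)`, called the chart of `v`, both forms are diagonal. They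
share the coefficients of `∇_y v / h`, which are of size `ε⁻²`. They differ only in the coefficient
of `|Dv|²`, by `1 - 1/β_ε`, and in that of `|v|²`, by `c (1 - β_ε)`. Both differences are `O(ε)`,
because `h`, `k` and `S` are bounded. So the difference of the forms is controlled by `ε` times
`‖v‖` and `‖Dv‖` alone. If both forms dominate `‖v‖² + ‖Dv‖²/2` uniformly in `ε`, a Lax-Milgram
argument turns this into an `O(ε)` bound for the inverses (`norm_sub_le_of_forms`). In the weighted
space the right hand side `f` is replaced by `β_ε f`, which is another `O(ε)` change.

The work lies in the uniform lower bound `exists_lower_bound`, which combines three facts.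

On a slice, `β_ε` is an affine function of `y` with gradient `-ξ` and `‖ξ‖ = ε h |k|`. Inserting
`√β_ε φ` into the Rayleigh quotient produces a cross term that is a constant vector field applied to
`|φ|²`, and this integrates to zero. Hence the weighted eigenvalue inequality fails only by `‖ξ‖²/2`
(`firstEigenvalue_mul_weighted_le`). After division by `ε² h²` this error stays bounded, whereas a
first order error would be of size `1/ε`.

What remains of the transverse energy is the potential `λ₀ ε⁻² (1/h² - 1/M²)`. The non-degenerate
strict maximum of `h` at `0`, and its distance from `M` at infinity, give the lower bound `κ λ₀ ε⁻²
tanh² s` (`exists_mul_tanh_sq_le_inv_sq`).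

Finally `D` is skew-symmetric: the rotation preserves area, and the two terms with `h'/h` together
form the generator of a unitary dilation. Pairing `D v` with `tanh(s) v` gives an uncertainty
principle, which bounds `‖v‖²` by a small multiple of `‖Dv‖²` plus a large multiple of `∫ tanh²
|v|²` (`integral_norm_sq_le_longitudinal`). For small `ε` the potential pays for the large multiple,
and the bounded error of the first fact is absorbed.

The functional analysis takes place in the closed subspace `energySpace` of `L²(I × S; ℂ⁴)` formed
by the charts of the form domain. -/

namespace ThinTube

/-! ### Operators of coercive forms -/

section Form

variable {K V : Type*} [NormedAddCommGroup K] [InnerProductSpace ℂ K] [CompleteSpace K]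
  [NormedAddCommGroup V] [InnerProductSpace ℂ V] [CompleteSpace V]

/-- A bounded symmetric injective operator is the inverse of a self-adjoint operator. -/
theorem exists_isSelfAdjoint_isBoundedInverse (R : K →L[ℂ] K)
    (hR : ∀ f g, inner ℂ (R f) g = inner ℂ f (R g)) (hinj : ∀ f, R f = 0 → f = 0) :
    ∃ A : K →ₗ.[ℂ] K, IsSelfAdjoint A ∧ IsBoundedInverse A R := by
  -- The graph of `R` with its two coordinates exchanged, which is the graph of the inverse.
  let S : Submodule ℂ (K × K) := LinearMap.range (R.toLinearMap.prod LinearMap.id)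
  have hS : ∀ u f : K, (u, f) ∈ S ↔ u = R f := by
    intro u f
    constructor
    · rintro ⟨g, hg⟩
      have h1 : R g = u := congrArg Prod.fst hg
      have h2 : g = f := congrArg Prod.snd hg
      rw [← h1, h2]
    · rintro rfl
      exact ⟨f, rfl⟩
  have hgraph : S.toLinearPMap.graph = S := by
    apply Submodule.toLinearPMap_graph_eq
    rintro ⟨u, f⟩ hx hu
    rw [hS] at hx
    exact hinj f (by rw [← hx]; exact hu)
  have hinv : IsBoundedInverse S.toLinearPMap R := by
    intro u f
    rw [hgraph, hS]
  -- A vector orthogonal to the range of `R` is killed by `R`, by symmetry, and so vanishes.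
  have hdense : Dense (S.toLinearPMap.domain : Set K) := by
    rw [Submodule.dense_iff_topologicalClosure_eq_top, Submodule.topologicalClosure_eq_top_iff,
      Submodule.eq_bot_iff]
    intro f hf
    apply hinj
    apply ext_inner_left ℂ
    intro g
    rw [← hR, inner_zero_right]
    exact Submodule.inner_right_of_mem_orthogonal
      (LinearPMap.mem_domain_of_mem_graph ((hinv (R g) g).2 rfl)) hf
  refine ⟨S.toLinearPMap, ?_, hinv⟩
  rw [LinearPMap.isSelfAdjoint_def]
  apply LinearPMap.eq_of_eq_graph
  rw [LinearPMap.adjoint_graph_eq_graph_adjoint hdense, hgraph]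
  ext ⟨u, f⟩
  rw [Submodule.mem_adjoint_iff, hS]
  constructor
  · intro h
    apply ext_inner_left ℂ
    intro g
    have := h (R g) g ((hS _ _).2 rfl)
    rw [← hR]
    exact sub_eq_zero.1 this
  · rintro rfl a b hab
    rw [hS] at hab
    rw [hab, hR, sub_self]

/-- The self-adjoint operator of a bounded, symmetric and coercive form. -/
theorem exists_operator_of_coercive (B : V →L[ℂ] V)
    (hB : ∀ x y, inner ℂ (B x) y = inner ℂ x (B y)) {δ : ℝ} (hδ : 0 < δ)
    (hcoer : ∀ x, δ * ‖x‖ ^ 2 ≤ RCLike.re (inner ℂ x (B x))) (j : V →L[ℂ] K)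
    (hj : DenseRange j) :
    ∃ (A : K →ₗ.[ℂ] K) (T : K →L[ℂ] V), IsSelfAdjoint A ∧ IsBoundedInverse A (j ∘L T) ∧
      (∀ f y, inner ℂ y (B (T f)) = inner ℂ (j y) f) ∧
      ∀ u f, (u, f) ∈ A.graph ↔ ∃ x, j x = u ∧ ∀ y, inner ℂ y (B x) = inner ℂ (j y) f := by
  have hunit : IsUnit B := by
    refine ContinuousLinearMap.isUnit_of_forall_le_norm_inner_map B (c := ⟨δ, hδ.le⟩) hδ
      fun x => ?_
    calc ‖x‖ ^ 2 * δ ≤ RCLike.re (inner ℂ x (B x)) := by rw [mul_comm]; exact hcoer x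
      _ ≤ ‖inner ℂ x (B x)‖ := RCLike.re_le_norm _
      _ = ‖inner ℂ (B x) x‖ := norm_inner_symm _ _
  obtain ⟨Bu, rfl⟩ := hunit
  -- The Lax-Milgram solution map `B⁻¹ j*`.
  let T : K →L[ℂ] V := (↑Bu⁻¹ : V →L[ℂ] V) ∘L ContinuousLinearMap.adjoint j
  have hBT : ∀ f, (Bu : V →L[ℂ] V) (T f) = ContinuousLinearMap.adjoint j f := fun f => by
    change ((Bu : V →L[ℂ] V) * (↑Bu⁻¹ : V →L[ℂ] V)) (ContinuousLinearMap.adjoint j f) = _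
    rw [Bu.mul_inv]
    rfl
  have hT : ∀ f y, inner ℂ y ((Bu : V →L[ℂ] V) (T f)) = inner ℂ (j y) f := fun f y => by
    rw [hBT, ContinuousLinearMap.adjoint_inner_right]
  have hTuniq : ∀ x f, (∀ y, inner ℂ y ((Bu : V →L[ℂ] V) x) = inner ℂ (j y) f) → x = T f := by
    intro x f h
    have h1 : (Bu : V →L[ℂ] V) x = (Bu : V →L[ℂ] V) (T f) :=
      ext_inner_left ℂ fun y => by rw [h, hT]
    have h2 := congrArg (↑Bu⁻¹ : V →L[ℂ] V) h1
    have h3 : ∀ z, (↑Bu⁻¹ : V →L[ℂ] V) ((Bu : V →L[ℂ] V) z) = z := fun z => by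
      change ((↑Bu⁻¹ : V →L[ℂ] V) * (Bu : V →L[ℂ] V)) z = z
      rw [Bu.inv_mul]
      rfl
    rwa [h3, h3] at h2
  have hsymm : ∀ f g, inner ℂ (j (T f)) g = inner ℂ f (j (T g)) := fun f g => by
    rw [← hT, ← hB, ← inner_conj_symm, hT, inner_conj_symm]
  -- Injectivity of `j T`: if `j T f = 0`, the form vanishes at `T f`, so `T f = 0` by coercivity.
  -- Then `f` is orthogonal to the dense range of `j`.
  obtain ⟨A, hA, hinv⟩ := exists_isSelfAdjoint_isBoundedInverse (j ∘L T) hsymm (by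
    intro f hf
    have h0 : T f = 0 := by
      have h1 := hcoer (T f)
      have h2 : inner ℂ (T f) ((Bu : V →L[ℂ] V) (T f)) = 0 := by
        rw [hT]
        change inner ℂ ((j ∘L T) f) f = 0
        rw [hf, inner_zero_left]
      rw [h2, map_zero] at h1
      have h3 : ‖T f‖ ^ 2 ≤ 0 := by
        by_contra h
        push Not at h
        exact absurd h1 (not_le.2 (mul_pos hδ h))
      exact norm_eq_zero.1 (pow_eq_zero_iff two_ne_zero |>.1 (le_antisymm h3 (sq_nonneg _)))
    have h4 : ∀ y, inner ℂ (j y) f = 0 := fun y => by rw [← hT, h0, map_zero, inner_zero_right]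
    have h5 : (fun g : K => inner ℂ g f) = fun _ => 0 :=
      hj.equalizer (by fun_prop) continuous_const (funext h4)
    exact inner_self_eq_zero.1 (congrFun h5 f))
  refine ⟨A, T, hA, hinv, hT, fun u f => ?_⟩
  rw [hinv]
  constructor
  · rintro rfl
    exact ⟨T f, rfl, hT f⟩
  · rintro ⟨x, rfl, hx⟩
    rw [hTuniq x f hx]
    rfl

/-- Comparison of the solutions of two variational problems with nearby coercive forms. -/
theorem norm_sub_le_of_forms {W K' : Type*} [NormedAddCommGroup W] [InnerProductSpace ℂ W]
    [NormedAddCommGroup K'] [NormedSpace ℂ K'] (B B' : W →L[ℂ] W) (P₀ : W →L[ℂ] K)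
    (P₁ : W →L[ℂ] K') {η : ℝ} (hη : 0 ≤ η) (hη1 : η ≤ 1)
    (hB : ∀ x, ‖P₀ x‖ ^ 2 + 1 / 2 * ‖P₁ x‖ ^ 2 ≤ RCLike.re (inner ℂ x (B x)))
    (hB' : ∀ x, ‖P₀ x‖ ^ 2 + 1 / 2 * ‖P₁ x‖ ^ 2 ≤ RCLike.re (inner ℂ x (B' x)))
    (hdiff : ∀ x y, ‖inner ℂ y (B x) - inner ℂ y (B' x)‖ ≤
      η * (‖P₀ y‖ * ‖P₀ x‖ + ‖P₁ y‖ * ‖P₁ x‖))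
    {f f' : K} (hf : ‖f' - f‖ ≤ η * ‖f‖) {x x' : W}
    (hx : ∀ y, inner ℂ y (B x) = inner ℂ (P₀ y) f)
    (hx' : ∀ y, inner ℂ y (B' x') = inner ℂ (P₀ y) f') :
    ‖P₀ x' - P₀ x‖ ≤ 5 * η * ‖f‖ := by
  -- The part of the energy norm that is controlled independently of `ε`; the bound on the
  -- difference of the forms involves nothing else.
  let N : W → ℝ := fun x => √(‖P₀ x‖ ^ 2 + 1 / 2 * ‖P₁ x‖ ^ 2)
  have hN : ∀ x, N x ^ 2 = ‖P₀ x‖ ^ 2 + 1 / 2 * ‖P₁ x‖ ^ 2 := fun x => Real.sq_sqrt (by positivity)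
  have hN0 : ∀ x, 0 ≤ N x := fun x => Real.sqrt_nonneg _
  have hPN : ∀ x, ‖P₀ x‖ ≤ N x := fun x => Real.le_sqrt_of_sq_le (by nlinarith [sq_nonneg ‖P₁ x‖])
  have hcs : ∀ x y, ‖P₀ y‖ * ‖P₀ x‖ + ‖P₁ y‖ * ‖P₁ x‖ ≤ 2 * (N y * N x) := by
    intro x y
    have h := hN0 x
    have h' := hN0 y
    apply le_of_sq_le_sq _ (by positivity)
    have e : (2 * (N y * N x)) ^ 2 = 4 * (N y ^ 2 * N x ^ 2) := by ring
    rw [e, hN, hN]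
    nlinarith [sq_nonneg (‖P₀ y‖ * ‖P₁ x‖ - ‖P₁ y‖ * ‖P₀ x‖), sq_nonneg (‖P₀ y‖ * ‖P₀ x‖),
      sq_nonneg (‖P₀ y‖ * ‖P₁ x‖), sq_nonneg (‖P₁ y‖ * ‖P₀ x‖)]
  have cancel : ∀ a b : ℝ, 0 ≤ a → 0 ≤ b → a ^ 2 ≤ a * b → a ≤ b := by
    intro a b ha hb h
    rcases ha.eq_or_lt with rfl | ha
    · exact hb
    · nlinarith
  have hf' : ‖f'‖ ≤ 2 * ‖f‖ := by
    calc ‖f'‖ = ‖(f' - f) + f‖ := by rw [sub_add_cancel]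
      _ ≤ ‖f' - f‖ + ‖f‖ := norm_add_le _ _
      _ ≤ 2 * ‖f‖ := by nlinarith [norm_nonneg f]
  -- A priori estimate: test the equation for `x'` with `x'` itself.
  have hxn : N x' ≤ 2 * ‖f‖ := by
    refine (cancel (N x') ‖f'‖ (hN0 _) (norm_nonneg _) ?_).trans hf'
    calc N x' ^ 2 ≤ RCLike.re (inner ℂ x' (B' x')) := by rw [hN]; exact hB' x'
      _ ≤ ‖inner ℂ x' (B' x')‖ := RCLike.re_le_norm _
      _ ≤ ‖P₀ x'‖ * ‖f'‖ := by rw [hx']; exact norm_inner_le_norm _ _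
      _ ≤ N x' * ‖f'‖ := by gcongr; exact hPN _
  rw [← map_sub]
  set w := x' - x with hw
  refine (hPN w).trans (cancel (N w) _ (hN0 _) (by positivity) ?_)
  -- Galerkin identity for the error: the mismatch of the right hand sides plus the mismatch of the
  -- forms at the known function `x'`. They contribute `1` and `2 · 2` to the constant `5`.
  have key : inner ℂ w (B w) = inner ℂ (P₀ w) (f' - f) +
      (inner ℂ w (B x') - inner ℂ w (B' x')) := by
    rw [inner_sub_right, ← hx, ← hx', hw, map_sub B, inner_sub_right]
    ring
  calc N w ^ 2 ≤ RCLike.re (inner ℂ w (B w)) := by rw [hN]; exact hB w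
    _ ≤ ‖inner ℂ w (B w)‖ := RCLike.re_le_norm _
    _ ≤ ‖inner ℂ (P₀ w) (f' - f)‖ + ‖inner ℂ w (B x') - inner ℂ w (B' x')‖ := by
        rw [key]; exact norm_add_le _ _
    _ ≤ N w * (η * ‖f‖) + η * (2 * (N w * (2 * ‖f‖))) := by
        gcongr
        · exact (norm_inner_le_norm _ _).trans (mul_le_mul (hPN w) hf (norm_nonneg _) (hN0 w))
        · refine (hdiff x' w).trans ?_
          gcongr
          exact (hcs x' w).trans (by have := hN0 w; gcongr)
    _ = N w * (5 * η * ‖f‖) := by ring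

end Form

end ThinTube

namespace ThinTube

/-! ### Convergence in `L²` -/

section LTwo

variable {α F : Type*} [MeasurableSpace α] {μ : Measure α} [NormedAddCommGroup F]

theorem integral_norm_sq_eq {f : α → F} (hf : MemLp f 2 μ) :
    ∫ z, ‖f z‖ ^ 2 ∂μ = (eLpNorm f 2 μ).toReal ^ 2 := by
  rw [hf.eLpNorm_eq_integral_rpow_norm two_ne_zero ENNReal.ofNat_ne_top,
    ENNReal.toReal_ofReal (by positivity), ← Real.rpow_natCast, ← Real.rpow_mul (by positivity)]
  simp

theorem tendsto_integral_norm_sq {f : ℕ → α → F} {g : α → F} (hf : ∀ n, MemLp (f n) 2 μ)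
    (hg : MemLp g 2 μ) (h : Tendsto (fun n => eLpNorm (f n - g) 2 μ) atTop (𝓝 0)) :
    Tendsto (fun n => ∫ z, ‖f n z‖ ^ 2 ∂μ) atTop (𝓝 (∫ z, ‖g z‖ ^ 2 ∂μ)) := by
  simp only [integral_norm_sq_eq (hf _), integral_norm_sq_eq hg]
  have h1 := ((Lp.tendsto_Lp_iff_tendsto_eLpNorm'' f hf g hg).2 h).norm
  simp only [Lp.norm_toLp] at h1
  exact h1.pow 2

theorem eLpNorm_le_mul_add {G H : Type*} [NormedAddCommGroup G] [NormedAddCommGroup H]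
    {f : α → F} {a : α → G} {b : α → H} {C : ℝ} (ha : AEStronglyMeasurable a μ)
    (hb : AEStronglyMeasurable b μ) (h : ∀ᵐ z ∂μ, ‖f z‖ ≤ C * (‖a z‖ + ‖b z‖)) :
    eLpNorm f 2 μ ≤ ENNReal.ofReal C * (eLpNorm a 2 μ + eLpNorm b 2 μ) := by
  calc eLpNorm f 2 μ ≤ ENNReal.ofReal C * eLpNorm (fun z => ‖a z‖ + ‖b z‖) 2 μ := by
        apply eLpNorm_le_mul_eLpNorm_of_ae_le_mul
        filter_upwards [h] with z hz
        rwa [Real.norm_of_nonneg (by positivity)]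
    _ ≤ ENNReal.ofReal C * (eLpNorm (fun z => ‖a z‖) 2 μ + eLpNorm (fun z => ‖b z‖) 2 μ) := by
        gcongr
        exact eLpNorm_add_le ha.norm hb.norm (by norm_num)
    _ = _ := by rw [eLpNorm_norm, eLpNorm_norm]

theorem memLp_two_add {f g : α → F} (hf : MemLp f 2 μ) (hg : MemLp g 2 μ) : MemLp (f + g) 2 μ :=
  hf.add hg

theorem eLpNorm_two_sub_self (f : α → F) : eLpNorm (f - f) 2 μ = 0 := by simp

theorem eLpNorm_two_smul_sub [NormedSpace ℂ F] (a : ℂ) (f g : α → F) :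
    eLpNorm (a • f - a • g) 2 μ = ‖a‖ₑ * eLpNorm (f - g) 2 μ := by
  rw [← smul_sub, eLpNorm_const_smul]

theorem eLpNorm_two_sub_le {f g k : α → F} {a b : ENNReal} (hf : AEStronglyMeasurable f μ)
    (hg : AEStronglyMeasurable g μ) (hk : AEStronglyMeasurable k μ) (ha : eLpNorm (f - g) 2 μ ≤ a)
    (hb : eLpNorm (g - k) 2 μ ≤ b) : eLpNorm (f - k) 2 μ ≤ a + b := by
  rw [← sub_add_sub_cancel f g k]
  exact (eLpNorm_add_le (hf.sub hg) (hg.sub hk) (by norm_num)).trans (add_le_add ha hb)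

theorem eLpNorm_two_add_sub_add_le {f g f' g' : α → F} {a b : ENNReal}
    (hf : AEStronglyMeasurable f μ) (hg : AEStronglyMeasurable g μ)
    (hf' : AEStronglyMeasurable f' μ) (hg' : AEStronglyMeasurable g' μ)
    (ha : eLpNorm (f - f') 2 μ ≤ a) (hb : eLpNorm (g - g') 2 μ ≤ b) :
    eLpNorm (f + g - (f' + g')) 2 μ ≤ a + b := by
  rw [add_sub_add_comm]
  exact (eLpNorm_add_le (hf.sub hf') (hg.sub hg') (by norm_num)).trans (add_le_add ha hb)

theorem eLpNorm_two_sub_eq_zero {f g : α → F} (h : f =ᵐ[μ] g) : eLpNorm (g - f) 2 μ = 0 := by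
  rw [eLpNorm_congr_ae (h.symm.sub (ae_eq_refl f)), eLpNorm_two_sub_self]

end LTwo

/-! ### Sobolev functions with zero trace -/

/-- Test functions on `Ω`. -/
structure IsTest {E : Type*} [NormedAddCommGroup E] [NormedSpace ℝ E] (Ω : Set E) (φ : E → ℂ) :
    Prop where
  contDiff : ContDiff ℝ ∞ φ
  hasCompactSupport : HasCompactSupport φ
  tsupport_subset : tsupport φ ⊆ Ω

namespace IsTest

variable {E : Type*} [NormedAddCommGroup E] [NormedSpace ℝ E] {Ω : Set E} {φ : E → ℂ}

theorem differentiable (h : IsTest Ω φ) : Differentiable ℝ φ :=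
  h.contDiff.differentiable (by simp)

theorem continuous (h : IsTest Ω φ) : Continuous φ := h.contDiff.continuous

theorem continuous_fderiv (h : IsTest Ω φ) : Continuous (fderiv ℝ φ) :=
  h.contDiff.continuous_fderiv (by simp)

theorem eq_zero (h : IsTest Ω φ) {x : E} (hx : x ∉ Ω) : φ x = 0 :=
  image_eq_zero_of_notMem_tsupport fun h' => hx (h.tsupport_subset h')

theorem fderiv_eq_zero (h : IsTest Ω φ) {x : E} (hx : x ∉ Ω) : fderiv ℝ φ x = 0 :=
  image_eq_zero_of_notMem_tsupport fun h' =>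
    hx (h.tsupport_subset (tsupport_fderiv_subset ℝ h'))

theorem fderiv_eq_zero_of_notMem_tsupport {x : E} (hx : x ∉ tsupport φ) : fderiv ℝ φ x = 0 :=
  image_eq_zero_of_notMem_tsupport fun h' => hx (tsupport_fderiv_subset ℝ h')

variable [MeasurableSpace E] [BorelSpace E]

theorem memLp (h : IsTest Ω φ) (μ : Measure E) [IsFiniteMeasureOnCompacts μ] : MemLp φ 2 μ :=
  h.continuous.memLp_of_hasCompactSupport h.hasCompactSupport

theorem memLp_fderiv (h : IsTest Ω φ) (μ : Measure E) [IsFiniteMeasureOnCompacts μ] :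
    MemLp (fderiv ℝ φ) 2 μ :=
  h.continuous_fderiv.memLp_of_hasCompactSupport (h.hasCompactSupport.fderiv ℝ)

end IsTest

section Sobolev

variable {E : Type*} [NormedAddCommGroup E] [NormedSpace ℝ E] [MeasureSpace E] [BorelSpace E]
  [IsFiniteMeasureOnCompacts (volume : Measure E)] {Ω : Set E}
  {u v : E → ℂ} {U V : E → E →L[ℝ] ℂ}

theorem IsTest.memH01 {φ : E → ℂ} (h : IsTest Ω φ) : MemH01 Ω φ (fderiv ℝ φ) :=
  ⟨h.memLp _, h.memLp_fderiv _, fun _ _ => ⟨φ, h.contDiff, h.hasCompactSupport,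
    h.tsupport_subset, (eLpNorm_two_sub_self φ).trans_le zero_le,
    (eLpNorm_two_sub_self (fderiv ℝ φ)).trans_le zero_le⟩⟩

/-- Limits of functions in `H¹₀(Ω)`. -/
theorem MemH01.of_forall_approx (hu : MemLp u 2 (volume.restrict Ω))
    (hU : MemLp U 2 (volume.restrict Ω))
    (h : ∀ δ : ENNReal, 0 < δ → ∃ v V, MemH01 Ω v V ∧ eLpNorm (u - v) 2 (volume.restrict Ω) ≤ δ ∧
      eLpNorm (U - V) 2 (volume.restrict Ω) ≤ δ) : MemH01 Ω u U := by
  refine ⟨hu, hU, fun δ hδ => ?_⟩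
  obtain ⟨v, V, hv, h1, h2⟩ := h _ (ENNReal.half_pos hδ.ne')
  obtain ⟨φ, hφ, hc, ht, h3, h4⟩ := hv.2.2 _ (ENNReal.half_pos hδ.ne')
  have hT : IsTest Ω φ := ⟨hφ, hc, ht⟩
  refine ⟨φ, hφ, hc, ht, ?_, ?_⟩
  · exact (eLpNorm_two_sub_le hu.1 hv.1.1 (hT.memLp _).1 h1 h3).trans_eq (ENNReal.add_halves δ)
  · exact (eLpNorm_two_sub_le hU.1 hv.2.1.1 (hT.memLp_fderiv _).1 h2 h4).trans_eq
      (ENNReal.add_halves δ)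

theorem MemH01.congr (h : MemH01 Ω u U) (hu : u =ᵐ[volume.restrict Ω] v)
    (hU : U =ᵐ[volume.restrict Ω] V) : MemH01 Ω v V :=
  MemH01.of_forall_approx ((memLp_congr_ae hu).1 h.1) ((memLp_congr_ae hU).1 h.2.1)
    fun _ _ => ⟨u, U, h, (eLpNorm_two_sub_eq_zero hu).trans_le zero_le,
      (eLpNorm_two_sub_eq_zero hU).trans_le zero_le⟩

theorem MemH01.exists_seq (h : MemH01 Ω u U) : ∃ φ : ℕ → E → ℂ, (∀ n, IsTest Ω (φ n)) ∧
    Tendsto (fun n => eLpNorm (φ n - u) 2 (volume.restrict Ω)) atTop (𝓝 0) ∧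
    Tendsto (fun n => eLpNorm (fderiv ℝ (φ n) - U) 2 (volume.restrict Ω)) atTop (𝓝 0) := by
  choose φ h1 h2 h3 h4 h5 using fun n : ℕ => h.2.2 ((n : ENNReal) + 1)⁻¹ (by simp)
  have hlim : Tendsto (fun n : ℕ => ((n : ENNReal) + 1)⁻¹) atTop (𝓝 0) := by
    have := (tendsto_add_atTop_iff_nat 1).2 ENNReal.tendsto_inv_nat_nhds_zero
    simpa using this
  refine ⟨φ, fun n => ⟨h1 n, h2 n, h3 n⟩, ?_, ?_⟩
  · refine tendsto_of_tendsto_of_tendsto_of_le_of_le tendsto_const_nhds hlim (fun _ => zero_le)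
      fun n => ?_
    rw [eLpNorm_sub_comm]
    exact h4 n
  · refine tendsto_of_tendsto_of_tendsto_of_le_of_le tendsto_const_nhds hlim (fun _ => zero_le)
      fun n => ?_
    rw [eLpNorm_sub_comm]
    exact h5 n

theorem MemH01.add (hu : MemH01 Ω u U) (hv : MemH01 Ω v V) : MemH01 Ω (u + v) (U + V) := by
  refine ⟨hu.1.add hv.1, memLp_two_add hu.2.1 hv.2.1, fun δ hδ => ?_⟩
  obtain ⟨φ, h1, h2, h3, h4, h5⟩ := hu.2.2 _ (ENNReal.half_pos hδ.ne')
  obtain ⟨ψ, k1, k2, k3, k4, k5⟩ := hv.2.2 _ (ENNReal.half_pos hδ.ne')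
  have hφ : IsTest Ω φ := ⟨h1, h2, h3⟩
  have hψ : IsTest Ω ψ := ⟨k1, k2, k3⟩
  have hd : fderiv ℝ (φ + ψ) = fderiv ℝ φ + fderiv ℝ ψ := by
    ext1 x
    exact fderiv_add (hφ.differentiable x) (hψ.differentiable x)
  refine ⟨φ + ψ, h1.add k1, h2.add k2, (tsupport_add φ ψ).trans (union_subset h3 k3), ?_, ?_⟩
  · exact (eLpNorm_two_add_sub_add_le hu.1.1 hv.1.1 (hφ.memLp _).1 (hψ.memLp _).1 h4 k4).trans_eq
      (ENNReal.add_halves δ)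
  · rw [hd]
    exact (eLpNorm_two_add_sub_add_le hu.2.1.1 hv.2.1.1 (hφ.memLp_fderiv _).1
      (hψ.memLp_fderiv _).1 h5 k5).trans_eq (ENNReal.add_halves δ)

theorem MemH01.const_smul (hu : MemH01 Ω u U) (a : ℂ) : MemH01 Ω (a • u) (a • U) := by
  refine ⟨hu.1.const_smul a, hu.2.1.const_smul a, fun δ hδ => ?_⟩
  -- The summand `1` covers the case `a = 0`.
  have hpos : 0 < δ / (‖a‖ₑ + 1) := ENNReal.div_pos hδ.ne' (by finiteness)
  have hle : ‖a‖ₑ * (δ / (‖a‖ₑ + 1)) ≤ δ := by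
    calc ‖a‖ₑ * (δ / (‖a‖ₑ + 1)) ≤ (‖a‖ₑ + 1) * (δ / (‖a‖ₑ + 1)) := by
          gcongr
          exact le_self_add
      _ ≤ δ := ENNReal.mul_div_le
  obtain ⟨φ, h1, h2, h3, h4, h5⟩ := hu.2.2 _ hpos
  have hφ : IsTest Ω φ := ⟨h1, h2, h3⟩
  have hd : fderiv ℝ (a • φ) = a • fderiv ℝ φ := by
    ext1 x
    exact fderiv_const_smul (hφ.differentiable x) a
  refine ⟨a • φ, h1.const_smul a, h2.smul_left (f := fun _ => a),
    (tsupport_smul_subset_right (fun _ => a) φ).trans h3, ?_, ?_⟩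
  · exact (eLpNorm_two_smul_sub a u φ).trans_le ((mul_le_mul_right h4 _).trans hle)
  · rw [hd]
    exact (eLpNorm_two_smul_sub a U (fderiv ℝ φ)).trans_le ((mul_le_mul_right h5 _).trans hle)

/-- Continuity of quadratic functionals along approximating test functions. -/
theorem MemH01.tendsto_integral {F : Type*} [NormedAddCommGroup F]
    {ℓ : (E → ℂ) → (E → E →L[ℝ] ℂ) → E → F} {C : ℝ} (hu : MemH01 Ω u U) {φ : ℕ → E → ℂ}
    (hφ : ∀ n, IsTest Ω (φ n))
    (h0 : Tendsto (fun n => eLpNorm (φ n - u) 2 (volume.restrict Ω)) atTop (𝓝 0))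
    (h1 : Tendsto (fun n => eLpNorm (fderiv ℝ (φ n) - U) 2 (volume.restrict Ω)) atTop (𝓝 0))
    (hm : ∀ v V, MemH01 Ω v V → MemLp (ℓ v V) 2 (volume.restrict Ω))
    (hℓ : ∀ v V w W, ∀ᵐ z ∂volume.restrict Ω,
      ‖ℓ v V z - ℓ w W z‖ ≤ C * (‖v z - w z‖ + ‖V z - W z‖)) :
    Tendsto (fun n => ∫ z in Ω, ‖ℓ (φ n) (fderiv ℝ (φ n)) z‖ ^ 2) atTop
      (𝓝 (∫ z in Ω, ‖ℓ u U z‖ ^ 2)) := by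
  refine tendsto_integral_norm_sq (fun n => hm _ _ (hφ n).memH01) (hm _ _ hu) ?_
  have hlim := ENNReal.Tendsto.const_mul (a := ENNReal.ofReal C) (h0.add h1)
    (Or.inr ENNReal.ofReal_ne_top)
  rw [add_zero, mul_zero] at hlim
  refine tendsto_of_tendsto_of_tendsto_of_le_of_le tendsto_const_nhds hlim (fun _ => zero_le)
    fun n => ?_
  exact eLpNorm_le_mul_add (((hφ n).memLp _).1.sub hu.1.1)
    (((hφ n).memLp_fderiv _).1.sub hu.2.1.1) (hℓ _ _ _ _)

end Sobolev

/-! ### Integration by parts -/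

section Parts

variable {E : Type*} [NormedAddCommGroup E] [NormedSpace ℝ E] [FiniteDimensional ℝ E]
  [MeasurableSpace E] [BorelSpace E] (μ : Measure E) [μ.IsAddHaarMeasure]

/-- Only `f` has compact support, so `p` may grow; it is used with coordinate functions and with
`tanh`. -/
theorem integral_mul_fderiv_of_hasCompactSupport {p f : E → ℝ} (hp : ContDiff ℝ 1 p)
    (hf : ContDiff ℝ 1 f) (hc : HasCompactSupport f) (v : E) :
    ∫ x, p x * fderiv ℝ f x v ∂μ = -∫ x, fderiv ℝ p x v * f x ∂μ := by
  have hp' : Continuous fun x => fderiv ℝ p x v := (hp.continuous_fderiv one_ne_zero).clm_apply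
    continuous_const
  have hf' : Continuous fun x => fderiv ℝ f x v := (hf.continuous_fderiv one_ne_zero).clm_apply
    continuous_const
  apply integral_mul_fderiv_eq_neg_fderiv_mul_of_integrable
  · exact (hp'.mul hf.continuous).integrable_of_hasCompactSupport hc.mul_left
  · exact (hp.continuous.mul hf').integrable_of_hasCompactSupport
      (hc.fderiv_apply ℝ v).mul_left
  · exact (hp.continuous.mul hf.continuous).integrable_of_hasCompactSupport hc.mul_left
  · exact fun x _ => hp.differentiable (by simp) x
  · exact fun x _ => hf.differentiable (by simp) x

omit [FiniteDimensional ℝ E] [MeasurableSpace E] [BorelSpace E] in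
theorem fderiv_norm_sq_apply {φ : E → ℂ} {x : E} (h : DifferentiableAt ℝ φ x) (v : E) :
    fderiv ℝ (fun x => ‖φ x‖ ^ 2) x v = 2 * (starRingEnd ℂ (φ x) * fderiv ℝ φ x v).re := by
  rw [h.hasFDerivAt.norm_sq.fderiv]
  simp [Complex.inner]
  ring

/-- `∫ p 2 Re (φ̄ ∂_v φ) = - ∫ (∂_v p) |φ|²`. -/
theorem integral_mul_re_conj_mul_fderiv {p : E → ℝ} {φ : E → ℂ} (hp : ContDiff ℝ 1 p)
    (hφ : ContDiff ℝ 1 φ) (hc : HasCompactSupport φ) (v : E) :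
    ∫ x, p x * (2 * (starRingEnd ℂ (φ x) * fderiv ℝ φ x v).re) ∂μ =
      -∫ x, fderiv ℝ p x v * ‖φ x‖ ^ 2 ∂μ := by
  have hf : ContDiff ℝ 1 fun x => ‖φ x‖ ^ 2 := hφ.norm_sq ℝ
  have hcf : HasCompactSupport fun x => ‖φ x‖ ^ 2 := hc.comp_left (g := fun w : ℂ => ‖w‖ ^ 2)
    (by simp)
  rw [← integral_mul_fderiv_of_hasCompactSupport μ hp hf hcf v]
  simp only [fderiv_norm_sq_apply (hφ.differentiable (by simp) _)]

end Parts

end ThinTube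

namespace ThinTube

/-! ### The lowest Dirichlet eigenvalue of the cross section -/

section Section

variable {S : Set Plane} {φ : Plane → ℂ}

theorem IsTest.continuous_fderiv_apply {E : Type*} [NormedAddCommGroup E] [NormedSpace ℝ E]
    {Ω : Set E} {φ : E → ℂ} (h : IsTest Ω φ) (v : E) : Continuous fun x => fderiv ℝ φ x v :=
  h.continuous_fderiv.clm_apply continuous_const

theorem IsTest.hasCompactSupport_fderiv_apply {E : Type*} [NormedAddCommGroup E]
    [NormedSpace ℝ E] {Ω : Set E} {φ : E → ℂ} (h : IsTest Ω φ) (v : E) :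
    HasCompactSupport fun x => fderiv ℝ φ x v :=
  h.hasCompactSupport.fderiv_apply ℝ v

theorem hasCompactSupport_norm_sq {E : Type*} [TopologicalSpace E] {f : E → ℂ}
    (h : HasCompactSupport f) : HasCompactSupport fun x => ‖f x‖ ^ 2 :=
  h.comp_left (g := fun w : ℂ => ‖w‖ ^ 2) (by simp)

theorem IsTest.integrable_norm_sq {E : Type*} [NormedAddCommGroup E] [NormedSpace ℝ E]
    [MeasurableSpace E] [BorelSpace E] {Ω : Set E} {φ : E → ℂ} (h : IsTest Ω φ) (μ : Measure E)
    [IsFiniteMeasureOnCompacts μ] : Integrable (fun x => ‖φ x‖ ^ 2) μ :=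
  (h.continuous.norm.pow 2).integrable_of_hasCompactSupport
    (hasCompactSupport_norm_sq h.hasCompactSupport)

theorem IsTest.integrable_fderiv_norm_sq {E : Type*} [NormedAddCommGroup E] [NormedSpace ℝ E]
    [MeasurableSpace E] [BorelSpace E] {Ω : Set E} {φ : E → ℂ} (h : IsTest Ω φ) (μ : Measure E)
    [IsFiniteMeasureOnCompacts μ] (v : E) : Integrable (fun x => ‖fderiv ℝ φ x v‖ ^ 2) μ :=
  ((h.continuous_fderiv_apply v).norm.pow 2).integrable_of_hasCompactSupport
    (hasCompactSupport_norm_sq (h.hasCompactSupport_fderiv_apply v))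

/-- Young's inequality with a free parameter: the gap is `t⁻¹` times a square. -/
theorem two_mul_re_conj_mul_le (w z : ℂ) {t : ℝ} (ht : 0 < t) :
    |2 * (starRingEnd ℂ w * z).re| ≤ t * ‖w‖ ^ 2 + t⁻¹ * ‖z‖ ^ 2 := by
  have h1 : |(starRingEnd ℂ w * z).re| ≤ ‖w‖ * ‖z‖ := by
    simpa using Complex.abs_re_le_norm (starRingEnd ℂ w * z)
  have h2 : t * ‖w‖ ^ 2 + t⁻¹ * ‖z‖ ^ 2 - 2 * (‖w‖ * ‖z‖) = t⁻¹ * (t * ‖w‖ - ‖z‖) ^ 2 := by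
    field_simp
    ring
  have h3 : 0 ≤ t⁻¹ * (t * ‖w‖ - ‖z‖) ^ 2 := by positivity
  rw [abs_mul, abs_two]
  linarith

/-- Poincaré inequality for test functions. -/
theorem IsTest.integral_norm_sq_le {R : ℝ} (hR : ∀ y ∈ S, ‖y‖ ≤ R) (hφ : IsTest S φ) :
    ∫ y in S, ‖φ y‖ ^ 2 ≤
      4 * R ^ 2 * ∫ y in S, ‖fderiv ℝ φ y (EuclideanSpace.single 0 1)‖ ^ 2 := by
  set e : Plane := EuclideanSpace.single 0 1
  rw [setIntegral_eq_integral_of_forall_compl_eq_zero fun y hy => by simp [hφ.eq_zero hy],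
    setIntegral_eq_integral_of_forall_compl_eq_zero fun y hy => by simp [hφ.fderiv_eq_zero hy]]
  let p : Plane →L[ℝ] ℝ := EuclideanSpace.proj 0
  have hpe : p e = 1 := by simp [p, e]
  -- With `p` the first coordinate, `∂p = 1`, and the right hand side is exactly `-∫ |φ|²`.
  have hparts := integral_mul_re_conj_mul_fderiv (volume : Measure Plane) p.contDiff
    (hφ.contDiff.of_le (by simp)) hφ.hasCompactSupport e
  simp only [ContinuousLinearMap.fderiv, hpe, one_mul] at hparts
  have i1 := hφ.integrable_norm_sq volume
  have i2 := hφ.integrable_fderiv_norm_sq volume e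
  -- The weights in Young's inequality are chosen so that half of `|φ|²` can be absorbed on the
  -- left, which leads to the factor `4 R²`.
  have hpt : ∀ y, -(p y * (2 * (starRingEnd ℂ (φ y) * fderiv ℝ φ y e).re)) ≤
      1 / 2 * ‖φ y‖ ^ 2 + 2 * R ^ 2 * ‖fderiv ℝ φ y e‖ ^ 2 := by
    intro y
    by_cases hy : y ∈ S
    · have h1 : |p y| ≤ R := (PiLp.norm_apply_le y 0).trans (hR y hy)
      rcases (abs_nonneg (p y)).trans h1 |>.eq_or_lt with h0 | h0
      · have : p y = 0 := abs_eq_zero.1 (le_antisymm (h1.trans h0.ge) (abs_nonneg _))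
        rw [this, zero_mul, neg_zero]
        positivity
      · have h2 := two_mul_re_conj_mul_le (φ y) (fderiv ℝ φ y e) (t := (2 * R)⁻¹) (by positivity)
        rw [inv_inv] at h2
        calc -(p y * (2 * (starRingEnd ℂ (φ y) * fderiv ℝ φ y e).re))
            ≤ |p y| * |2 * (starRingEnd ℂ (φ y) * fderiv ℝ φ y e).re| := by
              rw [← abs_mul]; exact neg_le_abs _
          _ ≤ R * ((2 * R)⁻¹ * ‖φ y‖ ^ 2 + 2 * R * ‖fderiv ℝ φ y e‖ ^ 2) := by gcongr
          _ = _ := by field_simp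
    · simp [hφ.eq_zero hy, hφ.fderiv_eq_zero hy]
  have key : ∫ y, ‖φ y‖ ^ 2 ≤ ∫ y, (1 / 2 * ‖φ y‖ ^ 2 + 2 * R ^ 2 * ‖fderiv ℝ φ y e‖ ^ 2) := by
    rw [← neg_neg (∫ y, ‖φ y‖ ^ 2), ← hparts, ← integral_neg]
    refine integral_mono (Integrable.neg ?_) ((i1.const_mul _).add (i2.const_mul _)) hpt
    have hc : Continuous fun y => fderiv ℝ φ y e := hφ.continuous_fderiv_apply e
    have hc' := hφ.continuous
    refine Continuous.integrable_of_hasCompactSupport (by fun_prop) ?_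
    refine (hφ.hasCompactSupport_fderiv_apply e).mono fun y hy => ?_
    rw [Function.mem_support] at hy ⊢
    contrapose! hy
    rw [hy]
    simp
  rw [integral_add (i1.const_mul _) (i2.const_mul _), integral_const_mul, integral_const_mul] at key
  linarith

theorem MemH01.integral_norm_sq_le {R : ℝ} (hR : ∀ y ∈ S, ‖y‖ ≤ R) {u : Plane → ℂ}
    {U : Plane → Plane →L[ℝ] ℂ} (hu : MemH01 S u U) :
    ∫ y in S, ‖u y‖ ^ 2 ≤ 4 * R ^ 2 * ∫ y in S, ‖U y (EuclideanSpace.single 0 1)‖ ^ 2 := by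
  set e : Plane := EuclideanSpace.single 0 1
  have he : ‖e‖ = 1 := by simp [e]
  obtain ⟨φ, hφ, h0, h1⟩ := hu.exists_seq
  refine le_of_tendsto_of_tendsto
    (hu.tendsto_integral (C := 1) (ℓ := fun u _ => u) hφ h0 h1 (fun v V h => h.1) ?_)
    ((hu.tendsto_integral (C := 1) (ℓ := fun _ U y => U y e) hφ h0 h1 (fun v V h => ?_) ?_).const_mul
      (4 * R ^ 2)) (Eventually.of_forall fun n => (hφ n).integral_norm_sq_le hR)
  · refine fun v V w W => Eventually.of_forall fun z => ?_
    rw [one_mul]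
    exact le_add_of_nonneg_right (norm_nonneg _)
  · refine h.2.1.of_le (h.2.1.1.apply_continuousLinearMap e) (Eventually.of_forall fun y => ?_)
    simpa [he] using (V y).le_opNorm e
  · refine fun v V w W => Eventually.of_forall fun z => ?_
    have := (V z - W z).le_opNorm e
    rw [he, mul_one] at this
    rw [one_mul]
    exact this.trans (le_add_of_nonneg_left (norm_nonneg _))

theorem integral_norm_sq_pos {u : Plane → ℂ} (hu : MemLp u 2 (volume.restrict S))
    (h0 : ¬ u =ᵐ[volume.restrict S] 0) : 0 < ∫ y in S, ‖u y‖ ^ 2 := by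
  rw [integral_norm_sq_eq hu]
  have h1 : eLpNorm u 2 (volume.restrict S) ≠ 0 := by
    rwa [Ne, eLpNorm_eq_zero_iff hu.1 two_ne_zero]
  have := ENNReal.toReal_pos h1 hu.2.ne
  positivity

/-- Provides an admissible function for the Rayleigh quotient, so that the infimum defining
`firstEigenvalue` is not taken over the empty set, where `sInf` would be `0`. -/
theorem exists_isTest_pos (hS : IsOpen S) (hne : S.Nonempty) :
    ∃ φ : Plane → ℂ, IsTest S φ ∧ ¬ φ =ᵐ[volume.restrict S] 0 := by
  obtain ⟨y₀, hy₀⟩ := hne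
  obtain ⟨f, hf1, hf2, hf3, -, hf5⟩ := exists_contDiff_tsupport_subset (n := ⊤) (hS.mem_nhds hy₀)
  have hφ : IsTest S fun y => (f y : ℂ) := by
    refine ⟨Complex.ofRealCLM.contDiff.comp hf3, hf2.comp_left (g := fun t : ℝ => (t : ℂ)) (by simp),
      (closure_mono ?_).trans hf1⟩
    intro y hy
    simpa using hy
  refine ⟨_, hφ, fun h => ?_⟩
  have h1 := Measure.eqOn_open_of_ae_eq h hS hφ.continuous.continuousOn continuousOn_const hy₀
  simp [hf5] at h1

/-- The Poincaré inequality bounds all Rayleigh quotients below by `(4 R²)⁻¹`. Strict positivity is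
what makes the narrowing of the tube act as a confining potential. -/
theorem firstEigenvalue_pos (hS : IsOpen S) (hb : Bornology.IsBounded S) (hne : S.Nonempty) :
    0 < firstEigenvalue S := by
  obtain ⟨R, hR0, hR⟩ := hb.exists_pos_norm_le
  have hpos : 0 < (4 * R ^ 2)⁻¹ := by positivity
  refine hpos.trans_le (le_csInf ?_ ?_)
  · obtain ⟨φ, hφ, h0⟩ := exists_isTest_pos hS hne
    exact ⟨_, φ, fderiv ℝ φ, hφ.memH01, h0, rfl⟩
  · rintro _ ⟨u, U, hu, h0, rfl⟩
    rw [le_div_iff₀ (integral_norm_sq_pos hu.1 h0), inv_mul_le_iff₀ (by positivity)]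
    refine (hu.integral_norm_sq_le hR).trans ?_
    have hint : ∀ i, Integrable (fun y => ‖U y (EuclideanSpace.single i 1)‖ ^ 2)
        (volume.restrict S) := fun i => by
      have : MemLp (fun y => U y (EuclideanSpace.single i 1)) 2 (volume.restrict S) := by
        refine hu.2.1.of_le (hu.2.1.1.apply_continuousLinearMap _)
          (Eventually.of_forall fun y => ?_)
        simpa using (U y).le_opNorm (EuclideanSpace.single i 1)
      exact this.integrable_norm_pow two_ne_zero
    gcongr ?_ * ?_
    refine integral_mono (hint 0) (integrable_finsetSum _ fun i _ => hint i) fun y => ?_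
    exact Finset.single_le_sum (f := fun i : Fin 2 => ‖U y (EuclideanSpace.single i 1)‖ ^ 2)
      (fun i _ => by positivity) (Finset.mem_univ 0)

theorem sum_norm_sq_nonneg (L : Plane →L[ℝ] ℂ) :
    0 ≤ ∑ i : Fin 2, ‖L (EuclideanSpace.single i 1)‖ ^ 2 :=
  Finset.sum_nonneg fun _ _ => sq_nonneg _

theorem firstEigenvalue_mul_le {u : Plane → ℂ} {U : Plane → Plane →L[ℝ] ℂ} (hu : MemH01 S u U) :
    firstEigenvalue S * ∫ y in S, ‖u y‖ ^ 2 ≤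
      ∫ y in S, ∑ i : Fin 2, ‖U y (EuclideanSpace.single i 1)‖ ^ 2 := by
  by_cases h0 : u =ᵐ[volume.restrict S] 0
  · have : ∫ y in S, ‖u y‖ ^ 2 = 0 := by
      rw [integral_eq_zero_of_ae]
      filter_upwards [h0] with y hy
      simp [hy]
    rw [this, mul_zero]
    exact integral_nonneg fun y => sum_norm_sq_nonneg (U y)
  · rw [← le_div_iff₀ (integral_norm_sq_pos hu.1 h0)]
    refine csInf_le ⟨0, ?_⟩ ⟨u, U, hu, h0, rfl⟩
    rintro _ ⟨u, U, -, -, rfl⟩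
    exact div_nonneg (integral_nonneg fun y => sum_norm_sq_nonneg (U y))
      (integral_nonneg fun y => by positivity)

/-- The factor need only be smooth on `S`: outside its support `φ` vanishes locally, and so does the
product. This is needed for the square root of the weight. -/
theorem isTest_smul {b : Plane → ℝ} {φ : Plane → ℂ} (hφ : IsTest S φ)
    (hb : ∀ y ∈ S, ContDiffAt ℝ ∞ b y) : IsTest S fun y => b y • φ y := by
  have hsupp : Function.support (fun y => b y • φ y) ⊆ Function.support φ := fun y hy h => by
    simp [h] at hy
  refine ⟨contDiff_iff_contDiffAt.2 fun y => ?_, hφ.hasCompactSupport.mono hsupp,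
    (closure_mono hsupp).trans hφ.tsupport_subset⟩
  by_cases hy : y ∈ tsupport φ
  · exact (hb y (hφ.tsupport_subset hy)).smul hφ.contDiff.contDiffAt
  · refine contDiffAt_const (c := (0 : ℂ)) |>.congr_of_eventuallyEq ?_
    filter_upwards [notMem_tsupport_iff_eventuallyEq.1 hy] with z hz
    simp [hz]

/-- The lowest eigenvalue of a weighted Dirichlet problem with an affine weight is, up to
a quadratic error, at least the unweighted one. -/
theorem firstEigenvalue_mul_weighted_le {φ : Plane → ℂ} (hφ : IsTest S φ) (ξ : Plane)
    (hS : IsOpen S) (hξ : ∀ y ∈ S, 1 / 2 ≤ 1 - inner ℝ ξ y) :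
    firstEigenvalue S * ∫ y in S, (1 - inner ℝ ξ y) * ‖φ y‖ ^ 2 ≤
      ∫ y in S, ((1 - inner ℝ ξ y) *
        ∑ i : Fin 2, ‖fderiv ℝ φ y (EuclideanSpace.single i 1)‖ ^ 2 +
        ‖ξ‖ ^ 2 / 2 * ‖φ y‖ ^ 2) := by
  let b : Plane → ℝ := fun y => √(1 - inner ℝ ξ y)
  let ξL : Plane →L[ℝ] ℝ := innerSL ℝ ξ
  have hβ : ContDiff ℝ ∞ fun y : Plane => 1 - inner ℝ ξ y := contDiff_const.sub ξL.contDiff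
  have hβpos : ∀ y ∈ S, 0 < 1 - inner ℝ ξ y := fun y hy => by linarith [hξ y hy]
  have hb0 : ∀ y ∈ S, 0 < b y := fun y hy => Real.sqrt_pos.2 (hβpos y hy)
  have hb2 : ∀ y ∈ S, b y ^ 2 = 1 - inner ℝ ξ y := fun y hy => Real.sq_sqrt (hβpos y hy).le
  have hw : IsTest S fun y => b y • φ y :=
    isTest_smul hφ fun y hy => hβ.contDiffAt.sqrt (hβpos y hy).ne'
  have hdb : ∀ y ∈ S, HasFDerivAt b ((1 / (2 * b y)) • (-ξL)) y := fun y hy => by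
    have h1 : HasFDerivAt (fun y : Plane => 1 - inner ℝ ξ y) (-ξL) y :=
      ξL.hasFDerivAt.const_sub 1
    exact h1.sqrt (hβpos y hy).ne'
  have hξi : ∀ i, ξL (EuclideanSpace.single i 1) = ξ i := fun i => by
    simp [ξL, EuclideanSpace.inner_single_right]
  -- Expansion of `|∂ᵢ(√β φ)|²` with `β = 1 - ⟨ξ, y⟩`. The middle term is `-ξᵢ/2` times `∂ᵢ|φ|²`,
  -- and `ξᵢ` does not depend on `y`.
  have hd : ∀ y ∈ S, ∀ i, ‖fderiv ℝ (fun y => b y • φ y) y (EuclideanSpace.single i 1)‖ ^ 2 =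
      (1 - inner ℝ ξ y) * ‖fderiv ℝ φ y (EuclideanSpace.single i 1)‖ ^ 2
      - ξ i / 2 * (2 * (starRingEnd ℂ (φ y) * fderiv ℝ φ y (EuclideanSpace.single i 1)).re)
      + ξ i ^ 2 / (4 * (1 - inner ℝ ξ y)) * ‖φ y‖ ^ 2 := by
    intro y hy i
    have h1 := (hdb y hy).smul (hφ.differentiable y).hasFDerivAt
    have h2 : fderiv ℝ (fun y => b y • φ y) y (EuclideanSpace.single i 1) =
        (b y : ℂ) * fderiv ℝ φ y (EuclideanSpace.single i 1) + ((-(ξ i) / (2 * b y) : ℝ) : ℂ) * φ y := by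
      rw [show fderiv ℝ (fun y => b y • φ y) y = _ from h1.fderiv]
      simp [hξi]
      ring
    have h3 := hb0 y hy
    rw [h2, ← hb2 y hy, ← Complex.normSq_eq_norm_sq, ← Complex.normSq_eq_norm_sq,
      ← Complex.normSq_eq_norm_sq, Complex.normSq_apply, Complex.normSq_apply, Complex.normSq_apply]
    simp only [Complex.add_re, Complex.add_im, Complex.mul_re, Complex.mul_im, Complex.ofReal_re,
      Complex.ofReal_im, Complex.conj_re, Complex.conj_im]
    field_simp
    ring
  have hmain := firstEigenvalue_mul_le hw.memH01
  have e1 : ∫ y in S, ‖b y • φ y‖ ^ 2 = ∫ y in S, (1 - inner ℝ ξ y) * ‖φ y‖ ^ 2 :=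
    setIntegral_congr_fun hS.measurableSet fun y hy => by
      simp only [norm_smul, mul_pow, Real.norm_eq_abs, sq_abs, hb2 y hy]
  have hcφ := hφ.continuous
  have hcβ := hβ.continuous
  have hcd : ∀ i : Fin 2, Continuous fun y => fderiv ℝ φ y (EuclideanSpace.single i 1) :=
    fun i => hφ.continuous_fderiv_apply _
  have i0 : ∀ i : Fin 2, Integrable
      fun y => 2 * (starRingEnd ℂ (φ y) * fderiv ℝ φ y (EuclideanSpace.single i 1)).re := fun i => by
    have := hcd i
    refine Continuous.integrable_of_hasCompactSupport (by fun_prop) ?_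
    refine hφ.hasCompactSupport.mono fun y hy => ?_
    rw [Function.mem_support] at hy ⊢
    contrapose! hy
    simp [hy]
  -- The integral of a derivative of a compactly supported function; this removes the first order
  -- term in `ξ`.
  have z0 : ∀ i : Fin 2, ∫ y in S,
      2 * (starRingEnd ℂ (φ y) * fderiv ℝ φ y (EuclideanSpace.single i 1)).re = 0 := fun i => by
    rw [setIntegral_eq_integral_of_forall_compl_eq_zero fun y hy => by simp [hφ.eq_zero hy]]
    have := integral_mul_re_conj_mul_fderiv (volume : Measure Plane) (p := fun _ => 1)
      contDiff_const (hφ.contDiff.of_le (by simp)) hφ.hasCompactSupport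
      (EuclideanSpace.single i (1 : ℝ))
    simpa using this
  have i1 : Integrable (fun y => ‖φ y‖ ^ 2) (volume.restrict S) := hφ.integrable_norm_sq _
  have i2 : Integrable (fun y => (1 - inner ℝ ξ y) *
      ∑ i : Fin 2, ‖fderiv ℝ φ y (EuclideanSpace.single i 1)‖ ^ 2) (volume.restrict S) := by
    refine Integrable.integrableOn (Continuous.integrable_of_hasCompactSupport (by fun_prop) ?_)
    refine (hφ.hasCompactSupport.fderiv ℝ).mono fun y hy => ?_
    rw [Function.mem_support] at hy ⊢
    contrapose! hy
    simp [hy]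
  have i3 : Integrable (fun y => ∑ i : Fin 2, ξ i / 2 *
      (2 * (starRingEnd ℂ (φ y) * fderiv ℝ φ y (EuclideanSpace.single i 1)).re))
      (volume.restrict S) :=
    integrable_finsetSum _ fun i _ => (i0 i).integrableOn.const_mul _
  have i4 : Integrable (fun y => (1 - inner ℝ ξ y) *
      ∑ i : Fin 2, ‖fderiv ℝ φ y (EuclideanSpace.single i 1)‖ ^ 2 + ‖ξ‖ ^ 2 / 2 * ‖φ y‖ ^ 2)
      (volume.restrict S) := i2.add (i1.const_mul _)
  rw [e1] at hmain
  refine hmain.trans ?_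
  have key : ∫ y in S, ∑ i : Fin 2,
      ‖fderiv ℝ (fun y => b y • φ y) y (EuclideanSpace.single i 1)‖ ^ 2 ≤
      ∫ y in S, (((1 - inner ℝ ξ y) *
        ∑ i : Fin 2, ‖fderiv ℝ φ y (EuclideanSpace.single i 1)‖ ^ 2 + ‖ξ‖ ^ 2 / 2 * ‖φ y‖ ^ 2)
        - ∑ i : Fin 2, ξ i / 2 *
          (2 * (starRingEnd ℂ (φ y) * fderiv ℝ φ y (EuclideanSpace.single i 1)).re)) := by
    refine setIntegral_mono_on ?_ ?_ hS.measurableSet fun y hy => ?_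
    · exact integrable_finsetSum _ fun i _ => hw.integrable_fderiv_norm_sq _ _
    · exact i4.sub i3
    · have h1 := hξ y hy
      have h2 : 0 ≤ (1 - inner ℝ ξ y)⁻¹ := by positivity
      have h3 : (1 - inner ℝ ξ y)⁻¹ ≤ 2 := by
        rw [inv_le_comm₀ (hβpos y hy) two_pos]
        linarith
      have h4 : ‖ξ‖ ^ 2 = ∑ i, ξ i ^ 2 := by simp [EuclideanSpace.norm_sq_eq]
      -- This is where `β ≥ 1/2` enters: `1/(4β) ≤ 1/2`.
      have h5 : ∀ i, ξ i ^ 2 / (4 * (1 - inner ℝ ξ y)) ≤ ξ i ^ 2 / 2 := fun i => by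
        rw [div_eq_mul_inv, mul_inv, div_eq_mul_inv]
        gcongr
        linarith
      rw [h4, Finset.sum_congr rfl fun i _ => hd y hy i]
      simp only [Fin.sum_univ_two]
      have h6 := mul_le_mul_of_nonneg_right (h5 0) (sq_nonneg ‖φ y‖)
      have h7 := mul_le_mul_of_nonneg_right (h5 1) (sq_nonneg ‖φ y‖)
      linarith
  rw [integral_sub i4 i3, integral_finsetSum _ fun i _ =>
    ((i0 i).integrableOn.const_mul _)] at key
  simpa only [integral_const_mul, z0, mul_zero, Finset.sum_const_zero, sub_zero] using key

end Section

end ThinTube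

namespace ThinTube

/-! ### The hyperbolic tangent -/

theorem hasDerivAt_tanh (s : ℝ) : HasDerivAt Real.tanh (1 - Real.tanh s ^ 2) s := by
  have h1 : HasDerivAt (fun s => Real.sinh s / Real.cosh s) _ s :=
    (Real.hasDerivAt_sinh s).div (Real.hasDerivAt_cosh s) (Real.cosh_pos s).ne'
  have h2 : Real.tanh = fun s => Real.sinh s / Real.cosh s := funext Real.tanh_eq_sinh_div_cosh
  rw [h2]
  convert h1 using 1
  have := (Real.cosh_pos s).ne'
  field_simp

theorem contDiff_tanh : ContDiff ℝ 1 Real.tanh := by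
  have h2 : Real.tanh = fun s => Real.sinh s / Real.cosh s := funext Real.tanh_eq_sinh_div_cosh
  rw [h2]
  exact Real.contDiff_sinh.div Real.contDiff_cosh fun s => (Real.cosh_pos s).ne'

theorem tanh_sq_lt_one (s : ℝ) : Real.tanh s ^ 2 < 1 := by
  rw [Real.tanh_eq_sinh_div_cosh, div_pow, div_lt_one (by have := Real.cosh_pos s; positivity),
    Real.cosh_sq]
  exact lt_add_one _

/-- The derivative of `tanh` lies in `(0, 1]`. Near `0` this compares `tanh²` with the quadratic
behaviour of `M - h`. -/
theorem tanh_sq_le_sq (s : ℝ) : Real.tanh s ^ 2 ≤ s ^ 2 := by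
  have h := convex_univ.norm_image_sub_le_of_norm_hasDerivWithin_le (f := Real.tanh) (C := 1)
    (fun x _ => (hasDerivAt_tanh x).hasDerivWithinAt) (fun x _ => ?_) (mem_univ 0) (mem_univ s)
  · rw [Real.tanh_zero, sub_zero, sub_zero, one_mul, Real.norm_eq_abs, Real.norm_eq_abs] at h
    exact sq_le_sq.2 h
  · rw [Real.norm_eq_abs, abs_le]
    constructor <;> linarith [tanh_sq_lt_one x, sq_nonneg (Real.tanh x)]

namespace DeformedTube

variable (X : DeformedTube)

/-! ### The coefficients of the forms -/

/-- The logarithmic derivative of `h`. -/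
noncomputable def logDeriv (s : ℝ) : ℝ := derivWithin X.h X.I s / X.h s

/-- The rate of rotation `τ + α'` of the cross section with respect to the Tang frame. -/
noncomputable def twist (s : ℝ) : ℝ := X.τ s + derivWithin X.α X.I s

theorem isClosed_I : IsClosed X.I := by
  obtain ⟨a, b, -, -, h⟩ | h := X.interval
  · rw [h]; exact isClosed_Icc
  · rw [h]; exact isClosed_univ

theorem I_mem_nhds : X.I ∈ 𝓝 0 := by
  obtain ⟨a, b, ha, hb, h⟩ | h := X.interval
  · rw [h]; exact Icc_mem_nhds (by linarith) hb
  · rw [h]; exact univ_mem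

theorem zero_mem : (0 : ℝ) ∈ X.I := mem_of_mem_nhds X.I_mem_nhds

/-- At `s = 0` the error term of the expansion is zero. -/
theorem h_zero : X.h 0 = X.M := by
  have h := X.deformation.expansion.eq_zero_imp
  have h0 := h.self_of_nhds (by simp)
  simp only [ne_eq, OfNat.ofNat_ne_zero, not_false_eq_true, zero_pow, sub_zero] at h0
  linarith

theorem h_le {s : ℝ} (hs : s ∈ X.I) : X.h s ≤ X.M := by
  by_cases h0 : s = 0
  · rw [h0, X.h_zero]
  · exact (X.deformation.unique_max s hs h0).le

theorem h_pos {s : ℝ} (hs : s ∈ X.I) : 0 < X.h s := X.deformation.pos s hs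

/-- The assumed bound on `h'/h` omits the origin. There `h` has a local maximum, so the derivative
(or its default value) is `0`. -/
theorem logDeriv_zero : X.logDeriv 0 = 0 := by
  have hmax : IsLocalMax X.h 0 := by
    filter_upwards [X.I_mem_nhds] with s hs
    rw [X.h_zero]
    exact X.h_le hs
  rw [logDeriv, derivWithin_of_mem_nhds X.I_mem_nhds, hmax.deriv_eq_zero, zero_div]

theorem exists_bound : ∃ K : ℝ, 1 ≤ K ∧ (∀ s ∈ X.I, |X.k s| ≤ K) ∧ (∀ s ∈ X.I, |X.logDeriv s| ≤ K) ∧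
    (∀ s ∈ X.I, |X.twist s| ≤ K) ∧ ∀ y ∈ X.S, ‖y‖ ≤ K := by
  obtain ⟨K₁, h₁⟩ := X.curvature_bounded
  obtain ⟨K₂, h₂⟩ := X.torsion_bounded
  obtain ⟨K₃, h₃⟩ := X.angle_deriv_bounded
  obtain ⟨K₄, h₄⟩ := X.deformation.log_deriv_bounded
  obtain ⟨K₅, h₅, h₆⟩ := X.isBounded_section.exists_pos_norm_le
  have p₁ := (abs_nonneg _).trans (h₁ 0 X.zero_mem)
  have p₂ := (abs_nonneg _).trans (h₂ 0 X.zero_mem)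
  have p₃ := (abs_nonneg _).trans (h₃ 0 X.zero_mem)
  have p₄ := le_abs_self K₄
  have p₅ := abs_nonneg K₄
  refine ⟨1 + K₁ + K₂ + K₃ + |K₄| + K₅, by linarith, fun s hs => ?_, fun s hs => ?_, fun s hs => ?_,
    fun y hy => ?_⟩
  · linarith [h₁ s hs]
  · by_cases h0 : s = 0
    · rw [h0, logDeriv_zero, abs_zero]
      linarith
    · have := h₄ s ⟨hs, h0⟩
      rw [logDeriv]
      linarith
  · have := abs_add_le (X.τ s) (derivWithin X.α X.I s)
    rw [twist]
    linarith [h₂ s hs, h₃ s hs]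
  · linarith [h₆ y hy]

/-- Away from a compact set `h` stays below a constant smaller than `M`. On the line this is the
condition on the limsup; on a bounded interval the compact set is all of `I` and the constant is
arbitrary. -/
theorem exists_compact_h_le : ∃ (Q : Set ℝ) (c : ℝ), IsCompact Q ∧ c < X.M ∧
    ∀ s ∈ X.I, s ∉ Q → X.h s ≤ c := by
  obtain ⟨a, b, ha, hb, h⟩ | h := X.interval
  · exact ⟨X.I, X.M - 1, by rw [h]; exact isCompact_Icc, by linarith, fun s hs hs' => absurd hs hs'⟩
  · obtain ⟨c, hc1, hc2⟩ := exists_between (X.deformation.limsup_lt h)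
    have hev := eventually_lt_of_limsup_lt hc1
      ⟨X.M, eventually_map.2 (Eventually.of_forall fun s => X.h_le (by rw [h]; trivial))⟩
    obtain ⟨Q, hQ, hsub⟩ := mem_cocompact.1 hev
    exact ⟨Q, c, hQ, hc2, fun s _ hs => (show X.h s < c from hsub hs).le⟩

/-- Three regions: near `0` the expansion of `h` gives `s²/2 ≥ tanh² s / 2`; on a compact set away
from `0` the strict maximum gives a positive gap; far out the gap is `M - c`. In the last two
regions `tanh² < 1` suffices. -/
theorem exists_mul_tanh_sq_le : ∃ m : ℝ, 0 < m ∧ ∀ s ∈ X.I, m * Real.tanh s ^ 2 ≤ X.M - X.h s := by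
  obtain ⟨C, hC0, hC⟩ := X.deformation.expansion.exists_pos
  obtain ⟨δ, hδ, hball⟩ := Metric.eventually_nhds_iff.1 hC.bound
  -- Within this radius the cubic error is at most half of the quadratic term.
  let r := min (δ / 2) (1 / (2 * C))
  have hr : 0 < r := by positivity
  have hnear : ∀ s, |s| ≤ r → 1 / 2 * s ^ 2 ≤ X.M - X.h s := by
    intro s hs
    have h1 := hball (y := s) (by
      rw [Real.dist_0_eq_abs]
      linarith [hs.trans (min_le_left (δ / 2) (1 / (2 * C)))])
    simp only [Real.norm_eq_abs, abs_abs, abs_pow] at h1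
    have h2 : C * |s| ^ 3 ≤ 1 / 2 * s ^ 2 := by
      have h3 : C * |s| ≤ 1 / 2 := by
        have := hs.trans (min_le_right (δ / 2) (1 / (2 * C)))
        rw [le_div_iff₀ (by positivity)] at this
        linarith
      calc C * |s| ^ 3 = C * |s| * s ^ 2 := by rw [← sq_abs s]; ring
        _ ≤ 1 / 2 * s ^ 2 := by gcongr
    have h3 := (abs_le.1 h1).2
    linarith
  obtain ⟨Q, c, hQ, hc, hQc⟩ := X.exists_compact_h_le
  have hcomp : IsCompact (Q ∩ (X.I ∩ {s | r ≤ |s|})) :=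
    hQ.inter_right (X.isClosed_I.inter (isClosed_le continuous_const continuous_abs))
  obtain ⟨d, hd0, hd⟩ : ∃ d : ℝ, 0 < d ∧ ∀ s ∈ Q ∩ (X.I ∩ {s | r ≤ |s|}), d ≤ X.M - X.h s := by
    rcases (Q ∩ (X.I ∩ {s | r ≤ |s|})).eq_empty_or_nonempty with he | hne
    · exact ⟨1, one_pos, by simp [he]⟩
    · obtain ⟨s₀, hs₀, hmax⟩ := hcomp.exists_isMaxOn hne
        (X.deformation.continuousOn.mono fun s hs => hs.2.1)
      refine ⟨X.M - X.h s₀, ?_, fun s hs => ?_⟩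
      · have : s₀ ≠ 0 := fun h0 => by
          have := hs₀.2.2
          rw [h0, mem_ofPred_eq, abs_zero] at this
          linarith
        linarith [X.deformation.unique_max s₀ hs₀.2.1 this]
      · linarith [show X.h s ≤ X.h s₀ from hmax hs]
  refine ⟨min (1 / 2) (min d (X.M - c)), lt_min (by norm_num) (lt_min hd0 (by linarith)),
    fun s hs => ?_⟩
  have ht := tanh_sq_lt_one s
  have ht0 := sq_nonneg (Real.tanh s)
  by_cases h1 : |s| ≤ r
  · refine le_trans ?_ (hnear s h1)
    exact mul_le_mul (min_le_left _ _) (tanh_sq_le_sq s) ht0 (by norm_num)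
  · have hmin : ∀ e, 0 < e → min (1 / 2) (min d (X.M - c)) ≤ e →
        min (1 / 2) (min d (X.M - c)) * Real.tanh s ^ 2 ≤ e := fun e he hle =>
      (mul_le_mul hle ht.le ht0 he.le).trans_eq (mul_one e)
    by_cases h2 : s ∈ Q
    · exact (hmin d hd0 ((min_le_right _ _).trans (min_le_left _ _))).trans
        (hd s ⟨h2, hs, (not_le.1 h1).le⟩)
    · have := hmin (X.M - c) (by linarith) ((min_le_right _ _).trans (min_le_right _ _))
      linarith [hQc s hs h2]

/-- The effective potential has a non-degenerate minimum at `0`. -/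
theorem exists_mul_tanh_sq_le_inv_sq : ∃ κ : ℝ, 0 < κ ∧ ∀ s ∈ X.I,
    κ * Real.tanh s ^ 2 ≤ 1 / X.h s ^ 2 - 1 / X.M ^ 2 := by
  obtain ⟨m, hm, h⟩ := X.exists_mul_tanh_sq_le
  have hM := X.deformation.max_pos
  -- The factor `M⁻³` comes from `1/h² - 1/M² = (M - h)(M + h)/(h² M²) ≥ (M - h)/M³`, valid since `h
  -- ≤ M`.
  refine ⟨m / X.M ^ 3, by positivity, fun s hs => ?_⟩
  have h1 := X.h_pos hs
  have h2 := X.h_le hs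
  calc m / X.M ^ 3 * Real.tanh s ^ 2 = (m * Real.tanh s ^ 2) / X.M ^ 3 := by ring
    _ ≤ (X.M - X.h s) / X.M ^ 3 := by gcongr; exact h s hs
    _ ≤ _ := by
      rw [div_sub_div _ _ (by positivity) (by positivity), div_le_div_iff₀ (by positivity)
        (by positivity)]
      have h3 : X.h s ^ 2 ≤ X.M * (X.M + X.h s) := by nlinarith
      have h4 : 0 ≤ X.M - X.h s := by linarith
      have h5 : (1 * X.M ^ 2 - X.h s ^ 2 * 1) * X.M ^ 3 - (X.M - X.h s) * (X.h s ^ 2 * X.M ^ 2) =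
        (X.M - X.h s) * X.M ^ 2 * (X.M * (X.M + X.h s) - X.h s ^ 2) := by ring
      have h6 : 0 ≤ (X.M - X.h s) * X.M ^ 2 * (X.M * (X.M + X.h s) - X.h s ^ 2) :=
        mul_nonneg (by positivity) (by linarith)
      linarith

end DeformedTube

end ThinTube

namespace ThinTube

namespace DeformedTube

variable (X : DeformedTube)

/-! ### Measurability of the coefficients -/

theorem isOpen_Ω : IsOpen X.Ω := isOpen_interior.prod X.isOpen_section

theorem mem_I {z : Coord} (hz : z ∈ X.Ω) : z.1 ∈ X.I := interior_subset hz.1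

theorem mem_S {z : Coord} (hz : z ∈ X.Ω) : z.2 ∈ X.S := hz.2

theorem I_mem_nhds_of_mem_interior {s : ℝ} (hs : s ∈ interior X.I) : X.I ∈ 𝓝 s :=
  mem_interior_iff_mem_nhds.1 hs

theorem ae_mem_Ω : ∀ᵐ z ∂X.μ, z ∈ X.Ω := ae_restrict_mem X.isOpen_Ω.measurableSet

theorem μ_eq_prod :
    X.μ = (volume.restrict (interior X.I)).prod (volume.restrict X.S) := by
  rw [μ, Ω, Measure.volume_eq_prod, Measure.prod_restrict]

theorem aemeasurable_comp_fst {f : ℝ → ℝ} (hf : AEMeasurable f (volume.restrict (interior X.I))) :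
    AEMeasurable (fun z : Coord => f z.1) X.μ := by
  rw [μ_eq_prod]
  exact hf.comp_quasiMeasurePreserving Measure.quasiMeasurePreserving_fst

theorem aemeasurable_h : AEMeasurable X.h (volume.restrict (interior X.I)) :=
  (X.deformation.continuousOn.mono interior_subset).aemeasurable isOpen_interior.measurableSet

/-- In the interior this is the ordinary derivative, which is measurable for every function. -/
theorem aemeasurable_derivWithin (f : ℝ → ℝ) :
    AEMeasurable (derivWithin f X.I) (volume.restrict (interior X.I)) := by
  refine (measurable_deriv f).aemeasurable.congr ?_
  filter_upwards [ae_restrict_mem isOpen_interior.measurableSet] with s hs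
  rw [derivWithin_of_mem_nhds (X.I_mem_nhds_of_mem_interior hs)]

theorem aemeasurable_logDeriv : AEMeasurable X.logDeriv (volume.restrict (interior X.I)) :=
  (X.aemeasurable_derivWithin X.h).div X.aemeasurable_h

/-- Curvature and torsion come without a measurability assumption. They are recovered from the
frame, as `k = ⟨N, T'⟩` and `τ = ⟨B, N'⟩`, and derivatives are measurable. -/
theorem aestronglyMeasurable_inner_deriv {F G : ℝ → Space} {f : ℝ → ℝ}
    (hF : ContinuousOn F X.I)
    (hf : ∀ s ∈ interior X.I, inner ℝ (F s) (deriv G s) = f s) :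
    AEMeasurable f (volume.restrict (interior X.I)) := by
  have h1 : AEMeasurable F (volume.restrict (interior X.I)) :=
    (hF.mono interior_subset).aemeasurable isOpen_interior.measurableSet
  refine (h1.inner (𝕜 := ℝ) (measurable_deriv G).aemeasurable).congr ?_
  filter_upwards [ae_restrict_mem isOpen_interior.measurableSet] with s hs
  exact hf s hs

theorem inner_binormal_tangent {s : ℝ} (hs : s ∈ X.I) : inner ℝ (X.B s) (X.T s) = 0 := by
  rw [X.frenet.binormal s hs, EuclideanSpace.inner_eq_star_dotProduct, star_trivial]
  exact dot_self_cross _ _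

theorem norm_binormal {s : ℝ} (hs : s ∈ X.I) : inner ℝ (X.B s) (X.B s) = (1 : ℝ) := by
  have h1 := X.frenet.norm_tangent s hs
  have h2 := X.frenet.norm_normal s hs
  have h3 := X.frenet.orthogonal s hs
  have h1' : inner ℝ (X.T s) (X.T s) = (1 : ℝ) := by simp [h1]
  have h2' : inner ℝ (X.N s) (X.N s) = (1 : ℝ) := by simp [h2]
  rw [EuclideanSpace.inner_eq_star_dotProduct, star_trivial] at h1' h2' h3
  rw [X.frenet.binormal s hs, EuclideanSpace.inner_eq_star_dotProduct, star_trivial,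
    cross_dot_cross, h1', h2', dotProduct_comm, h3]
  simp

theorem aemeasurable_k : AEMeasurable X.k (volume.restrict (interior X.I)) := by
  refine X.aestronglyMeasurable_inner_deriv (F := X.N) (G := X.T)
    (fun s hs => (X.frenet.frenet_normal s hs).continuousWithinAt) fun s hs => ?_
  have hI := X.I_mem_nhds_of_mem_interior hs
  have hs' := interior_subset hs
  rw [((X.frenet.frenet_tangent s hs').hasDerivAt hI).deriv, inner_smul_right,
    real_inner_self_eq_norm_sq, X.frenet.norm_normal s hs']
  simp

theorem aemeasurable_τ : AEMeasurable X.τ (volume.restrict (interior X.I)) := by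
  refine X.aestronglyMeasurable_inner_deriv (F := X.B) (G := X.N)
    (fun s hs => (X.frenet.frenet_binormal s hs).continuousWithinAt) fun s hs => ?_
  have hI := X.I_mem_nhds_of_mem_interior hs
  have hs' := interior_subset hs
  rw [((X.frenet.frenet_normal s hs').hasDerivAt hI).deriv, inner_add_right, inner_smul_right,
    inner_smul_right, X.inner_binormal_tangent hs', X.norm_binormal hs']
  simp

theorem aemeasurable_twist : AEMeasurable X.twist (volume.restrict (interior X.I)) :=
  X.aemeasurable_τ.add (X.aemeasurable_derivWithin X.α)

theorem aemeasurable_α : AEMeasurable X.α (volume.restrict (interior X.I)) :=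
  (X.differentiableOn_angle.continuousOn.mono interior_subset).aemeasurable
    isOpen_interior.measurableSet

theorem inner_zα (s : ℝ) (y : Plane) :
    inner ℝ (X.zα s) y = Real.cos (X.α s) * y 0 - Real.sin (X.α s) * y 1 := by
  simp [zα, PiLp.inner_apply, Fin.sum_univ_two]
  ring

theorem norm_zα (s : ℝ) : ‖X.zα s‖ = 1 := by
  rw [EuclideanSpace.norm_eq]
  simp [zα, Fin.sum_univ_two]

theorem aemeasurable_beta (ε : ℝ) : AEMeasurable (X.beta ε) X.μ := by
  have h1 := X.aemeasurable_comp_fst X.aemeasurable_h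
  have h2 := X.aemeasurable_comp_fst X.aemeasurable_k
  have h3 := X.aemeasurable_comp_fst (Real.measurable_cos.comp_aemeasurable X.aemeasurable_α)
  have h4 := X.aemeasurable_comp_fst (Real.measurable_sin.comp_aemeasurable X.aemeasurable_α)
  have h5 : ∀ i : Fin 2, AEMeasurable (fun z : Coord => z.2 i) X.μ := fun i =>
    (Continuous.measurable (by fun_prop)).aemeasurable
  have : X.beta ε = fun z => 1 - ε * X.h z.1 * X.k z.1 *
      (Real.cos (X.α z.1) * z.2 0 - Real.sin (X.α z.1) * z.2 1) := by
    funext z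
    rw [beta, inner_zα]
  rw [this]
  exact ((((h1.const_mul ε).mul h2).mul ((h3.mul (h5 0)).sub (h4.mul (h5 1))))).const_sub 1

/-! ### Bounds for `β` -/

theorem exists_abs_beta_sub_one_le : ∃ C : ℝ, 1 ≤ C ∧ ∀ ε : ℝ, 0 < ε → ∀ z ∈ X.I ×ˢ X.S,
    |X.beta ε z - 1| ≤ C * ε := by
  obtain ⟨K, hK, hk, -, -, hy⟩ := X.exists_bound
  have hM := X.deformation.max_pos
  refine ⟨1 + X.M * K * K, by nlinarith [mul_nonneg (mul_nonneg hM.le (by linarith : 0 ≤ K)) (by linarith : 0 ≤ K)], fun ε hε z hz => ?_⟩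
  have h1 := X.h_pos hz.1
  have h2 : |inner ℝ (X.zα z.1) z.2| ≤ K := by
    refine (abs_real_inner_le_norm _ _).trans ?_
    rw [norm_zα, one_mul]
    exact hy _ hz.2
  have h3 : X.beta ε z - 1 = -(ε * X.h z.1 * X.k z.1 * inner ℝ (X.zα z.1) z.2) := by
    rw [beta]; ring
  rw [h3, abs_neg, abs_mul, abs_mul, abs_mul, abs_of_pos hε, abs_of_pos h1]
  calc ε * X.h z.1 * |X.k z.1| * |inner ℝ (X.zα z.1) z.2| ≤ ε * X.M * K * K := by
        gcongr
        · exact X.h_le hz.1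
        · exact hk _ hz.1
    _ ≤ (1 + X.M * K * K) * ε := by nlinarith

theorem tendstoUniformlyOn_beta :
    TendstoUniformlyOn (fun (ε : ℝ) (z : Coord) => X.beta ε z) (fun _ => 1)
      (𝓝[>] (0 : ℝ)) (X.I ×ˢ X.S) := by
  obtain ⟨C, hC, h⟩ := X.exists_abs_beta_sub_one_le
  rw [Metric.tendstoUniformlyOn_iff]
  intro η hη
  filter_upwards [Ioo_mem_nhdsGT (show (0 : ℝ) < η / C by positivity)] with ε hε z hz
  rw [dist_comm, Real.dist_eq]
  refine (h ε hε.1 z hz).trans_lt ?_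
  have := hε.2
  rw [lt_div_iff₀ (by linarith)] at this
  linarith

end DeformedTube

end ThinTube

namespace ThinTube

/-! ### Integration by parts in the cross section -/

section Section

variable {S : Set Plane} {φ : Plane → ℂ}

/-- The `i`-th unit vector of the plane. -/
noncomputable abbrev unitVec (i : Fin 2) : Plane := EuclideanSpace.single i 1

theorem plane_eq (y : Plane) : y = y 0 • unitVec 0 + y 1 • unitVec 1 := by
  ext i
  fin_cases i <;> simp

theorem rot_eq (y : Plane) : rot y = y 1 • unitVec 0 - y 0 • unitVec 1 := by
  ext i
  fin_cases i <;> simp [rot]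

/-- Integration by parts against a coordinate function. Distinct indices give zero, so rotations are
skew; each pair of equal indices gives `-∫ |φ|²`, so the dilation field contributes this twice. -/
theorem IsTest.integral_coord_mul (hφ : IsTest S φ) (i j : Fin 2) :
    ∫ y in S, y i * (2 * (starRingEnd ℂ (φ y) * fderiv ℝ φ y (unitVec j)).re) =
      -((if i = j then 1 else 0) * ∫ y in S, ‖φ y‖ ^ 2) := by
  rw [setIntegral_eq_integral_of_forall_compl_eq_zero fun y hy => by simp [hφ.eq_zero hy],
    setIntegral_eq_integral_of_forall_compl_eq_zero fun y hy => by simp [hφ.eq_zero hy]]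
  let p : Plane →L[ℝ] ℝ := EuclideanSpace.proj i
  have hp : p (unitVec j) = if i = j then 1 else 0 := by
    simp [p]
  have h := integral_mul_re_conj_mul_fderiv (volume : Measure Plane) p.contDiff
    (hφ.contDiff.of_le (by simp)) hφ.hasCompactSupport (unitVec j)
  simp only [ContinuousLinearMap.fderiv, hp, integral_const_mul] at h
  exact h

theorem IsTest.integrable_coord_mul (hφ : IsTest S φ) (i j : Fin 2) :
    Integrable (fun y => y i * (2 * (starRingEnd ℂ (φ y) * fderiv ℝ φ y (unitVec j)).re))
      (volume.restrict S) := by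
  have := hφ.continuous_fderiv_apply (unitVec j)
  have := hφ.continuous
  refine Integrable.integrableOn (Continuous.integrable_of_hasCompactSupport (by fun_prop) ?_)
  refine hφ.hasCompactSupport.mono fun y hy => ?_
  rw [Function.mem_support] at hy ⊢
  contrapose! hy
  simp [hy]

end Section

namespace DeformedTube

variable {X : DeformedTube}

theorem gradY_rot (V : Coord → Coord →L[ℝ] ℂ) (z : Coord) :
    gradY V z (rot z.2) = (z.2 1 : ℂ) * gradY V z (unitVec 0) - (z.2 0 : ℂ) * gradY V z (unitVec 1) := by
  have h : ((0 : ℝ), rot z.2) = z.2 1 • ((0 : ℝ), unitVec 0) - z.2 0 • ((0 : ℝ), unitVec 1) := by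
    rw [rot_eq]
    simp
  rw [gradY, h, map_sub, map_smul, map_smul, Complex.real_smul, Complex.real_smul]
  rfl

theorem gradY_self (V : Coord → Coord →L[ℝ] ℂ) (z : Coord) :
    gradY V z z.2 = (z.2 0 : ℂ) * gradY V z (unitVec 0) + (z.2 1 : ℂ) * gradY V z (unitVec 1) := by
  have h : ((0 : ℝ), z.2) = z.2 0 • ((0 : ℝ), unitVec 0) + z.2 1 • ((0 : ℝ), unitVec 1) := by
    conv_lhs => rw [plane_eq z.2]
    simp
  rw [gradY, h, map_add, map_smul, map_smul, Complex.real_smul, Complex.real_smul]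
  rfl

theorem longitudinal_eq (v : Coord → ℂ) (V : Coord → Coord →L[ℝ] ℂ) (z : Coord) :
    X.longitudinal v V z = V z (1, 0) - (X.logDeriv z.1 : ℂ) * v z +
      (X.twist z.1 : ℂ) * ((z.2 1 : ℂ) * gradY V z (unitVec 0)
        - (z.2 0 : ℂ) * gradY V z (unitVec 1)) -
      (X.logDeriv z.1 : ℂ) * ((z.2 0 : ℂ) * gradY V z (unitVec 0)
        + (z.2 1 : ℂ) * gradY V z (unitVec 1)) := by
  rw [longitudinal, gradY_rot, gradY_self, twist, logDeriv]
  ring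

/-! ### Slices of test functions -/

theorem isTest_slice {φ : Coord → ℂ} (hφ : IsTest X.Ω φ) (s : ℝ) :
    IsTest X.S fun y => φ (s, y) := by
  have hsub : tsupport (fun y => φ (s, y)) ⊆ (fun y => (s, y)) ⁻¹' tsupport φ :=
    tsupport_comp_subset_preimage (f := fun y : Plane => (s, y)) φ (by fun_prop)
  refine ⟨hφ.contDiff.comp (contDiff_prodMk_right s), ?_, fun y hy =>
    (hφ.tsupport_subset (hsub hy)).2⟩
  refine HasCompactSupport.of_support_subset_isCompact
    (hφ.hasCompactSupport.isCompact.image continuous_snd) fun y hy => ?_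
  exact ⟨(s, y), hsub (subset_tsupport _ hy), rfl⟩

theorem fderiv_slice {φ : Coord → ℂ} (hφ : IsTest X.Ω φ) (s : ℝ) (y w : Plane) :
    fderiv ℝ (fun y => φ (s, y)) y w = gradY (fderiv ℝ φ) (s, y) w := by
  have h1 : HasFDerivAt (fun y : Plane => (s, y)) (ContinuousLinearMap.inr ℝ ℝ Plane) y :=
    hasFDerivAt_prodMk_right s y
  have h2 := (hφ.differentiable (s, y)).hasFDerivAt.comp y h1
  rw [show fderiv ℝ (fun y => φ (s, y)) y = _ from h2.fderiv]
  rfl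

theorem integrable_bdd_mul {c F : Coord → ℝ} {C : ℝ} (hc : AEMeasurable c X.μ)
    (hb : ∀ z ∈ X.Ω, |c z| ≤ C) (hF : Integrable F X.μ) : Integrable (fun z => c z * F z) X.μ := by
  refine hF.bdd_mul (c := C) hc.aestronglyMeasurable ?_
  filter_upwards [X.ae_mem_Ω] with z hz
  exact hb z hz

/-- Fubini: a coefficient that depends on `s` alone comes out of the integral over the cross
section. -/
theorem integral_mul_fst {a : ℝ → ℝ} {F : Coord → ℝ}
    (hint : Integrable (fun z : Coord => a z.1 * F z) X.μ) :
    ∫ z, a z.1 * F z ∂X.μ = ∫ s in interior X.I, a s * ∫ y in X.S, F (s, y) := by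
  rw [X.μ_eq_prod] at hint ⊢
  rw [integral_prod _ hint]
  simp only [integral_const_mul]

/-! ### Boundedness of the longitudinal derivative -/

instance : (volume : Measure Coord).IsAddHaarMeasure :=
  inferInstanceAs ((volume : Measure ℝ).prod (volume : Measure Plane)).IsAddHaarMeasure

instance : IsFiniteMeasureOnCompacts X.μ := by
  unfold μ
  infer_instance

theorem longitudinal_sub (v w : Coord → ℂ) (V W : Coord → Coord →L[ℝ] ℂ) (z : Coord) :
    X.longitudinal (v - w) (V - W) z = X.longitudinal v V z - X.longitudinal w W z := by
  simp only [longitudinal, gradY, Pi.sub_apply, sub_apply]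
  ring

theorem norm_gradY_le (V : Coord → Coord →L[ℝ] ℂ) (z : Coord) (w : Plane) :
    ‖gradY V z w‖ ≤ ‖V z‖ * ‖w‖ := by
  simpa [gradY] using (V z).le_opNorm (0, w)

theorem norm_rot (y : Plane) : ‖rot y‖ = ‖y‖ := by
  simp [EuclideanSpace.norm_eq, rot, Fin.sum_univ_two, add_comm]

theorem exists_norm_longitudinal_le (X : DeformedTube) : ∃ C : ℝ, 0 < C ∧
    ∀ (v : Coord → ℂ) (V : Coord → Coord →L[ℝ] ℂ), ∀ z ∈ X.Ω,
      ‖X.longitudinal v V z‖ ≤ C * (‖v z‖ + ‖V z‖) := by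
  obtain ⟨K, hK, -, hq, hω, hy⟩ := X.exists_bound
  refine ⟨1 + K + 2 * (K * K), by positivity, fun v V z hz => ?_⟩
  have h1 : ‖V z (1, 0)‖ ≤ ‖V z‖ := by simpa using (V z).le_opNorm (1, 0)
  have h2 := hy _ (X.mem_S hz)
  have h3 : ‖gradY V z (rot z.2)‖ ≤ ‖V z‖ * K := by
    refine (norm_gradY_le V z _).trans ?_
    rw [norm_rot]
    gcongr
  have h4 : ‖gradY V z z.2‖ ≤ ‖V z‖ * K := (norm_gradY_le V z _).trans (by gcongr)
  have h5 : ‖((X.logDeriv z.1 : ℝ) : ℂ)‖ ≤ K := by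
    rw [Complex.norm_real]
    exact hq _ (X.mem_I hz)
  have h6 : ‖((X.twist z.1 : ℝ) : ℂ)‖ ≤ K := by
    rw [Complex.norm_real]
    exact hω _ (X.mem_I hz)
  have h7 : X.longitudinal v V z = V z (1, 0) - v z * (X.logDeriv z.1 : ℂ) +
      gradY V z (rot z.2) * (X.twist z.1 : ℂ) - gradY V z z.2 * (X.logDeriv z.1 : ℂ) := rfl
  rw [h7]
  calc _ ≤ ‖V z (1, 0)‖ + ‖v z * (X.logDeriv z.1 : ℂ)‖ +
        ‖gradY V z (rot z.2) * (X.twist z.1 : ℂ)‖ + ‖gradY V z z.2 * (X.logDeriv z.1 : ℂ)‖ :=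
        (norm_sub_le _ _).trans (add_le_add_left ((norm_add_le _ _).trans
          (add_le_add_left (norm_sub_le _ _) _)) _)
    _ ≤ ‖V z‖ + ‖v z‖ * K + ‖V z‖ * K * K + ‖V z‖ * K * K := by
        simp only [norm_mul]
        gcongr
    _ ≤ _ := by nlinarith [norm_nonneg (v z), norm_nonneg (V z),
        mul_nonneg (norm_nonneg (v z)) (by nlinarith : 0 ≤ K * K)]

theorem aestronglyMeasurable_longitudinal {v : Coord → ℂ} {V : Coord → Coord →L[ℝ] ℂ}
    (hv : AEStronglyMeasurable v X.μ) (hV : AEStronglyMeasurable V X.μ) :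
    AEStronglyMeasurable (X.longitudinal v V) X.μ := by
  have h1 : ∀ w, AEStronglyMeasurable (fun z => V z w) X.μ := fun w =>
    hV.apply_continuousLinearMap w
  have h2 : AEStronglyMeasurable (fun z : Coord => (X.logDeriv z.1 : ℂ)) X.μ :=
    (Complex.measurable_ofReal.comp_aemeasurable
      (X.aemeasurable_comp_fst X.aemeasurable_logDeriv)).aestronglyMeasurable
  have h3 : AEStronglyMeasurable (fun z : Coord => (X.twist z.1 : ℂ)) X.μ :=
    (Complex.measurable_ofReal.comp_aemeasurable
      (X.aemeasurable_comp_fst X.aemeasurable_twist)).aestronglyMeasurable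
  have h4 : ∀ i : Fin 2, AEStronglyMeasurable (fun z : Coord => (z.2 i : ℂ)) X.μ := fun i =>
    (by fun_prop : Continuous fun z : Coord => (z.2 i : ℂ)).aestronglyMeasurable
  have h5 : X.longitudinal v V = _ := funext (longitudinal_eq v V)
  rw [h5]
  exact (((h1 _).sub (h2.mul hv)).add (h3.mul (((h4 1).mul (h1 _)).sub ((h4 0).mul (h1 _))))).sub
    (h2.mul (((h4 0).mul (h1 _)).add ((h4 1).mul (h1 _))))

theorem memLp_longitudinal {v : Coord → ℂ} {V : Coord → Coord →L[ℝ] ℂ}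
    (hv : MemLp v 2 X.μ) (hV : MemLp V 2 X.μ) : MemLp (X.longitudinal v V) 2 X.μ := by
  obtain ⟨C, -, hC⟩ := X.exists_norm_longitudinal_le
  refine MemLp.of_le_mul (g := fun z => ‖v z‖ + ‖V z‖) (c := C) (hv.norm.add hV.norm)
    (aestronglyMeasurable_longitudinal hv.1 hV.1) ?_
  filter_upwards [X.ae_mem_Ω] with z hz
  rw [Real.norm_of_nonneg (by positivity)]
  exact hC v V z hz

theorem memLp_gradY {V : Coord → Coord →L[ℝ] ℂ} (hV : MemLp V 2 X.μ) (w : Plane) :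
    MemLp (fun z => gradY V z w) 2 X.μ := by
  refine MemLp.of_le_mul (g := V) (c := ‖w‖) hV
    (hV.1.apply_continuousLinearMap ((0 : ℝ), w)) (Eventually.of_forall fun z => ?_)
  rw [mul_comm]
  exact norm_gradY_le V z w

/-! ### Lower bounds for test functions -/

/-- Skew-symmetry of `D`, tested with the multiplier `tanh s`: only the commutator with the
multiplier, its derivative `1 - tanh²`, survives. The coefficients `h'/h` and `τ + α'` depend on `s`
alone and their terms are integrated by parts in `y` only, so they are never differentiated. -/
theorem integral_tanh_mul_re_longitudinal {φ : Coord → ℂ} (hφ : IsTest X.Ω φ) :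
    ∫ z, Real.tanh z.1 * (2 * (starRingEnd ℂ (φ z) * X.longitudinal φ (fderiv ℝ φ) z).re) ∂X.μ =
      -∫ z, (1 - Real.tanh z.1 ^ 2) * ‖φ z‖ ^ 2 ∂X.μ := by
  obtain ⟨K, hK, -, hq, hω, hy⟩ := X.exists_bound
  have htanh : ∀ s, |Real.tanh s| ≤ 1 := fun s =>
    abs_le_one_iff_mul_self_le_one.2 (by nlinarith [tanh_sq_lt_one s])
  have hct : Continuous Real.tanh := contDiff_tanh.continuous
  have hmt : AEMeasurable Real.tanh (volume.restrict (interior X.I)) := hct.aemeasurable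
  let F : Coord → ℝ := fun z => ‖φ z‖ ^ 2
  let G : Coord → ℝ := fun z => 2 * (starRingEnd ℂ (φ z) * fderiv ℝ φ z (1, 0)).re
  let g : Fin 2 → Coord → ℝ := fun i z =>
    2 * (starRingEnd ℂ (φ z) * gradY (fderiv ℝ φ) z (unitVec i)).re
  have hcont : ∀ w, Continuous fun z => fderiv ℝ φ z w := hφ.continuous_fderiv_apply
  have hcont' : ∀ w, Continuous fun z => gradY (fderiv ℝ φ) z w := fun w => hcont (0, w)
  have hcφ := hφ.continuous
  have hint : ∀ H : Coord → ℝ, Continuous H → (∀ z, φ z = 0 → H z = 0) → Integrable H X.μ := by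
    intro H hH h0
    refine hH.integrable_of_hasCompactSupport (hφ.hasCompactSupport.mono fun z hz => ?_)
    exact fun h => hz (h0 z h)
  have iF : Integrable F X.μ := hint _ (by fun_prop) fun z hz => by simp [F, hz]
  have iG : Integrable (fun z => Real.tanh z.1 * G z) X.μ := by
    have := hcont (1, 0)
    exact hint _ (by fun_prop) fun z hz => by simp [G, hz]
  have h01 := hcont' (unitVec 0)
  have h02 := hcont' (unitVec 1)
  have iR : Integrable (fun z => z.2 1 * g 0 z - z.2 0 * g 1 z) X.μ :=
    hint _ (by fun_prop) fun z hz => by simp [g, hz]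
  have iD : Integrable (fun z => z.2 0 * g 0 z + z.2 1 * g 1 z) X.μ :=
    hint _ (by fun_prop) fun z hz => by simp [g, hz]
  -- The coefficients are known to be measurable and bounded, not continuous, so integrability is
  -- inherited from the other factor.
  have hF : ∀ c : ℝ → ℝ, AEMeasurable c (volume.restrict (interior X.I)) →
      (∀ s ∈ X.I, |c s| ≤ K) → ∀ H : Coord → ℝ, Integrable H X.μ →
      Integrable (fun z => (Real.tanh z.1 * c z.1) * H z) X.μ := by
    intro c hc hcK H hH
    refine integrable_bdd_mul (C := K) (X.aemeasurable_comp_fst (hmt.mul hc)) (fun z hz => ?_) hH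
    rw [abs_mul]
    calc |Real.tanh z.1| * |c z.1| ≤ 1 * K :=
          mul_le_mul (htanh _) (hcK _ (X.mem_I hz)) (abs_nonneg _) zero_le_one
      _ = K := one_mul K
  have k1 := hF _ X.aemeasurable_logDeriv hq F iF
  have k2 := hF _ X.aemeasurable_twist hω _ iR
  have k3 := hF _ X.aemeasurable_logDeriv hq _ iD
  have hpt : ∀ z, Real.tanh z.1 *
      (2 * (starRingEnd ℂ (φ z) * X.longitudinal φ (fderiv ℝ φ) z).re) =
      Real.tanh z.1 * G z - 2 * ((Real.tanh z.1 * X.logDeriv z.1) * F z) +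
      (Real.tanh z.1 * X.twist z.1) * (z.2 1 * g 0 z - z.2 0 * g 1 z) -
      (Real.tanh z.1 * X.logDeriv z.1) * (z.2 0 * g 0 z + z.2 1 * g 1 z) := by
    intro z
    simp only [F, G, g]
    rw [longitudinal_eq, ← Complex.normSq_eq_norm_sq, Complex.normSq_apply]
    simp only [Complex.add_re, Complex.add_im, Complex.sub_re, Complex.sub_im, Complex.mul_re,
      Complex.mul_im, Complex.ofReal_re, Complex.ofReal_im, Complex.conj_re, Complex.conj_im]
    ring
  have e1 : ∫ z, (Real.tanh z.1 * X.twist z.1) * (z.2 1 * g 0 z - z.2 0 * g 1 z) ∂X.μ = 0 := by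
    rw [integral_mul_fst (a := fun s => Real.tanh s * X.twist s) k2]
    refine integral_eq_zero_of_ae (Eventually.of_forall fun s => ?_)
    have hs := isTest_slice hφ s
    simp only [g, ← fderiv_slice hφ]
    rw [integral_sub (hs.integrable_coord_mul 1 0) (hs.integrable_coord_mul 0 1),
      hs.integral_coord_mul, hs.integral_coord_mul]
    simp
  -- The dilation of the two-dimensional cross section yields `-2 ∫ tanh (h'/h) |φ|²`, which cancels
  -- the contribution of the term `-v h'/h`.
  have e2 : ∫ z, (Real.tanh z.1 * X.logDeriv z.1) * (z.2 0 * g 0 z + z.2 1 * g 1 z) ∂X.μ =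
      -(2 * ∫ z, (Real.tanh z.1 * X.logDeriv z.1) * F z ∂X.μ) := by
    rw [integral_mul_fst (a := fun s => Real.tanh s * X.logDeriv s) k3,
      integral_mul_fst (a := fun s => Real.tanh s * X.logDeriv s) k1, ← integral_const_mul,
      ← integral_neg]
    refine integral_congr_ae (Eventually.of_forall fun s => ?_)
    have hs := isTest_slice hφ s
    simp only [g, ← fderiv_slice hφ]
    rw [integral_add (hs.integrable_coord_mul 0 0) (hs.integrable_coord_mul 1 1),
      hs.integral_coord_mul, hs.integral_coord_mul]
    simp only [if_true]
    ring
  -- Since `φ` vanishes outside `Ω`, the integral extends to the whole space and no boundary terms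
  -- arise at the ends of `I`.
  have e3 : ∫ z, Real.tanh z.1 * G z ∂X.μ = -∫ z, (1 - Real.tanh z.1 ^ 2) * ‖φ z‖ ^ 2 ∂X.μ := by
    rw [μ, setIntegral_eq_integral_of_forall_compl_eq_zero fun z hz => by simp [G, hφ.eq_zero hz],
      setIntegral_eq_integral_of_forall_compl_eq_zero fun z hz => by simp [hφ.eq_zero hz]]
    have h1 := integral_mul_re_conj_mul_fderiv (volume : Measure Coord)
      (contDiff_tanh.comp contDiff_fst) (hφ.contDiff.of_le (by simp)) hφ.hasCompactSupport (1, 0)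
    have h2 : ∀ z : Coord, fderiv ℝ (Real.tanh ∘ Prod.fst) z (1, 0) = 1 - Real.tanh z.1 ^ 2 := by
      intro z
      have h3 := (hasDerivAt_tanh z.1).comp_hasFDerivAt z (hasFDerivAt_fst (𝕜 := ℝ) (p := z))
      rw [h3.fderiv]
      simp
    simp only [h2] at h1
    exact h1
  simp only [hpt]
  have i4 : Integrable (fun z => Real.tanh z.1 * G z - 2 * ((Real.tanh z.1 * X.logDeriv z.1) * F z))
      X.μ := iG.sub (k1.const_mul 2)
  have i5 : Integrable (fun z => Real.tanh z.1 * G z - 2 * ((Real.tanh z.1 * X.logDeriv z.1) * F z) +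
      (Real.tanh z.1 * X.twist z.1) * (z.2 1 * g 0 z - z.2 0 * g 1 z)) X.μ := i4.add k2
  rw [integral_sub i5 k3, integral_add i4 k2, integral_sub iG (k1.const_mul 2), e1, e2, e3,
    integral_const_mul]
  ring

/-- Uncertainty principle: a function concentrated near `s = 0` has large longitudinal energy. Write
`1 = (1 - tanh²) + tanh²`, use the preceding identity for the first part, and estimate its left hand
side by Young's inequality. -/
theorem integral_norm_sq_le_longitudinal_of_isTest {φ : Coord → ℂ} (hφ : IsTest X.Ω φ) {t : ℝ}
    (ht : 0 < t) :
    ∫ z, ‖φ z‖ ^ 2 ∂X.μ ≤ t * ∫ z, ‖X.longitudinal φ (fderiv ℝ φ) z‖ ^ 2 ∂X.μ +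
      (1 + t⁻¹) * ∫ z, Real.tanh z.1 ^ 2 * ‖φ z‖ ^ 2 ∂X.μ := by
  have h := integral_tanh_mul_re_longitudinal hφ
  have i0 : Integrable (fun z => ‖φ z‖ ^ 2) X.μ := hφ.integrable_norm_sq _
  have i1 : Integrable (fun z => ‖X.longitudinal φ (fderiv ℝ φ) z‖ ^ 2) X.μ :=
    (memLp_longitudinal (hφ.memLp _) (hφ.memLp_fderiv _)).integrable_norm_pow two_ne_zero
  have hct : Continuous Real.tanh := contDiff_tanh.continuous
  have i2 : Integrable (fun z => Real.tanh z.1 ^ 2 * ‖φ z‖ ^ 2) X.μ := by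
    refine integrable_bdd_mul (C := 1) (by fun_prop) (fun z hz => ?_) i0
    rw [abs_of_nonneg (sq_nonneg _)]
    exact (tanh_sq_lt_one _).le
  have hR : Integrable (fun z => t * ‖X.longitudinal φ (fderiv ℝ φ) z‖ ^ 2 +
      t⁻¹ * (Real.tanh z.1 ^ 2 * ‖φ z‖ ^ 2)) X.μ := (i1.const_mul t).add (i2.const_mul _)
  have hpt : ∀ z, |Real.tanh z.1 *
      (2 * (starRingEnd ℂ (φ z) * X.longitudinal φ (fderiv ℝ φ) z).re)| ≤
      t * ‖X.longitudinal φ (fderiv ℝ φ) z‖ ^ 2 + t⁻¹ * (Real.tanh z.1 ^ 2 * ‖φ z‖ ^ 2) := by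
    intro z
    have h1 := two_mul_re_conj_mul_le ((Real.tanh z.1 : ℂ) * φ z)
      (X.longitudinal φ (fderiv ℝ φ) z) (inv_pos.2 ht)
    have h2 : Real.tanh z.1 * (2 * (starRingEnd ℂ (φ z) * X.longitudinal φ (fderiv ℝ φ) z).re) =
        2 * (starRingEnd ℂ ((Real.tanh z.1 : ℂ) * φ z) * X.longitudinal φ (fderiv ℝ φ) z).re := by
      rw [map_mul, Complex.conj_ofReal, mul_assoc, Complex.re_ofReal_mul]
      ring
    rw [norm_mul, Complex.norm_real, mul_pow, Real.norm_eq_abs, sq_abs, inv_inv] at h1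
    rw [h2]
    linarith
  have hL : Integrable (fun z => Real.tanh z.1 *
      (2 * (starRingEnd ℂ (φ z) * X.longitudinal φ (fderiv ℝ φ) z).re)) X.μ := by
    refine hR.mono' ?_ (Eventually.of_forall hpt)
    have hm : AEStronglyMeasurable (fun z => starRingEnd ℂ (φ z) *
        X.longitudinal φ (fderiv ℝ φ) z) X.μ :=
      (Complex.continuous_conj.comp hφ.continuous).aestronglyMeasurable.mul
        (aestronglyMeasurable_longitudinal (hφ.memLp _).1 (hφ.memLp_fderiv _).1)
    exact (hct.comp continuous_fst).aestronglyMeasurable.mul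
      ((Complex.continuous_re.comp_aestronglyMeasurable hm).const_mul 2)
  have key : -∫ z, Real.tanh z.1 *
      (2 * (starRingEnd ℂ (φ z) * X.longitudinal φ (fderiv ℝ φ) z).re) ∂X.μ ≤
      ∫ z, (t * ‖X.longitudinal φ (fderiv ℝ φ) z‖ ^ 2 +
        t⁻¹ * (Real.tanh z.1 ^ 2 * ‖φ z‖ ^ 2)) ∂X.μ := by
    rw [← integral_neg]
    exact integral_mono hL.neg hR fun z => (neg_le_abs _).trans (hpt z)
  rw [h, neg_neg, integral_add (i1.const_mul t) (i2.const_mul _), integral_const_mul,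
    integral_const_mul] at key
  simp only [sub_mul, one_mul] at key
  rw [integral_sub i0 i2] at key
  linarith

/-- The weighted eigenvalue inequality on every slice, multiplied by `a(s) ≥ 0` and integrated over
`s`. Here `a` stands for a truncation of `1/h²`, and its upper bound `C` serves only integrability.
-/
theorem firstEigenvalue_mul_le_of_isTest {φ : Coord → ℂ} (hφ : IsTest X.Ω φ) {ε : ℝ}
    (hβ : ∀ z ∈ X.Ω, 1 / 2 ≤ X.beta ε z ∧ X.beta ε z ≤ 2) {a : ℝ → ℝ} {C : ℝ}
    (ha : AEMeasurable a (volume.restrict (interior X.I)))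
    (ha0 : ∀ s ∈ interior X.I, 0 ≤ a s) (haC : ∀ s ∈ interior X.I, a s ≤ C) :
    firstEigenvalue X.S * ∫ z, a z.1 * X.beta ε z * ‖φ z‖ ^ 2 ∂X.μ ≤
      ∫ z, a z.1 * X.beta ε z * ‖gradY (fderiv ℝ φ) z (unitVec 0)‖ ^ 2 ∂X.μ +
      ∫ z, a z.1 * X.beta ε z * ‖gradY (fderiv ℝ φ) z (unitVec 1)‖ ^ 2 ∂X.μ +
      ∫ z, a z.1 * (ε * X.h z.1 * X.k z.1) ^ 2 / 2 * ‖φ z‖ ^ 2 ∂X.μ := by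
  have ha' := X.aemeasurable_comp_fst ha
  have hb' := X.aemeasurable_beta ε
  have hh' := X.aemeasurable_comp_fst X.aemeasurable_h
  have hk' := X.aemeasurable_comp_fst X.aemeasurable_k
  obtain ⟨K, hK, hk, -⟩ := X.exists_bound
  have hC : ∀ z ∈ X.Ω, |a z.1 * X.beta ε z| ≤ C * 2 := fun z hz => by
    have h1 := ha0 _ hz.1
    have h2 := haC _ hz.1
    have h3 := hβ z hz
    rw [abs_of_nonneg (mul_nonneg h1 (by linarith))]
    exact mul_le_mul h2 h3.2 (by linarith) (h1.trans h2)
  have hC2 : ∀ z ∈ X.Ω, |a z.1 * (ε * X.h z.1 * X.k z.1) ^ 2 / 2| ≤ C * (ε * X.M * K) ^ 2 / 2 := by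
    intro z hz
    have h1 := ha0 _ hz.1
    have h2 := haC _ hz.1
    rw [abs_of_nonneg (by positivity)]
    gcongr ?_ / 2
    refine mul_le_mul h2 ?_ (by positivity) (h1.trans h2)
    rw [sq_le_sq, abs_mul, abs_mul, abs_mul, abs_mul]
    have h3 := X.h_pos (X.mem_I hz)
    have h4 := X.h_le (X.mem_I hz)
    have h5 : |X.h z.1| ≤ |X.M| := by
      rwa [abs_of_pos h3, abs_of_pos X.deformation.max_pos]
    have h6 : |X.k z.1| ≤ |K| := (hk _ (X.mem_I hz)).trans (le_abs_self K)
    gcongr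
  have i0 : Integrable (fun z => ‖φ z‖ ^ 2) X.μ := hφ.integrable_norm_sq _
  have i1 : ∀ w, Integrable (fun z => ‖gradY (fderiv ℝ φ) z w‖ ^ 2) X.μ :=
    fun w => hφ.integrable_fderiv_norm_sq _ _
  have j0 : Integrable (fun z => a z.1 * X.beta ε z * ‖φ z‖ ^ 2) X.μ :=
    integrable_bdd_mul (ha'.mul hb') hC i0
  have j1 : ∀ w, Integrable (fun z => a z.1 * X.beta ε z * ‖gradY (fderiv ℝ φ) z w‖ ^ 2) X.μ :=
    fun w => integrable_bdd_mul (ha'.mul hb') hC (i1 w)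
  have j2 := integrable_bdd_mul (c := fun z => a z.1 * (ε * X.h z.1 * X.k z.1) ^ 2 / 2)
    ((ha'.mul (((hh'.const_mul ε).mul hk').pow_const 2)).div_const 2) hC2 i0
  have hsplit : (fun z => a z.1 * (X.beta ε z * ‖gradY (fderiv ℝ φ) z (unitVec 0)‖ ^ 2 +
      X.beta ε z * ‖gradY (fderiv ℝ φ) z (unitVec 1)‖ ^ 2 +
      (ε * X.h z.1 * X.k z.1) ^ 2 / 2 * ‖φ z‖ ^ 2 -
      firstEigenvalue X.S * (X.beta ε z * ‖φ z‖ ^ 2))) = fun z =>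
      a z.1 * X.beta ε z * ‖gradY (fderiv ℝ φ) z (unitVec 0)‖ ^ 2 +
      a z.1 * X.beta ε z * ‖gradY (fderiv ℝ φ) z (unitVec 1)‖ ^ 2 +
      a z.1 * (ε * X.h z.1 * X.k z.1) ^ 2 / 2 * ‖φ z‖ ^ 2 -
      firstEigenvalue X.S * (a z.1 * X.beta ε z * ‖φ z‖ ^ 2) := by
    funext z
    ring
  have j3 : Integrable (fun z => a z.1 * X.beta ε z * ‖gradY (fderiv ℝ φ) z (unitVec 0)‖ ^ 2 +
      a z.1 * X.beta ε z * ‖gradY (fderiv ℝ φ) z (unitVec 1)‖ ^ 2) X.μ := (j1 _).add (j1 _)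
  have j4 : Integrable (fun z => a z.1 * X.beta ε z * ‖gradY (fderiv ℝ φ) z (unitVec 0)‖ ^ 2 +
      a z.1 * X.beta ε z * ‖gradY (fderiv ℝ φ) z (unitVec 1)‖ ^ 2 +
      a z.1 * (ε * X.h z.1 * X.k z.1) ^ 2 / 2 * ‖φ z‖ ^ 2) X.μ := j3.add j2
  have key : 0 ≤ ∫ z, a z.1 * (X.beta ε z * ‖gradY (fderiv ℝ φ) z (unitVec 0)‖ ^ 2 +
      X.beta ε z * ‖gradY (fderiv ℝ φ) z (unitVec 1)‖ ^ 2 +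
      (ε * X.h z.1 * X.k z.1) ^ 2 / 2 * ‖φ z‖ ^ 2 -
      firstEigenvalue X.S * (X.beta ε z * ‖φ z‖ ^ 2)) ∂X.μ := by
    rw [integral_mul_fst (by rw [hsplit]; exact j4.sub (j0.const_mul _))]
    · refine setIntegral_nonneg isOpen_interior.measurableSet fun s hs =>
        mul_nonneg (ha0 s hs) ?_
      -- On the slice at `s` the weight is `β_ε = 1 - ⟨ξ, y⟩`, affine in `y`.
      set ξ : Plane := (ε * X.h s * X.k s) • X.zα s with hξ
      have hξn : ‖ξ‖ ^ 2 = (ε * X.h s * X.k s) ^ 2 := by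
        rw [hξ, norm_smul, X.norm_zα, mul_one, Real.norm_eq_abs, sq_abs]
      have hβξ : ∀ y, 1 - inner ℝ ξ y = X.beta ε (s, y) := fun y => by
        rw [hξ, real_inner_smul_left, beta]
      have hs' := isTest_slice hφ s
      have hm := firstEigenvalue_mul_weighted_le hs' ξ X.isOpen_section fun y hy => by
        rw [hβξ]
        exact (hβ (s, y) ⟨hs, hy⟩).1
      simp only [hβξ, fderiv_slice hφ, Fin.sum_univ_two, hξn, mul_add] at hm
      have hcβ : Continuous fun y => X.beta ε (s, y) := by
        simp only [← hβξ]
        exact continuous_const.sub (innerSL ℝ ξ).continuous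
      have hcφ := hs'.continuous
      have hcd : ∀ w, Continuous fun y => gradY (fderiv ℝ φ) (s, y) w := fun w => by
        simp only [← fderiv_slice hφ]
        exact hs'.continuous_fderiv_apply w
      have l1 : Integrable (fun y => X.beta ε (s, y) * ‖φ (s, y)‖ ^ 2) (volume.restrict X.S) := by
        refine Integrable.integrableOn
          ((hcβ.mul (hcφ.norm.pow 2)).integrable_of_hasCompactSupport ?_)
        exact (hasCompactSupport_norm_sq hs'.hasCompactSupport).mul_left
      have l2 : ∀ w, Integrable (fun y => X.beta ε (s, y) * ‖gradY (fderiv ℝ φ) (s, y) w‖ ^ 2)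
          (volume.restrict X.S) := fun w => by
        refine Integrable.integrableOn
          ((hcβ.mul ((hcd w).norm.pow 2)).integrable_of_hasCompactSupport ?_)
        refine (hasCompactSupport_norm_sq ?_).mul_left
        simp only [← fderiv_slice hφ]
        exact hs'.hasCompactSupport_fderiv_apply w
      have l3 : Integrable (fun y => X.beta ε (s, y) * ‖gradY (fderiv ℝ φ) (s, y) (unitVec 0)‖ ^ 2 +
          X.beta ε (s, y) * ‖gradY (fderiv ℝ φ) (s, y) (unitVec 1)‖ ^ 2 +
          (ε * X.h s * X.k s) ^ 2 / 2 * ‖φ (s, y)‖ ^ 2) (volume.restrict X.S) :=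
        ((l2 _).add (l2 _)).add ((hs'.integrable_norm_sq _).const_mul _)
      rw [integral_sub l3 (l1.const_mul _), integral_const_mul]
      exact sub_nonneg.2 hm
  rw [hsplit, integral_sub j4 (j0.const_mul _), integral_add j3 j2, integral_add (j1 _) (j1 _),
    integral_const_mul] at key
  linarith

end DeformedTube

end ThinTube

/-! ### Passage to the limit in weighted quadratic functionals -/

namespace ThinTube

/-- A bounded nonnegative weight enters the linear map as its square root, which reduces the claim
to the unweighted case. -/
theorem MemH01.tendsto_integral_mul {E : Type*} [NormedAddCommGroup E] [NormedSpace ℝ E]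
    [MeasureSpace E] [BorelSpace E] [IsFiniteMeasureOnCompacts (volume : Measure E)] {Ω : Set E}
    {u : E → ℂ} {U : E → E →L[ℝ] ℂ} {F : Type*} [NormedAddCommGroup F] [NormedSpace ℝ F]
    {ℓ : (E → ℂ) → (E → E →L[ℝ] ℂ) → E → F} {C : ℝ} (hu : MemH01 Ω u U) {φ : ℕ → E → ℂ}
    (hφ : ∀ n, IsTest Ω (φ n))
    (h0 : Tendsto (fun n => eLpNorm (φ n - u) 2 (volume.restrict Ω)) atTop (𝓝 0))
    (h1 : Tendsto (fun n => eLpNorm (fderiv ℝ (φ n) - U) 2 (volume.restrict Ω)) atTop (𝓝 0))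
    (hm : ∀ v V, MemH01 Ω v V → MemLp (ℓ v V) 2 (volume.restrict Ω))
    (hℓ : ∀ v V w W, ∀ᵐ z ∂volume.restrict Ω,
      ‖ℓ v V z - ℓ w W z‖ ≤ C * (‖v z - w z‖ + ‖V z - W z‖)) {w : E → ℝ} {c : ℝ}
    (hw : AEMeasurable w (volume.restrict Ω)) (hw0 : ∀ᵐ z ∂volume.restrict Ω, 0 ≤ w z ∧ w z ≤ c) :
    Tendsto (fun n => ∫ z in Ω, w z * ‖ℓ (φ n) (fderiv ℝ (φ n)) z‖ ^ 2) atTop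
      (𝓝 (∫ z in Ω, w z * ‖ℓ u U z‖ ^ 2)) := by
  have h := hu.tendsto_integral (ℓ := fun v V z => √(w z) • ℓ v V z) (C := √c * C) hφ h0 h1
    (fun v V hv => ?_) (fun v V v' V' => ?_)
  · have heq : ∀ v V, ∫ z in Ω, ‖√(w z) • ℓ v V z‖ ^ 2 = ∫ z in Ω, w z * ‖ℓ v V z‖ ^ 2 := by
      intro v V
      refine integral_congr_ae ?_
      filter_upwards [hw0] with z hz
      rw [norm_smul, mul_pow, Real.norm_eq_abs, sq_abs, Real.sq_sqrt hz.1]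
    simpa only [heq] using h
  · refine (hm v V hv).of_le_mul (c := √c)
      (hw.sqrt.aestronglyMeasurable.smul (hm v V hv).1) ?_
    filter_upwards [hw0] with z hz
    rw [norm_smul, Real.norm_of_nonneg (Real.sqrt_nonneg _)]
    gcongr
    exact hz.2
  · filter_upwards [hw0, hℓ v V v' V'] with z hz hz'
    rw [← smul_sub, norm_smul, Real.norm_of_nonneg (Real.sqrt_nonneg _), mul_assoc]
    gcongr
    exact hz.2

namespace DeformedTube

variable {X : DeformedTube}

/-! ### Lower bounds on the form domain -/

theorem integral_norm_sq_le_longitudinal {v : Coord → ℂ} {V : Coord → Coord →L[ℝ] ℂ}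
    (hv : MemH01 X.Ω v V) {t : ℝ} (ht : 0 < t) :
    ∫ z, ‖v z‖ ^ 2 ∂X.μ ≤ t * ∫ z, ‖X.longitudinal v V z‖ ^ 2 ∂X.μ +
      (1 + t⁻¹) * ∫ z, Real.tanh z.1 ^ 2 * ‖v z‖ ^ 2 ∂X.μ := by
  obtain ⟨φ, hφ, h0, h1⟩ := hv.exists_seq
  obtain ⟨C, hC0, hC⟩ := X.exists_norm_longitudinal_le
  have hct : Continuous Real.tanh := contDiff_tanh.continuous
  have hval : ∀ (v : Coord → ℂ) (V : Coord → Coord →L[ℝ] ℂ) (w : Coord → ℂ)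
      (W : Coord → Coord →L[ℝ] ℂ), ∀ᵐ z ∂volume.restrict X.Ω,
      ‖v z - w z‖ ≤ 1 * (‖v z - w z‖ + ‖V z - W z‖) := fun v V w W =>
    Eventually.of_forall fun z => by
      rw [one_mul]
      exact le_add_of_nonneg_right (norm_nonneg _)
  have t1 := hv.tendsto_integral (ℓ := fun v _ => v) hφ h0 h1 (fun v V h => h.1) hval
  have t2 := hv.tendsto_integral_mul (ℓ := fun v _ => v) hφ h0 h1 (fun v V h => h.1) hval
    (w := fun z => Real.tanh z.1 ^ 2) (c := 1) (by fun_prop)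
    (Eventually.of_forall fun z => ⟨sq_nonneg _, (tanh_sq_lt_one _).le⟩)
  have t3 := hv.tendsto_integral (ℓ := X.longitudinal) (C := C) hφ h0 h1
    (fun v V h => memLp_longitudinal h.1 h.2.1) (fun v V w W => by
      filter_upwards [X.ae_mem_Ω] with z hz
      rw [← longitudinal_sub]
      exact hC _ _ z hz)
  exact le_of_tendsto_of_tendsto t1 ((t3.const_mul t).add (t2.const_mul _))
    (Eventually.of_forall fun n => integral_norm_sq_le_longitudinal_of_isTest (hφ n) ht)

/-- By density of test functions. Approximation takes place in the `H¹` norm, and this is why the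
weight `a` has to be bounded; `1/h²` itself need not be. -/
theorem firstEigenvalue_mul_le_of_memH01 {v : Coord → ℂ} {V : Coord → Coord →L[ℝ] ℂ}
    (hv : MemH01 X.Ω v V) {ε : ℝ} (hβ : ∀ z ∈ X.Ω, 1 / 2 ≤ X.beta ε z ∧ X.beta ε z ≤ 2)
    {a : ℝ → ℝ} {C : ℝ} (ha : AEMeasurable a (volume.restrict (interior X.I)))
    (ha0 : ∀ s ∈ interior X.I, 0 ≤ a s) (haC : ∀ s ∈ interior X.I, a s ≤ C) :
    firstEigenvalue X.S * ∫ z, a z.1 * X.beta ε z * ‖v z‖ ^ 2 ∂X.μ ≤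
      ∫ z, a z.1 * X.beta ε z * ‖gradY V z (unitVec 0)‖ ^ 2 ∂X.μ +
      ∫ z, a z.1 * X.beta ε z * ‖gradY V z (unitVec 1)‖ ^ 2 ∂X.μ +
      ∫ z, a z.1 * (ε * X.h z.1 * X.k z.1) ^ 2 / 2 * ‖v z‖ ^ 2 ∂X.μ := by
  obtain ⟨φ, hφ, h0, h1⟩ := hv.exists_seq
  obtain ⟨K, hK, hk, -⟩ := X.exists_bound
  have hval : ∀ (v : Coord → ℂ) (V : Coord → Coord →L[ℝ] ℂ) (w : Coord → ℂ)
      (W : Coord → Coord →L[ℝ] ℂ), ∀ᵐ z ∂volume.restrict X.Ω,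
      ‖v z - w z‖ ≤ 1 * (‖v z - w z‖ + ‖V z - W z‖) := fun v V w W =>
    Eventually.of_forall fun z => by
      rw [one_mul]
      exact le_add_of_nonneg_right (norm_nonneg _)
  have ha' := X.aemeasurable_comp_fst ha
  have hh' := X.aemeasurable_comp_fst X.aemeasurable_h
  have hk' := X.aemeasurable_comp_fst X.aemeasurable_k
  have hw1 : ∀ᵐ z ∂volume.restrict X.Ω, 0 ≤ a z.1 * X.beta ε z ∧ a z.1 * X.beta ε z ≤ C * 2 := by
    filter_upwards [X.ae_mem_Ω] with z hz
    have h1 := ha0 _ hz.1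
    have h2 := haC _ hz.1
    have h3 := hβ z hz
    exact ⟨mul_nonneg h1 (by linarith), mul_le_mul h2 h3.2 (by linarith) (h1.trans h2)⟩
  have hw2 : ∀ᵐ z ∂volume.restrict X.Ω, 0 ≤ a z.1 * (ε * X.h z.1 * X.k z.1) ^ 2 / 2 ∧
      a z.1 * (ε * X.h z.1 * X.k z.1) ^ 2 / 2 ≤ C * (ε * X.M * K) ^ 2 / 2 := by
    filter_upwards [X.ae_mem_Ω] with z hz
    have h1 := ha0 _ hz.1
    have h2 := haC _ hz.1
    refine ⟨by positivity, ?_⟩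
    gcongr ?_ / 2
    refine mul_le_mul h2 ?_ (by positivity) (h1.trans h2)
    rw [sq_le_sq, abs_mul, abs_mul, abs_mul, abs_mul]
    have h3 := X.h_pos (X.mem_I hz)
    have h4 := X.h_le (X.mem_I hz)
    have h5 : |X.h z.1| ≤ |X.M| := by
      rwa [abs_of_pos h3, abs_of_pos X.deformation.max_pos]
    have h6 : |X.k z.1| ≤ |K| := (hk _ (X.mem_I hz)).trans (le_abs_self K)
    gcongr
  have hgrad : ∀ (w : Plane) (v : Coord → ℂ) (V : Coord → Coord →L[ℝ] ℂ) (v' : Coord → ℂ)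
      (V' : Coord → Coord →L[ℝ] ℂ), ∀ᵐ z ∂volume.restrict X.Ω,
      ‖gradY V z w - gradY V' z w‖ ≤ ‖w‖ * (‖v z - v' z‖ + ‖V z - V' z‖) := by
    refine fun w v V v' V' => Eventually.of_forall fun z => ?_
    have h := norm_gradY_le (V - V') z w
    rw [mul_comm] at h
    refine h.trans ?_
    gcongr
    exact le_add_of_nonneg_left (norm_nonneg _)
  have t1 := hv.tendsto_integral_mul (ℓ := fun v _ => v) hφ h0 h1 (fun v V h => h.1) hval
    (ha'.mul (X.aemeasurable_beta ε)) hw1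
  have t2 := hv.tendsto_integral_mul (ℓ := fun v _ => v) hφ h0 h1 (fun v V h => h.1) hval
    ((ha'.mul (((hh'.const_mul ε).mul hk').pow_const 2)).div_const 2) hw2
  have t3 := fun w => hv.tendsto_integral_mul (ℓ := fun _ V z => gradY V z w) hφ h0 h1
    (fun v V h => memLp_gradY h.2.1 w) (hgrad w) (ha'.mul (X.aemeasurable_beta ε)) hw1
  exact le_of_tendsto_of_tendsto (t1.const_mul _) (((t3 (unitVec 0)).add (t3 (unitVec 1))).add t2)
    (Eventually.of_forall fun n => firstEigenvalue_mul_le_of_isTest (hφ n) hβ ha ha0 haC)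

theorem gradYInner_self (V : Coord → Coord →L[ℝ] ℂ) (z : Coord) :
    gradYInner V V z =
      ((‖gradY V z (unitVec 0)‖ ^ 2 + ‖gradY V z (unitVec 1)‖ ^ 2 : ℝ) : ℂ) := by
  simp only [gradYInner, Fin.sum_univ_two, ← Complex.normSq_eq_conj_mul_self,
    Complex.normSq_eq_norm_sq]
  push_cast
  rfl

theorem aemeasurable_inv_h : AEMeasurable (fun z : Coord => (X.h z.1)⁻¹) X.μ :=
  (X.aemeasurable_comp_fst X.aemeasurable_h).inv

theorem aestronglyMeasurable_gradY_div {V : Coord → Coord →L[ℝ] ℂ}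
    (hV : AEStronglyMeasurable V X.μ) (w : Plane) :
    AEStronglyMeasurable (fun z => gradY V z w / (X.h z.1 : ℂ)) X.μ := by
  have h1 : AEStronglyMeasurable (fun z => gradY V z w) X.μ :=
    hV.apply_continuousLinearMap ((0 : ℝ), w)
  have h2 : AEStronglyMeasurable (fun z : Coord => (((X.h z.1)⁻¹ : ℝ) : ℂ)) X.μ :=
    (Complex.measurable_ofReal.comp_aemeasurable aemeasurable_inv_h).aestronglyMeasurable
  refine (h1.mul h2).congr (Eventually.of_forall fun z => ?_)
  simp [div_eq_mul_inv]

/-- The weighted gradient is square integrable on the form domain. -/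
theorem formDomain_iff {v : Coord → ℂ} {V : Coord → Coord →L[ℝ] ℂ} :
    X.FormDomain v V ↔ MemH01 X.Ω v V ∧
      ∀ i, MemLp (fun z => gradY V z (unitVec i) / (X.h z.1 : ℂ)) 2 X.μ := by
  refine and_congr_right fun hv => ?_
  have hm := fun w => X.aestronglyMeasurable_gradY_div hv.2.1.1 w
  have hsq : ∀ i z, ‖gradY V z (unitVec i) / (X.h z.1 : ℂ)‖ ^ 2 =
      ‖gradY V z (unitVec i)‖ ^ 2 / X.h z.1 ^ 2 := fun i z => by
    rw [norm_div, Complex.norm_real, div_pow, Real.norm_eq_abs, sq_abs]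
  have heq : (fun z => gradYInner V V z / (X.h z.1 : ℂ) ^ 2) = fun z =>
      ((‖gradY V z (unitVec 0) / (X.h z.1 : ℂ)‖ ^ 2 +
        ‖gradY V z (unitVec 1) / (X.h z.1 : ℂ)‖ ^ 2 : ℝ) : ℂ) := by
    funext z
    rw [gradYInner_self, hsq, hsq, ← add_div]
    push_cast
    rfl
  rw [heq]
  constructor
  · intro h i
    rw [memLp_two_iff_integrable_sq_norm (hm _)]
    refine h.norm.mono' ((hm _).norm.pow 2) (Eventually.of_forall fun z => ?_)
    rw [Complex.norm_real, Real.norm_of_nonneg (by positivity),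
      Real.norm_of_nonneg (by positivity)]
    fin_cases i
    · exact le_add_of_nonneg_right (sq_nonneg _)
    · exact le_add_of_nonneg_left (sq_nonneg _)
  · intro h
    exact (((h 0).integrable_norm_pow two_ne_zero).add
      ((h 1).integrable_norm_pow two_ne_zero)).ofReal

theorem exists_inv_h_sq_le (X : DeformedTube) (n : ℕ) :
    ∃ C : ℝ, ∀ s ∈ X.I, |s| ≤ n → (X.h s ^ 2)⁻¹ ≤ C := by
  have hK : IsCompact (X.I ∩ Icc (-(n : ℝ)) n) := isCompact_Icc.inter_left X.isClosed_I
  obtain ⟨C, hC⟩ := hK.exists_bound_of_continuousOn (f := fun s => (X.h s ^ 2)⁻¹)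
    (((X.deformation.continuousOn.mono inter_subset_left).pow 2).inv₀
      fun s hs => (pow_pos (X.h_pos hs.1) 2).ne')
  refine ⟨C, fun s hs hn => (le_abs_self _).trans (hC s ⟨hs, abs_le.1 hn⟩)⟩

theorem integrable_beta_mul {ε : ℝ} (hβ : ∀ z ∈ X.Ω, 1 / 2 ≤ X.beta ε z ∧ X.beta ε z ≤ 2)
    {F : Coord → ℝ} (hF : Integrable F X.μ) : Integrable (fun z => X.beta ε z * F z) X.μ :=
  integrable_bdd_mul (C := 2) (X.aemeasurable_beta ε) (fun z hz => by
    have := hβ z hz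
    rw [abs_of_nonneg (by linarith)]
    exact this.2) hF

theorem integrable_tanh_sq_mul {F : Coord → ℝ} (hF : Integrable F X.μ) :
    Integrable (fun z => Real.tanh z.1 ^ 2 * F z) X.μ := by
  have hct : Continuous Real.tanh := contDiff_tanh.continuous
  refine integrable_bdd_mul (C := 1) (by fun_prop) (fun z hz => ?_) hF
  rw [abs_of_nonneg (sq_nonneg _)]
  exact (tanh_sq_lt_one _).le

/-- If `h` is not bounded away from zero, `1/h²` is truncated to `|s| ≤ n`, where it is bounded. The
right hand side with the full weight dominates every truncation, and the left hand side converges as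
`n → ∞`. -/
theorem firstEigenvalue_mul_le_of_formDomain {v : Coord → ℂ} {V : Coord → Coord →L[ℝ] ℂ}
    (hv : X.FormDomain v V) {ε : ℝ} (hβ : ∀ z ∈ X.Ω, 1 / 2 ≤ X.beta ε z ∧ X.beta ε z ≤ 2)
    {K κ : ℝ} (hK : ∀ s ∈ X.I, |X.k s| ≤ K)
    (hκ : ∀ s ∈ X.I, κ * Real.tanh s ^ 2 ≤ 1 / X.h s ^ 2 - 1 / X.M ^ 2) :
    firstEigenvalue X.S * (1 / X.M ^ 2 * ∫ z, X.beta ε z * ‖v z‖ ^ 2 ∂X.μ +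
        κ * ∫ z, Real.tanh z.1 ^ 2 * (X.beta ε z * ‖v z‖ ^ 2) ∂X.μ) ≤
      ∫ z, X.beta ε z * ‖gradY V z (unitVec 0) / (X.h z.1 : ℂ)‖ ^ 2 ∂X.μ +
      ∫ z, X.beta ε z * ‖gradY V z (unitVec 1) / (X.h z.1 : ℂ)‖ ^ 2 ∂X.μ +
      ε ^ 2 * K ^ 2 / 2 * ∫ z, ‖v z‖ ^ 2 ∂X.μ := by
  have hM := X.deformation.max_pos
  obtain ⟨hv1, hv2⟩ := formDomain_iff.1 hv
  have hlam := firstEigenvalue_pos X.isOpen_section X.isBounded_section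
    X.simplyConnected_section.nonempty
  have i0 : Integrable (fun z => ‖v z‖ ^ 2) X.μ := hv1.1.integrable_norm_pow two_ne_zero
  have i1 := integrable_beta_mul hβ i0
  have i2 := fun i => integrable_beta_mul hβ ((hv2 i).integrable_norm_pow two_ne_zero)
  let f : Coord → ℝ := fun z =>
    1 / X.M ^ 2 * (X.beta ε z * ‖v z‖ ^ 2) + κ * (Real.tanh z.1 ^ 2 * (X.beta ε z * ‖v z‖ ^ 2))
  have hf : Integrable f X.μ := (i1.const_mul _).add ((integrable_tanh_sq_mul i1).const_mul _)
  let A : ℕ → Set Coord := fun n => {z | |z.1| ≤ n}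
  have hAm : ∀ n, MeasurableSet (A n) := fun n =>
    (isClosed_le (by fun_prop) continuous_const).measurableSet
  have hA : ⋃ n, A n = univ := eq_univ_of_forall fun z => by
    obtain ⟨n, hn⟩ := exists_nat_ge |z.1|
    exact mem_iUnion.2 ⟨n, hn⟩
  have hlim : Tendsto (fun n => ∫ z in A n, f z ∂X.μ) atTop (𝓝 (∫ z, f z ∂X.μ)) := by
    have := tendsto_setIntegral_of_monotone (μ := X.μ) (f := f) hAm (fun m n hmn z hz =>
      (show |z.1| ≤ m from hz).trans (by exact_mod_cast hmn)) (by rw [hA]; exact hf.integrableOn)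
    rwa [hA, setIntegral_univ] at this
  have hfint : ∫ z, f z ∂X.μ = 1 / X.M ^ 2 * ∫ z, X.beta ε z * ‖v z‖ ^ 2 ∂X.μ +
        κ * ∫ z, Real.tanh z.1 ^ 2 * (X.beta ε z * ‖v z‖ ^ 2) ∂X.μ := by
    rw [integral_add (i1.const_mul _) ((integrable_tanh_sq_mul i1).const_mul _),
      integral_const_mul, integral_const_mul]
  rw [← hfint]
  refine le_of_tendsto' (hlim.const_mul _) fun n => ?_
  obtain ⟨C, hC⟩ := X.exists_inv_h_sq_le n
  -- The truncated weight: equal to `1/h²` for `|s| ≤ n` and nowhere larger.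
  let a : ℝ → ℝ := indicator {s : ℝ | |s| ≤ n} fun s => (X.h s ^ 2)⁻¹
  have hsm : MeasurableSet {s : ℝ | |s| ≤ n} :=
    (isClosed_le continuous_abs continuous_const).measurableSet
  have ha : AEMeasurable a (volume.restrict (interior X.I)) :=
    ((X.aemeasurable_h.pow_const 2).inv).indicator hsm
  have ha0 : ∀ s, 0 ≤ a s := fun s => indicator_nonneg (fun s _ => by positivity) s
  have hale : ∀ s, a s ≤ (X.h s ^ 2)⁻¹ := fun s =>
    indicator_le_self' (fun _ _ => by positivity) s
  have hC0 : 0 ≤ C := le_trans (by positivity) (hC 0 X.zero_mem (by simp))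
  have haC : ∀ s ∈ interior X.I, a s ≤ C := fun s hs => by
    by_cases h : |s| ≤ n
    · exact (hale s).trans (hC s (interior_subset hs) h)
    · simp only [a]
      rw [indicator_of_notMem (by simpa using h)]
      exact hC0
  have hmain := firstEigenvalue_mul_le_of_memH01 hv1 hβ ha (fun s _ => ha0 s) haC
  have hβ0 : ∀ z ∈ X.Ω, 0 ≤ X.beta ε z := fun z hz => by linarith [(hβ z hz).1]
  have b1 : ∫ z in A n, f z ∂X.μ ≤ ∫ z, a z.1 * X.beta ε z * ‖v z‖ ^ 2 ∂X.μ := by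
    rw [← integral_indicator (hAm n)]
    have hint : Integrable (fun z => a z.1 * X.beta ε z * ‖v z‖ ^ 2) X.μ := by
      simp only [mul_assoc]
      refine integrable_bdd_mul (C := C) (X.aemeasurable_comp_fst ha) (fun z hz => ?_) i1
      rw [abs_of_nonneg (ha0 _)]
      exact haC _ hz.1
    refine integral_mono_ae (hf.indicator (hAm n)) hint ?_
    filter_upwards [X.ae_mem_Ω] with z hz
    by_cases h : z ∈ A n
    · have h' : z.1 ∈ {s : ℝ | |s| ≤ n} := h
      simp only [a]
      rw [indicator_of_mem h, indicator_of_mem h']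
      have h1 := hκ _ (X.mem_I hz)
      have h2 : 0 ≤ X.beta ε z * ‖v z‖ ^ 2 := mul_nonneg (hβ0 z hz) (sq_nonneg _)
      have h3 : f z = (1 / X.M ^ 2 + κ * Real.tanh z.1 ^ 2) * (X.beta ε z * ‖v z‖ ^ 2) := by
        simp only [f]; ring
      rw [h3, mul_assoc]
      refine mul_le_mul_of_nonneg_right ?_ h2
      rw [← one_div]
      linarith
    · have h' : z.1 ∉ {s : ℝ | |s| ≤ n} := h
      simp only [a]
      rw [indicator_of_notMem h, indicator_of_notMem h', zero_mul, zero_mul]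
  have b2 : ∀ i, ∫ z, a z.1 * X.beta ε z * ‖gradY V z (unitVec i)‖ ^ 2 ∂X.μ ≤
      ∫ z, X.beta ε z * ‖gradY V z (unitVec i) / (X.h z.1 : ℂ)‖ ^ 2 ∂X.μ := fun i => by
    refine integral_mono_of_nonneg ?_ (i2 i) ?_
    · filter_upwards [X.ae_mem_Ω] with z hz
      exact mul_nonneg (mul_nonneg (ha0 _) (hβ0 z hz)) (sq_nonneg _)
    · filter_upwards [X.ae_mem_Ω] with z hz
      rw [norm_div, Complex.norm_real, div_pow, Real.norm_eq_abs, sq_abs, div_eq_mul_inv]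
      have h1 : 0 ≤ X.beta ε z * ‖gradY V z (unitVec i)‖ ^ 2 :=
        mul_nonneg (hβ0 z hz) (sq_nonneg _)
      nlinarith [mul_le_mul_of_nonneg_right (hale z.1) h1]
  have b3 : ∫ z, a z.1 * (ε * X.h z.1 * X.k z.1) ^ 2 / 2 * ‖v z‖ ^ 2 ∂X.μ ≤
      ε ^ 2 * K ^ 2 / 2 * ∫ z, ‖v z‖ ^ 2 ∂X.μ := by
    rw [← integral_const_mul]
    refine integral_mono_of_nonneg (Eventually.of_forall fun z => ?_) (i0.const_mul _) ?_
    · have := ha0 z.1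
      simp only [Pi.zero_apply]
      positivity
    · filter_upwards [X.ae_mem_Ω] with z hz
      refine mul_le_mul_of_nonneg_right ?_ (sq_nonneg _)
      have h1 := X.h_pos (X.mem_I hz)
      have h2 : X.k z.1 ^ 2 ≤ K ^ 2 := by
        rw [← sq_abs]
        have := hK _ (X.mem_I hz)
        gcongr
      -- The factor `h²` in the quadratic error cancels the weight, so the error is uniform in `n`.
      have h3 : a z.1 * X.h z.1 ^ 2 ≤ 1 := by
        calc a z.1 * X.h z.1 ^ 2 ≤ (X.h z.1 ^ 2)⁻¹ * X.h z.1 ^ 2 := by gcongr; exact hale _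
          _ = 1 := inv_mul_cancel₀ (by positivity)
      gcongr ?_ / 2
      calc a z.1 * (ε * X.h z.1 * X.k z.1) ^ 2 = (a z.1 * X.h z.1 ^ 2) * (ε ^ 2 * X.k z.1 ^ 2) := by
            ring
        _ ≤ 1 * (ε ^ 2 * K ^ 2) := by gcongr
        _ = _ := one_mul _
  calc _ ≤ _ := mul_le_mul_of_nonneg_left b1 hlam.le
    _ ≤ _ := hmain
    _ ≤ _ := add_le_add (add_le_add (b2 0) (b2 1)) b3

/-- For small `ε` the forms dominate the longitudinal energy and the `L²` norm. -/
theorem exists_lower_bound (X : DeformedTube) : ∃ ε₁ : ℝ, 0 < ε₁ ∧ ∀ ε : ℝ, 0 < ε → ε < ε₁ →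
    (∀ z ∈ X.Ω, 1 / 2 ≤ X.beta ε z ∧ X.beta ε z ≤ 2) →
    ∀ (v : Coord → ℂ) (V : Coord → Coord →L[ℝ] ℂ), X.FormDomain v V →
      1 / 2 * ∫ z, ‖X.longitudinal v V z‖ ^ 2 ∂X.μ + ∫ z, ‖v z‖ ^ 2 ∂X.μ ≤
        3 / 4 * ∫ z, ‖X.longitudinal v V z‖ ^ 2 ∂X.μ +
        1 / ε ^ 2 * (∫ z, X.beta ε z * ‖gradY V z (unitVec 0) / (X.h z.1 : ℂ)‖ ^ 2 ∂X.μ +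
          ∫ z, X.beta ε z * ‖gradY V z (unitVec 1) / (X.h z.1 : ℂ)‖ ^ 2 ∂X.μ) -
        firstEigenvalue X.S / (ε ^ 2 * X.M ^ 2) * ∫ z, X.beta ε z * ‖v z‖ ^ 2 ∂X.μ := by
  obtain ⟨K, hK1, hK, -⟩ := X.exists_bound
  obtain ⟨κ, hκ0, hκ⟩ := X.exists_mul_tanh_sq_le_inv_sq
  have hM := X.deformation.max_pos
  have hlam := firstEigenvalue_pos X.isOpen_section X.isBounded_section
    X.simplyConnected_section.nonempty
  set lam := firstEigenvalue X.S
  -- The error `K²/2` of the weighted eigenvalue inequality plus the one copy of `‖v‖²` that has to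
  -- survive.
  let A : ℝ := K ^ 2 / 2 + 1
  have hA : 0 < A := by positivity
  -- Chosen so that `ε² ≤ ρ` gives `A (1 + 4A) ≤ λ₀ κ / (2 ε²)`; the factor `2` accounts for `β_ε ≥
  -- 1/2`.
  let ρ : ℝ := lam * κ / (2 * (A * (1 + 4 * A)))
  have hρ : 0 < ρ := by positivity
  refine ⟨min 1 ρ, lt_min one_pos hρ, fun ε hε hε1 hβ v V hv => ?_⟩
  have hερ : ε ^ 2 ≤ ρ := by
    have h1 := hε1.le.trans (min_le_left _ _)
    have h2 := hε1.le.trans (min_le_right _ _)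
    nlinarith
  have hv1 := hv.1
  have i0 : Integrable (fun z => ‖v z‖ ^ 2) X.μ := hv1.1.integrable_norm_pow two_ne_zero
  have i1 := integrable_beta_mul hβ i0
  -- With this parameter the uncertainty principle, multiplied by `A`, costs a quarter of `‖Dv‖²`,
  -- which is the gap between `3/4` and `1/2`.
  have h1 := integral_norm_sq_le_longitudinal hv1 (t := (4 * A)⁻¹) (by positivity)
  have h2 := firstEigenvalue_mul_le_of_formDomain hv hβ hK hκ
  have h3 : 1 / 2 * ∫ z, Real.tanh z.1 ^ 2 * ‖v z‖ ^ 2 ∂X.μ ≤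
      ∫ z, Real.tanh z.1 ^ 2 * (X.beta ε z * ‖v z‖ ^ 2) ∂X.μ := by
    rw [← integral_const_mul]
    refine integral_mono_ae ((integrable_tanh_sq_mul i0).const_mul _)
      (integrable_tanh_sq_mul i1) ?_
    filter_upwards [X.ae_mem_Ω] with z hz
    have h4 := mul_le_mul_of_nonneg_right (hβ z hz).1
      (by positivity : 0 ≤ Real.tanh z.1 ^ 2 * ‖v z‖ ^ 2)
    linarith
  have hT : 0 ≤ ∫ z, Real.tanh z.1 ^ 2 * ‖v z‖ ^ 2 ∂X.μ :=
    integral_nonneg fun z => by positivity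
  set Dn := ∫ z, ‖X.longitudinal v V z‖ ^ 2 ∂X.μ
  set N := ∫ z, ‖v z‖ ^ 2 ∂X.μ
  set T := ∫ z, Real.tanh z.1 ^ 2 * ‖v z‖ ^ 2 ∂X.μ
  set BT := ∫ z, Real.tanh z.1 ^ 2 * (X.beta ε z * ‖v z‖ ^ 2) ∂X.μ
  set Bv := ∫ z, X.beta ε z * ‖v z‖ ^ 2 ∂X.μ
  set G := ∫ z, X.beta ε z * ‖gradY V z (unitVec 0) / (X.h z.1 : ℂ)‖ ^ 2 ∂X.μ +
      ∫ z, X.beta ε z * ‖gradY V z (unitVec 1) / (X.h z.1 : ℂ)‖ ^ 2 ∂X.μ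
  have h4 : A * N ≤ 1 / 4 * Dn + A * (1 + 4 * A) * T := by
    have := mul_le_mul_of_nonneg_left h1 hA.le
    rw [inv_inv] at this
    have h5 : A * ((4 * A)⁻¹ * Dn + (1 + 4 * A) * T) = 1 / 4 * Dn + A * (1 + 4 * A) * T := by
      field_simp
    linarith
  have h5 : A * (1 + 4 * A) * T ≤ lam * κ / ε ^ 2 * BT := by
    have h6 : A * (1 + 4 * A) ≤ lam * κ / ε ^ 2 * (1 / 2) := by
      rw [le_div_iff₀ (by positivity)] at hερ
      rw [div_mul_eq_mul_div, le_div_iff₀ (by positivity)]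
      linarith
    calc A * (1 + 4 * A) * T ≤ lam * κ / ε ^ 2 * (1 / 2) * T := by gcongr
      _ = lam * κ / ε ^ 2 * (1 / 2 * T) := by ring
      _ ≤ lam * κ / ε ^ 2 * BT := by gcongr
  have h6 : lam / (ε ^ 2 * X.M ^ 2) * Bv + lam * κ / ε ^ 2 * BT ≤ 1 / ε ^ 2 * G + K ^ 2 / 2 * N := by
    have := mul_le_mul_of_nonneg_left h2 (by positivity : 0 ≤ 1 / ε ^ 2)
    have e1 : 1 / ε ^ 2 * (lam * (1 / X.M ^ 2 * Bv + κ * BT)) =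
        lam / (ε ^ 2 * X.M ^ 2) * Bv + lam * κ / ε ^ 2 * BT := by
      field_simp
    have e2 : 1 / ε ^ 2 * (G + ε ^ 2 * K ^ 2 / 2 * N) = 1 / ε ^ 2 * G + K ^ 2 / 2 * N := by
      field_simp
    rwa [e1, e2] at this
  have h7 : A * N = K ^ 2 / 2 * N + N := by simp only [A]; ring
  linarith

end DeformedTube

end ThinTube

/-! ### Square integrable functions with values in `ℂ⁴` -/

namespace ThinTube

/-- The space of the components of a chart of a Sobolev function. -/
abbrev Chart := EuclideanSpace ℂ (Fin 4)

theorem memLp_chart_iff {α : Type*} [MeasurableSpace α] {μ : Measure α} {f : α → Chart} :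
    MemLp f 2 μ ↔ ∀ i, MemLp (fun z => f z i) 2 μ := by
  constructor
  · intro h i
    refine h.of_le ?_ (Eventually.of_forall fun z => PiLp.norm_apply_le (f z) i)
    exact (EuclideanSpace.proj i : Chart →L[ℂ] ℂ).continuous.comp_aestronglyMeasurable h.1
  · intro h
    have hm : AEStronglyMeasurable f μ := by
      have h1 : AEMeasurable (fun z => (f z).ofLp) μ :=
        aemeasurable_pi_iff.2 fun i => (h i).1.aemeasurable
      exact ((PiLp.continuous_toLp 2 _).measurable.comp_aemeasurable h1).aestronglyMeasurable
    rw [memLp_two_iff_integrable_sq_norm hm]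
    simp only [EuclideanSpace.norm_sq_eq]
    exact integrable_finsetSum _ fun i _ => (h i).integrable_norm_pow two_ne_zero

/-- Multiplication of the components of a chart by bounded real functions. -/
theorem exists_diagonal {α : Type*} [MeasurableSpace α] {μ : Measure α} {a : Fin 4 → α → ℝ}
    (ha : ∀ i, AEMeasurable (a i) μ) {C : ℝ} (hC : ∀ᵐ z ∂μ, ∀ i, |a i z| ≤ C) :
    ∃ A : Lp Chart 2 μ →L[ℂ] Lp Chart 2 μ, ∀ x, A x =ᵐ[μ] fun z =>
      WithLp.toLp 2 fun i => (a i z : ℂ) * x z i := by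
  have hmem : ∀ x : Lp Chart 2 μ,
      MemLp (fun z => (WithLp.toLp 2 fun i => (a i z : ℂ) * x z i : Chart)) 2 μ := by
    intro x
    refine memLp_chart_iff.2 fun i => ?_
    have h := memLp_chart_iff.1 (Lp.memLp x) i
    refine h.of_le_mul (c := C)
      ((Complex.measurable_ofReal.comp_aemeasurable (ha i)).aestronglyMeasurable.mul h.1) ?_
    filter_upwards [hC] with z hz
    simp only [norm_mul, Complex.norm_real]
    gcongr
    exact hz i
  let A₀ : Lp Chart 2 μ →ₗ[ℂ] Lp Chart 2 μ :=
    { toFun := fun x => (hmem x).toLp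
      map_add' := fun x y => by
        apply Lp.ext
        filter_upwards [(hmem (x + y)).coeFn_toLp, (hmem x).coeFn_toLp, (hmem y).coeFn_toLp,
          Lp.coeFn_add x y, Lp.coeFn_add (hmem x).toLp (hmem y).toLp] with z h1 h2 h3 h4 h5
        rw [h1, h5, Pi.add_apply, h2, h3, h4]
        ext i
        simp [mul_add]
      map_smul' := fun b x => by
        apply Lp.ext
        filter_upwards [(hmem (b • x)).coeFn_toLp, (hmem x).coeFn_toLp,
          Lp.coeFn_smul b x, Lp.coeFn_smul b (hmem x).toLp] with z h1 h2 h4 h5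
        rw [h1, RingHom.id_apply, h5, Pi.smul_apply, h2, h4]
        ext i
        simp
        ring }
  have hA₀ : ∀ x, A₀ x =ᵐ[μ] fun z => WithLp.toLp 2 fun i => (a i z : ℂ) * x z i :=
    fun x => (hmem x).coeFn_toLp
  refine ⟨A₀.mkContinuous C fun x => ?_, hA₀⟩
  refine Lp.norm_le_mul_norm_of_ae_le_mul ?_
  filter_upwards [hA₀ x, hC] with z h1 h2
  change ‖A₀ x z‖ ≤ _
  have hC0 : 0 ≤ C := (abs_nonneg _).trans (h2 0)
  rw [h1, ← abs_of_nonneg (norm_nonneg (x z)), ← abs_of_nonneg hC0, ← abs_mul]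
  refine abs_le_of_sq_le_sq' ?_ (by positivity) |>.2 |>.trans (le_abs_self _)
  rw [mul_pow, EuclideanSpace.norm_sq_eq, EuclideanSpace.norm_sq_eq, Finset.mul_sum]
  refine Finset.sum_le_sum fun i _ => ?_
  simp only [norm_mul, Complex.norm_real, mul_pow]
  gcongr
  exact h2 i

namespace DeformedTube

variable {X : DeformedTube}

/-! ### Charts of Sobolev functions -/

/-- The components that enter the forms: `v`, `D v` and `∇_y v / h`. -/
noncomputable def chart (X : DeformedTube) (v : Coord → ℂ) (V : Coord → Coord →L[ℝ] ℂ) (z : Coord) :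
    Chart :=
  !₂[v z, X.longitudinal v V z, gradY V z (unitVec 0) / (X.h z.1 : ℂ),
    gradY V z (unitVec 1) / (X.h z.1 : ℂ)]

theorem chart_zero (v : Coord → ℂ) (V : Coord → Coord →L[ℝ] ℂ) (z : Coord) :
    X.chart v V z 0 = v z := rfl

theorem chart_one (v : Coord → ℂ) (V : Coord → Coord →L[ℝ] ℂ) (z : Coord) :
    X.chart v V z 1 = X.longitudinal v V z := rfl

theorem chart_two (v : Coord → ℂ) (V : Coord → Coord →L[ℝ] ℂ) (z : Coord) :
    X.chart v V z 2 = gradY V z (unitVec 0) / (X.h z.1 : ℂ) := rfl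

theorem chart_three (v : Coord → ℂ) (V : Coord → Coord →L[ℝ] ℂ) (z : Coord) :
    X.chart v V z 3 = gradY V z (unitVec 1) / (X.h z.1 : ℂ) := rfl

theorem memLp_chart {v : Coord → ℂ} {V : Coord → Coord →L[ℝ] ℂ} (hv : X.FormDomain v V) :
    MemLp (X.chart v V) 2 X.μ := by
  obtain ⟨h1, h2⟩ := formDomain_iff.1 hv
  refine memLp_chart_iff.2 fun i => ?_
  fin_cases i
  · exact h1.1
  · exact memLp_longitudinal h1.1 h1.2.1
  · exact h2 0
  · exact h2 1

theorem chart_add (v w : Coord → ℂ) (V W : Coord → Coord →L[ℝ] ℂ) (z : Coord) :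
    X.chart (v + w) (V + W) z = X.chart v V z + X.chart w W z := by
  ext i
  fin_cases i
  · simp [chart]
  · simp only [chart, longitudinal, gradY, Pi.add_apply, add_apply]
    simp
    ring
  · simp [chart, gradY, add_div]
  · simp [chart, gradY, add_div]

theorem chart_smul (a : ℂ) (v : Coord → ℂ) (V : Coord → Coord →L[ℝ] ℂ) (z : Coord) :
    X.chart (a • v) (a • V) z = a • X.chart v V z := by
  ext i
  fin_cases i
  · simp [chart]
  · simp only [chart, longitudinal, gradY, Pi.smul_apply]
    simp
    ring
  · simp [chart, gradY, mul_div_assoc]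
  · simp [chart, gradY, mul_div_assoc]

theorem FormDomain.add {v w : Coord → ℂ} {V W : Coord → Coord →L[ℝ] ℂ} (hv : X.FormDomain v V)
    (hw : X.FormDomain w W) : X.FormDomain (v + w) (V + W) := by
  obtain ⟨h1, h2⟩ := formDomain_iff.1 hv
  obtain ⟨k1, k2⟩ := formDomain_iff.1 hw
  refine formDomain_iff.2 ⟨h1.add k1, fun i => ?_⟩
  refine ((h2 i).add (k2 i)).congr_norm (aestronglyMeasurable_gradY_div (h1.add k1).2.1.1 _)
    (Eventually.of_forall fun z => ?_)
  simp [gradY, add_div]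

theorem FormDomain.smul {v : Coord → ℂ} {V : Coord → Coord →L[ℝ] ℂ} (hv : X.FormDomain v V)
    (a : ℂ) : X.FormDomain (a • v) (a • V) := by
  obtain ⟨h1, h2⟩ := formDomain_iff.1 hv
  refine formDomain_iff.2 ⟨h1.const_smul a, fun i => ?_⟩
  refine ((h2 i).const_smul a).congr_norm
    (aestronglyMeasurable_gradY_div (h1.const_smul a).2.1.1 _) (Eventually.of_forall fun z => ?_)
  simp [gradY, mul_div_assoc]

theorem FormDomain.congr {v w : Coord → ℂ} {V : Coord → Coord →L[ℝ] ℂ} (hv : X.FormDomain v V)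
    (h : v =ᵐ[X.μ] w) : X.FormDomain w V :=
  ⟨hv.1.congr h ae_eq_rfl, hv.2⟩

/-- On the compact support of a test function `h` is bounded away from zero, so `1/h` is harmless
there. -/
theorem formDomain_of_isTest {φ : Coord → ℂ} (hφ : IsTest X.Ω φ) :
    X.FormDomain φ (fderiv ℝ φ) := by
  refine formDomain_iff.2 ⟨hφ.memH01, fun i => ?_⟩
  obtain ⟨C, hC⟩ := hφ.hasCompactSupport.isCompact.exists_bound_of_continuousOn
    (f := fun z => (X.h z.1)⁻¹)
    ((X.deformation.continuousOn.comp continuous_fst.continuousOn fun z hz =>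
      X.mem_I (hφ.tsupport_subset hz)).inv₀
        fun z hz => (X.h_pos (X.mem_I (hφ.tsupport_subset hz))).ne')
  have hg : MemLp (fun z => gradY (fderiv ℝ φ) z (unitVec i)) 2 X.μ :=
    memLp_gradY (hφ.memLp_fderiv X.μ) _
  refine hg.of_le_mul (c := C) (aestronglyMeasurable_gradY_div (hφ.memLp_fderiv X.μ).1 _)
    (Eventually.of_forall fun z => ?_)
  by_cases hz : z ∈ tsupport φ
  · rw [div_eq_inv_mul, norm_mul, ← Complex.ofReal_inv, Complex.norm_real]
    gcongr
    exact hC z hz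
  · simp [gradY, IsTest.fderiv_eq_zero_of_notMem_tsupport hz]

end DeformedTube

end ThinTube

namespace ThinTube

namespace DeformedTube

variable {X : DeformedTube}

/-! ### The Hilbert space of charts -/

/-- The differential form `ds`. -/
noncomputable def dLong : Coord →L[ℝ] ℂ := Complex.ofRealCLM ∘L ContinuousLinearMap.fst ℝ ℝ Plane

/-- The differential form `dy i`. -/
noncomputable def dTrans (i : Fin 2) : Coord →L[ℝ] ℂ :=
  Complex.ofRealCLM ∘L (EuclideanSpace.proj i : Plane →L[ℝ] ℝ) ∘L ContinuousLinearMap.snd ℝ ℝ Plane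

/-- The partial derivative `∂_s v` in terms of the chart of `v`. -/
noncomputable def partialOfChart (X : DeformedTube) (z : Coord) (p : Chart) : ℂ :=
  p 1 + (X.logDeriv z.1 : ℂ) * p 0 -
    (X.twist z.1 : ℂ) * ((z.2 1 : ℂ) * ((X.h z.1 : ℂ) * p 2) -
      (z.2 0 : ℂ) * ((X.h z.1 : ℂ) * p 3)) +
    (X.logDeriv z.1 : ℂ) * ((z.2 0 : ℂ) * ((X.h z.1 : ℂ) * p 2) +
      (z.2 1 : ℂ) * ((X.h z.1 : ℂ) * p 3))

/-- The gradient of `v` in terms of the chart of `v`. -/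
noncomputable def gradOfChart (X : DeformedTube) (z : Coord) (p : Chart) : Coord →L[ℝ] ℂ :=
  X.partialOfChart z p • dLong + ((X.h z.1 : ℂ) * p 2) • dTrans 0 + ((X.h z.1 : ℂ) * p 3) • dTrans 1

theorem gradOfChart_sub (z : Coord) (p p' : Chart) :
    X.gradOfChart z (p - p') = X.gradOfChart z p - X.gradOfChart z p' := by
  have h : X.partialOfChart z (p - p') = X.partialOfChart z p - X.partialOfChart z p' := by
    simp only [partialOfChart, PiLp.sub_apply]
    ring
  refine ContinuousLinearMap.ext fun w => ?_
  simp [gradOfChart, h]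
  ring

theorem gradOfChart_chart (v : Coord → ℂ) (V : Coord → Coord →L[ℝ] ℂ) {z : Coord}
    (hz : z ∈ X.Ω) : X.gradOfChart z (X.chart v V z) = V z := by
  have hh : (X.h z.1 : ℂ) ≠ 0 := Complex.ofReal_ne_zero.2 (X.h_pos (X.mem_I hz)).ne'
  have hp : X.partialOfChart z (X.chart v V z) = V z (1, 0) := by
    rw [partialOfChart, chart_zero, chart_one, chart_two, chart_three, longitudinal_eq,
      mul_div_cancel₀ _ hh, mul_div_cancel₀ _ hh]
    ring
  ext w
  · simp [gradOfChart, hp, dLong, dTrans]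
  · have hw : V z (0, w) = (w 0 : ℂ) * gradY V z (unitVec 0) + (w 1 : ℂ) * gradY V z (unitVec 1) := by
      have h : ((0 : ℝ), w) = w 0 • ((0 : ℝ), unitVec 0) + w 1 • ((0 : ℝ), unitVec 1) := by
        conv_lhs => rw [plane_eq w]
        simp
      rw [h, map_add, map_smul, map_smul, Complex.real_smul, Complex.real_smul]
      rfl
    simp [gradOfChart, chart_two, chart_three, mul_div_cancel₀ _ hh, dLong, dTrans, hw]
    ring

/-- Together with `gradOfChart_chart` this shows that, pointwise on `Ω`, a function and its gradient
carry the same information as the chart. -/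
theorem chart_gradOfChart (f : Coord → Chart) {z : Coord} (hz : z ∈ X.Ω) :
    X.chart (fun z => f z 0) (fun z => X.gradOfChart z (f z)) z = f z := by
  have hh : (X.h z.1 : ℂ) ≠ 0 := Complex.ofReal_ne_zero.2 (X.h_pos (X.mem_I hz)).ne'
  have h0 : gradY (fun z => X.gradOfChart z (f z)) z (unitVec 0) = (X.h z.1 : ℂ) * f z 2 := by
    simp [gradY, gradOfChart, dLong, dTrans]
  have h1 : gradY (fun z => X.gradOfChart z (f z)) z (unitVec 1) = (X.h z.1 : ℂ) * f z 3 := by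
    simp [gradY, gradOfChart, dLong, dTrans]
  have h2 : X.gradOfChart z (f z) (1, 0) = X.partialOfChart z (f z) := by
    simp [gradOfChart, dLong, dTrans]
  ext i
  fin_cases i
  · rfl
  · refine (chart_one _ _ _).trans ?_
    rw [longitudinal_eq, h0, h1, h2, partialOfChart]
    change _ = f z 1
    ring
  · refine (chart_two _ _ _).trans ?_
    rw [h0, mul_div_cancel_left₀ _ hh]
    rfl
  · refine (chart_three _ _ _).trans ?_
    rw [h1, mul_div_cancel_left₀ _ hh]
    rfl

/-- Recovering the gradient multiplies by `h ≤ M` and never divides by it, so no lower bound on `h`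
is needed. -/
theorem exists_norm_gradOfChart_le (X : DeformedTube) :
    ∃ C : ℝ, 0 < C ∧ ∀ z ∈ X.Ω, ∀ p, ‖X.gradOfChart z p‖ ≤ C * ‖p‖ := by
  obtain ⟨K, hK, -, hq, hω, hy⟩ := X.exists_bound
  have hM := X.deformation.max_pos
  refine ⟨(1 + K + K * (K * (X.M * 1) + K * (X.M * 1)) + K * (K * (X.M * 1) + K * (X.M * 1))) *
    ‖dLong‖ + (X.M * 1) * ‖dTrans 0‖ + (X.M * 1) * ‖dTrans 1‖ + 1, by positivity, fun z hz p => ?_⟩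
  have hp : ∀ i, ‖p i‖ ≤ 1 * ‖p‖ := fun i => (PiLp.norm_apply_le p i).trans_eq (one_mul _).symm
  have hh : ‖(X.h z.1 : ℂ)‖ ≤ X.M := by
    rw [Complex.norm_real, Real.norm_of_nonneg (X.h_pos (X.mem_I hz)).le]
    exact X.h_le (X.mem_I hz)
  have hq' : ‖(X.logDeriv z.1 : ℂ)‖ ≤ K := by
    rw [Complex.norm_real]
    exact hq _ (X.mem_I hz)
  have hω' : ‖(X.twist z.1 : ℂ)‖ ≤ K := by
    rw [Complex.norm_real]
    exact hω _ (X.mem_I hz)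
  have hy' : ∀ i, ‖(z.2 i : ℂ)‖ ≤ K := fun i => by
    rw [Complex.norm_real]
    exact (PiLp.norm_apply_le z.2 i).trans (hy _ (X.mem_S hz))
  have hmul : ∀ {a b : ℂ} {A B : ℝ}, ‖a‖ ≤ A → ‖b‖ ≤ B * ‖p‖ → ‖a * b‖ ≤ A * B * ‖p‖ :=
    fun {a b A B} ha hb => by
      rw [norm_mul, mul_assoc]
      exact mul_le_mul ha hb (norm_nonneg _) ((norm_nonneg _).trans ha)
  have hadd : ∀ {a b : ℂ} {A B : ℝ}, ‖a‖ ≤ A * ‖p‖ → ‖b‖ ≤ B * ‖p‖ → ‖a + b‖ ≤ (A + B) * ‖p‖ :=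
    fun {a b A B} ha hb => by
      rw [add_mul]
      exact (norm_add_le _ _).trans (add_le_add ha hb)
  have hsub : ∀ {a b : ℂ} {A B : ℝ}, ‖a‖ ≤ A * ‖p‖ → ‖b‖ ≤ B * ‖p‖ → ‖a - b‖ ≤ (A + B) * ‖p‖ :=
    fun {a b A B} ha hb => by
      rw [add_mul]
      exact (norm_sub_le _ _).trans (add_le_add ha hb)
  have h2 := hmul hh (hp 2)
  have h3 := hmul hh (hp 3)
  have h1 : ‖X.partialOfChart z p‖ ≤ _ :=
    hadd (hsub (hadd (hp 1) (by simpa using hmul hq' (hp 0)))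
      (hmul hω' (hsub (hmul (hy' 1) h2) (hmul (hy' 0) h3))))
      (hmul hq' (hadd (hmul (hy' 0) h2) (hmul (hy' 1) h3)))
  have h4 : ‖X.gradOfChart z p‖ ≤ ‖X.partialOfChart z p‖ * ‖dLong‖ +
      ‖(X.h z.1 : ℂ) * p 2‖ * ‖dTrans 0‖ + ‖(X.h z.1 : ℂ) * p 3‖ * ‖dTrans 1‖ := by
    refine (norm_add_le _ _).trans (add_le_add ((norm_add_le _ _).trans (add_le_add ?_ ?_)) ?_)
    · exact norm_smul_le (X.partialOfChart z p) dLong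
    · exact norm_smul_le ((X.h z.1 : ℂ) * p 2) (dTrans 0)
    · exact norm_smul_le ((X.h z.1 : ℂ) * p 3) (dTrans 1)
  have h5 := mul_le_mul_of_nonneg_right h1 (norm_nonneg dLong)
  have h6 := mul_le_mul_of_nonneg_right h2 (norm_nonneg (dTrans 0))
  have h7 := mul_le_mul_of_nonneg_right h3 (norm_nonneg (dTrans 1))
  linarith [norm_nonneg p]

theorem aestronglyMeasurable_gradOfChart {f : Coord → Chart} (hf : MemLp f 2 X.μ) :
    AEStronglyMeasurable (fun z => X.gradOfChart z (f z)) X.μ := by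
  have h1 : ∀ i, AEStronglyMeasurable (fun z => f z i) X.μ := fun i => (memLp_chart_iff.1 hf i).1
  have h2 : ∀ {g : ℝ → ℝ}, AEMeasurable g (volume.restrict (interior X.I)) →
      AEStronglyMeasurable (fun z : Coord => (g z.1 : ℂ)) X.μ := fun hg =>
    (Complex.measurable_ofReal.comp_aemeasurable
      (X.aemeasurable_comp_fst hg)).aestronglyMeasurable
  have hh := h2 X.aemeasurable_h
  have hq := h2 X.aemeasurable_logDeriv
  have hω := h2 X.aemeasurable_twist
  have h4 : ∀ i : Fin 2, AEStronglyMeasurable (fun z : Coord => (z.2 i : ℂ)) X.μ := fun i =>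
    (by fun_prop : Continuous fun z : Coord => (z.2 i : ℂ)).aestronglyMeasurable
  have h5 : AEStronglyMeasurable (fun z => X.partialOfChart z (f z)) X.μ :=
    (((h1 1).add (hq.mul (h1 0))).sub
      (hω.mul (((h4 1).mul (hh.mul (h1 2))).sub ((h4 0).mul (hh.mul (h1 3)))))).add
      (hq.mul (((h4 0).mul (hh.mul (h1 2))).add ((h4 1).mul (hh.mul (h1 3)))))
  exact ((h5.smul_const dLong).add ((hh.mul (h1 2)).smul_const (dTrans 0))).add
    ((hh.mul (h1 3)).smul_const (dTrans 1))

/-- The form domain, as a subspace of the space of square integrable charts. -/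
def energySpace (X : DeformedTube) : Submodule ℂ (Lp Chart 2 X.μ) where
  carrier := {x | ∃ v V, X.FormDomain v V ∧ x =ᵐ[X.μ] X.chart v V}
  zero_mem' := by
    have ht : IsTest X.Ω (0 : Coord → ℂ) := ⟨contDiff_const, HasCompactSupport.zero, by
      rw [tsupport_eq_empty_iff.2 rfl]
      exact empty_subset _⟩
    -- Scaling by `0` lets linearity of the chart show that it vanishes.
    have h0 := (formDomain_of_isTest ht).smul 0
    refine ⟨_, _, h0, ?_⟩
    filter_upwards [Lp.coeFn_zero Chart 2 X.μ] with z hz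
    rw [hz, chart_smul, zero_smul]
    rfl
  add_mem' := by
    rintro x y ⟨v, V, hv, hx⟩ ⟨w, W, hw, hy⟩
    refine ⟨_, _, hv.add hw, ?_⟩
    filter_upwards [Lp.coeFn_add x y, hx, hy] with z hz h1 h2
    rw [hz, Pi.add_apply, h1, h2, chart_add]
  smul_mem' := by
    rintro a x ⟨v, V, hv, hx⟩
    refine ⟨_, _, hv.smul a, ?_⟩
    filter_upwards [Lp.coeFn_smul a x, hx] with z hz h1
    rw [hz, Pi.smul_apply, h1, chart_smul]

theorem exists_energySpace {v : Coord → ℂ} {V : Coord → Coord →L[ℝ] ℂ} (hv : X.FormDomain v V) :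
    ∃ x : X.energySpace, (x : Lp Chart 2 X.μ) =ᵐ[X.μ] X.chart v V :=
  ⟨⟨(memLp_chart hv).toLp, v, V, hv, (memLp_chart hv).coeFn_toLp⟩, (memLp_chart hv).coeFn_toLp⟩

/-- A limit of charts determines a candidate function and gradient. Since the reconstruction map is
bounded, convergence of the charts gives convergence of functions and gradients in `L²`, and `H¹₀`
is closed under such limits. -/
theorem isClosed_energySpace : IsClosed (X.energySpace : Set (Lp Chart 2 X.μ)) := by
  refine isClosed_of_closure_subset fun x hx => ?_
  obtain ⟨C, hC0, hC⟩ := X.exists_norm_gradOfChart_le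
  have hU : MemLp (fun z => X.gradOfChart z (x z)) 2 X.μ := by
    refine (Lp.memLp x).of_le_mul (c := C) (aestronglyMeasurable_gradOfChart (Lp.memLp x)) ?_
    filter_upwards [X.ae_mem_Ω] with z hz using hC z hz _
  have hchart : x =ᵐ[X.μ] X.chart (fun z => x z 0) (fun z => X.gradOfChart z (x z)) := by
    filter_upwards [X.ae_mem_Ω] with z hz
    rw [chart_gradOfChart _ hz]
  have hcomp := fun i => (memLp_chart_iff.1 (Lp.memLp x) i)
  refine ⟨fun z => x z 0, fun z => X.gradOfChart z (x z), formDomain_iff.2 ⟨?_, ?_⟩, hchart⟩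
  · refine MemH01.of_forall_approx (hcomp 0) hU fun δ hδ => ?_
    have hC' : ENNReal.ofReal (1 + C) ≠ 0 := by
      rw [Ne, ENNReal.ofReal_eq_zero]
      linarith
    obtain ⟨y, ⟨v, V, hv, hy⟩, hxy⟩ := EMetric.mem_closure_iff.1 hx (δ / ENNReal.ofReal (1 + C))
      (ENNReal.div_pos hδ.ne' ENNReal.ofReal_ne_top)
    rw [Lp.edist_def] at hxy
    have hle : ENNReal.ofReal (1 + C) * eLpNorm (⇑x - ⇑y) 2 X.μ ≤ δ := by
      rw [mul_comm]
      exact ENNReal.mul_le_of_le_div hxy.le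
    refine ⟨v, V, hv.1, le_trans ?_ hle, le_trans ?_ hle⟩
    · refine eLpNorm_le_mul_eLpNorm_of_ae_le_mul ?_ 2
      filter_upwards [hy] with z hz
      calc ‖x z 0 - v z‖ = ‖(x z - y z) 0‖ := by rw [hz]; rfl
        _ ≤ ‖x z - y z‖ := PiLp.norm_apply_le _ _
        _ ≤ (1 + C) * ‖x z - y z‖ := le_mul_of_one_le_left (norm_nonneg _) (by linarith)
    · refine eLpNorm_le_mul_eLpNorm_of_ae_le_mul ?_ 2
      filter_upwards [hy, X.ae_mem_Ω] with z hz hzΩ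
      calc ‖X.gradOfChart z (x z) - V z‖ = ‖X.gradOfChart z (x z - y z)‖ := by
            rw [gradOfChart_sub, hz, gradOfChart_chart v V hzΩ]
        _ ≤ C * ‖x z - y z‖ := hC z hzΩ _
        _ ≤ (1 + C) * ‖x z - y z‖ := by gcongr; linarith
  · intro i
    fin_cases i
    · refine (hcomp 2).ae_eq ?_
      filter_upwards [hchart] with z hz
      rw [hz, chart_two]
      rfl
    · refine (hcomp 3).ae_eq ?_
      filter_upwards [hchart] with z hz
      rw [hz, chart_three]
      rfl

instance : CompleteSpace X.energySpace := isClosed_energySpace.completeSpace_coe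

/-- The `i`-th component of an element of the form domain. -/
noncomputable def component (X : DeformedTube) (i : Fin 4) : X.energySpace →L[ℂ] Lp ℂ 2 X.μ :=
  (EuclideanSpace.proj i : Chart →L[ℂ] ℂ).compLpL 2 X.μ ∘L X.energySpace.subtypeL

theorem coeFn_component (i : Fin 4) (x : X.energySpace) :
    X.component i x =ᵐ[X.μ] fun z => (x : Lp Chart 2 X.μ) z i :=
  (EuclideanSpace.proj i : Chart →L[ℂ] ℂ).coeFn_compLpL _

/-- A function orthogonal to the whole form domain is orthogonal to all real test functions, and so
vanishes almost everywhere. -/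
theorem denseRange_component_zero : DenseRange (X.component 0) := by
  have h : (LinearMap.range (X.component 0).toLinearMap).topologicalClosure = ⊤ := by
    rw [Submodule.topologicalClosure_eq_top_iff, Submodule.eq_bot_iff]
    intro f hf
    have hf' : ∀ᵐ z ∂X.μ, z ∈ X.Ω → f z = 0 := by
      refine X.isOpen_Ω.ae_eq_zero_of_integral_contDiff_smul_eq_zero
        (((Lp.memLp f).locallyIntegrable one_le_two).locallyIntegrableOn _) fun g hg hgc hgs => ?_
      have hφ : IsTest X.Ω fun z => (g z : ℂ) :=
        ⟨Complex.ofRealCLM.contDiff.comp hg, hgc.comp_left Complex.ofReal_zero,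
          (closure_mono fun z hz => by simpa using hz).trans hgs⟩
      obtain ⟨x, hx⟩ := exists_energySpace (formDomain_of_isTest hφ)
      have h0 := hf _ ⟨x, rfl⟩
      rw [L2.inner_def] at h0
      refine (integral_congr_ae ?_).trans h0
      filter_upwards [coeFn_component 0 x, hx] with z h1 h2
      change _ = inner ℂ (X.component 0 x z) (f z)
      rw [h1, h2, chart_zero]
      simp [mul_comm]
    refine Lp.ext ?_
    filter_upwards [hf', X.ae_mem_Ω, Lp.coeFn_zero ℂ 2 X.μ] with z h1 h2 h3
    rw [h1 h2, h3]
    rfl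
  exact Submodule.dense_iff_topologicalClosure_eq_top.2 h

end DeformedTube

end ThinTube

/-! ### Norms of the components of a chart -/

namespace ThinTube

theorem integral_norm_mul_norm_le {α : Type*} [MeasurableSpace α] {μ : Measure α}
    (f g : Lp ℂ 2 μ) : Integrable (fun z => ‖f z‖ * ‖g z‖) μ ∧ ∫ z, ‖f z‖ * ‖g z‖ ∂μ ≤ ‖f‖ * ‖g‖ := by
  have hf := (Lp.memLp f).norm
  have hg := (Lp.memLp g).norm
  refine ⟨hf.integrable_mul hg, ?_⟩
  have h := (le_abs_self _).trans (abs_real_inner_le_norm hf.toLp hg.toLp)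
  rw [Lp.norm_toLp, Lp.norm_toLp, eLpNorm_norm, eLpNorm_norm, ← Lp.norm_def, ← Lp.norm_def,
    L2.inner_def] at h
  refine le_of_eq_of_le (integral_congr_ae ?_) h
  filter_upwards [hf.coeFn_toLp, hg.coeFn_toLp] with z h1 h2
  rw [h1, h2]
  simp [mul_comm]

theorem norm_sq_eq_integral {α F : Type*} [MeasurableSpace α] {μ : Measure α}
    [NormedAddCommGroup F] (f : Lp F 2 μ) : ‖f‖ ^ 2 = ∫ z, ‖f z‖ ^ 2 ∂μ := by
  rw [integral_norm_sq_eq (Lp.memLp f), Lp.norm_def]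

namespace DeformedTube

variable {X : DeformedTube}

theorem norm_component_sq (i : Fin 4) (x : X.energySpace) :
    ‖X.component i x‖ ^ 2 = ∫ z, ‖(x : Lp Chart 2 X.μ) z i‖ ^ 2 ∂X.μ := by
  rw [norm_sq_eq_integral]
  refine integral_congr_ae ?_
  filter_upwards [coeFn_component i x] with z hz
  rw [hz]

theorem integrable_component_sq (i : Fin 4) (x : X.energySpace) :
    Integrable (fun z => ‖(x : Lp Chart 2 X.μ) z i‖ ^ 2) X.μ :=
  (memLp_chart_iff.1 (Lp.memLp _) i).integrable_norm_pow two_ne_zero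

theorem norm_sq_eq_sum_component (x : X.energySpace) :
    ‖x‖ ^ 2 = ∑ i, ‖X.component i x‖ ^ 2 := by
  change ‖(x : Lp Chart 2 X.μ)‖ ^ 2 = _
  rw [norm_sq_eq_integral]
  simp only [EuclideanSpace.norm_sq_eq, norm_component_sq]
  exact integral_finsetSum _ fun i _ => integrable_component_sq i x

/-! ### Forms with given coefficients -/

/-- Coefficients of a form in terms of charts: measurable and bounded. -/
structure IsCoefficient (X : DeformedTube) (a : Fin 4 → Coord → ℝ) : Prop where
  aemeasurable : ∀ i, AEMeasurable (a i) X.μ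
  bounded : ∃ C, ∀ z ∈ X.Ω, ∀ i, |a i z| ≤ C

theorem IsCoefficient.integrable {a : Fin 4 → Coord → ℝ} (ha : X.IsCoefficient a) (i : Fin 4)
    {F : Coord → ℝ} (hF : Integrable F X.μ) : Integrable (fun z => a i z * F z) X.μ := by
  obtain ⟨C, hC⟩ := ha.bounded
  exact integrable_bdd_mul (C := C) (ha.aemeasurable i) (fun z hz => hC z hz i) hF

/-- The sesquilinear form with coefficients `a` on the form domain. -/
noncomputable def chartForm (X : DeformedTube) (a : Fin 4 → Coord → ℝ) (v : Coord → ℂ)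
    (V : Coord → Coord →L[ℝ] ℂ) (u : Coord → ℂ) (U : Coord → Coord →L[ℝ] ℂ) : ℂ :=
  ∫ z, ∑ i, (a i z : ℂ) * (starRingEnd ℂ (X.chart v V z i) * X.chart u U z i) ∂X.μ

/-- `B` represents the form with coefficients `a`. -/
def Represents (X : DeformedTube) (a : Fin 4 → Coord → ℝ)
    (B : X.energySpace →L[ℂ] X.energySpace) : Prop :=
  ∀ x y : X.energySpace, inner ℂ y (B x) =
    ∫ z, ∑ i, (a i z : ℂ) * (starRingEnd ℂ ((y : Lp Chart 2 X.μ) z i) *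
      (x : Lp Chart 2 X.μ) z i) ∂X.μ

/-- Multiplication by the coefficients, compressed to the subspace of charts. -/
theorem exists_operator {a : Fin 4 → Coord → ℝ} (ha : X.IsCoefficient a) :
    ∃ B, X.Represents a B := by
  obtain ⟨C, hC⟩ := ha.bounded
  obtain ⟨A, hA⟩ := exists_diagonal ha.aemeasurable (C := C) (by
    filter_upwards [X.ae_mem_Ω] with z hz using hC z hz)
  refine ⟨ContinuousLinearMap.adjoint X.energySpace.subtypeL ∘L A ∘L X.energySpace.subtypeL,
    fun x y => ?_⟩
  rw [ContinuousLinearMap.comp_apply, ContinuousLinearMap.adjoint_inner_right, L2.inner_def]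
  refine integral_congr_ae ?_
  filter_upwards [hA x] with z hz
  change inner ℂ ((y : Lp Chart 2 X.μ) z) (A x z) = _
  rw [hz, PiLp.inner_apply]
  refine Finset.sum_congr rfl fun i _ => ?_
  simp only [RCLike.inner_apply]
  ring

section Operator

variable {a a' : Fin 4 → Coord → ℝ} {B B' : X.energySpace →L[ℂ] X.energySpace}

theorem Represents.symmetric (hB : X.Represents a B) (x y : X.energySpace) :
    inner ℂ (B x) y = inner ℂ x (B y) := by
  rw [← inner_conj_symm (B x) y, hB, hB, ← integral_conj]
  refine integral_congr_ae (Eventually.of_forall fun z => ?_)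
  simp only [map_sum, map_mul, Complex.conj_ofReal, Complex.conj_conj]
  refine Finset.sum_congr rfl fun i _ => ?_
  ring

theorem Represents.re_inner_self (ha : X.IsCoefficient a) (hB : X.Represents a B)
    (x : X.energySpace) : RCLike.re (inner ℂ x (B x)) =
      ∑ i, ∫ z, a i z * ‖(x : Lp Chart 2 X.μ) z i‖ ^ 2 ∂X.μ := by
  rw [hB, ← integral_finsetSum _ fun i _ => ha.integrable i (integrable_component_sq i x)]
  have h : ∀ z, ∑ i, (a i z : ℂ) * (starRingEnd ℂ ((x : Lp Chart 2 X.μ) z i) *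
      (x : Lp Chart 2 X.μ) z i) =
      ((∑ i, a i z * ‖(x : Lp Chart 2 X.μ) z i‖ ^ 2 : ℝ) : ℂ) := fun z => by
    simp only [← Complex.normSq_eq_conj_mul_self, Complex.normSq_eq_norm_sq]
    push_cast
    rfl
  simp only [h]
  rw [integral_complex_ofReal]
  exact Complex.ofReal_re _

theorem Represents.inner_eq_chartForm (hB : X.Represents a B) {x y : X.energySpace}
    {u v : Coord → ℂ} {U V : Coord → Coord →L[ℝ] ℂ}
    (hx : (x : Lp Chart 2 X.μ) =ᵐ[X.μ] X.chart u U)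
    (hy : (y : Lp Chart 2 X.μ) =ᵐ[X.μ] X.chart v V) :
    inner ℂ y (B x) = X.chartForm a v V u U := by
  rw [hB]
  refine integral_congr_ae ?_
  filter_upwards [hx, hy] with z h1 h2
  rw [h1, h2]

theorem integrable_form (ha : X.IsCoefficient a) (x y : X.energySpace) (i : Fin 4) :
    Integrable (fun z => (a i z : ℂ) * (starRingEnd ℂ ((y : Lp Chart 2 X.μ) z i) *
      (x : Lp Chart 2 X.μ) z i)) X.μ := by
  obtain ⟨C, hC⟩ := ha.bounded
  have hx := memLp_chart_iff.1 (Lp.memLp (x : Lp Chart 2 X.μ)) i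
  have hy := memLp_chart_iff.1 (Lp.memLp (y : Lp Chart 2 X.μ)) i
  have h := (hy.star.integrable_mul hx)
  refine h.bdd_mul (c := C)
    (Complex.measurable_ofReal.comp_aemeasurable (ha.aemeasurable i)).aestronglyMeasurable ?_
  filter_upwards [X.ae_mem_Ω] with z hz
  rw [Complex.norm_real]
  exact hC z hz i

/-- Equality of the transverse coefficients is essential: they are of order `ε⁻²`, and a relative
error `O(ε)` there would not be controlled by the two components on the right. -/
theorem Represents.norm_inner_sub_le (ha : X.IsCoefficient a) (ha' : X.IsCoefficient a')
    (hB : X.Represents a B) (hB' : X.Represents a' B') {η : ℝ} (hη : 0 ≤ η)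
    (h0 : ∀ z ∈ X.Ω, |a 0 z - a' 0 z| ≤ η) (h1 : ∀ z ∈ X.Ω, |a 1 z - a' 1 z| ≤ η)
    (h2 : a 2 = a' 2) (h3 : a 3 = a' 3) (x y : X.energySpace) :
    ‖inner ℂ y (B x) - inner ℂ y (B' x)‖ ≤ η * (‖X.component 0 y‖ * ‖X.component 0 x‖ +
      ‖X.component 1 y‖ * ‖X.component 1 x‖) := by
  rw [hB, hB', ← integral_sub (integrable_finsetSum _ fun i _ => integrable_form ha x y i)
    (integrable_finsetSum _ fun i _ => integrable_form ha' x y i)]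
  obtain ⟨i0, j0⟩ := integral_norm_mul_norm_le (X.component 0 y) (X.component 0 x)
  obtain ⟨i1, j1⟩ := integral_norm_mul_norm_le (X.component 1 y) (X.component 1 x)
  refine (norm_integral_le_of_norm_le ((i0.add i1).const_mul η) ?_).trans ?_
  · filter_upwards [X.ae_mem_Ω, coeFn_component 0 x, coeFn_component 0 y, coeFn_component 1 x,
      coeFn_component 1 y] with z hz e1 e2 e3 e4
    rw [← Finset.sum_sub_distrib]
    simp only [← sub_mul, Fin.sum_univ_four, h2, h3, sub_self, zero_mul, add_zero]
    rw [Pi.add_apply, e1, e2, e3, e4, mul_add]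
    refine (norm_add_le _ _).trans (add_le_add ?_ ?_)
    · rw [norm_mul, norm_mul, RCLike.norm_conj, ← Complex.ofReal_sub, Complex.norm_real]
      exact mul_le_mul_of_nonneg_right (h0 z hz) (by positivity)
    · rw [norm_mul, norm_mul, RCLike.norm_conj, ← Complex.ofReal_sub, Complex.norm_real]
      exact mul_le_mul_of_nonneg_right (h1 z hz) (by positivity)
  · rw [integral_const_mul]
    refine mul_le_mul_of_nonneg_left ?_ hη
    exact (integral_add i0 i1).trans_le (add_le_add j0 j1)

end Operator

end DeformedTube

end ThinTube

namespace ThinTube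

namespace DeformedTube

variable {X : DeformedTube}

/-! ### Coefficients of the forms of the tube -/

/-- Coefficients that bound those of both forms from below. -/
noncomputable def lowerCoeff (X : DeformedTube) (ε : ℝ) : Fin 4 → Coord → ℝ :=
  ![fun z => -(firstEigenvalue X.S / (ε ^ 2 * X.M ^ 2)) * X.beta ε z, fun _ => 3 / 4,
    fun z => 1 / ε ^ 2 * X.beta ε z, fun z => 1 / ε ^ 2 * X.beta ε z]

theorem isCoefficient_vec {a b : Coord → ℝ} {ε : ℝ}
    (hβ : ∀ z ∈ X.Ω, 1 / 2 ≤ X.beta ε z ∧ X.beta ε z ≤ 2)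
    (ha : AEMeasurable a X.μ) (hb : AEMeasurable b X.μ) {C D : ℝ} (hC : ∀ z ∈ X.Ω, |a z| ≤ C)
    (hD : ∀ z ∈ X.Ω, |b z| ≤ D) :
    X.IsCoefficient ![a, b, fun z => 1 / ε ^ 2 * X.beta ε z, fun z => 1 / ε ^ 2 * X.beta ε z] := by
  have h1 : AEMeasurable (fun z => 1 / ε ^ 2 * X.beta ε z) X.μ :=
    (X.aemeasurable_beta ε).const_mul _
  have h2 : ∀ z ∈ X.Ω, |1 / ε ^ 2 * X.beta ε z| ≤ 1 / ε ^ 2 * 2 := fun z hz => by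
    have := hβ z hz
    rw [abs_mul, abs_of_nonneg (by positivity : 0 ≤ 1 / ε ^ 2), abs_of_nonneg (by linarith)]
    gcongr
    exact this.2
  constructor
  · intro i
    fin_cases i
    · exact ha
    · exact hb
    · exact h1
    · exact h1
  · refine ⟨max (max C D) (1 / ε ^ 2 * 2), fun z hz i => ?_⟩
    fin_cases i
    · exact (hC z hz).trans ((le_max_left _ _).trans (le_max_left _ _))
    · exact (hD z hz).trans ((le_max_right _ _).trans (le_max_left _ _))
    · exact (h2 z hz).trans (le_max_right _ _)
    · exact (h2 z hz).trans (le_max_right _ _)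

/-- The three summands cover the zeroth order coefficients of both forms and of their common lower
bound. -/
theorem abs_mul_beta_le {ε : ℝ} (hβ : ∀ z ∈ X.Ω, 1 / 2 ≤ X.beta ε z ∧ X.beta ε z ≤ 2) (b c d : ℝ) :
    ∀ z ∈ X.Ω, |b * X.beta ε z + c * X.beta ε z + d| ≤ |b| * 2 + |c| * 2 + |d| := by
  intro z hz
  have h1 : |X.beta ε z| ≤ 2 := by
    have := hβ z hz
    rw [abs_of_nonneg (by linarith)]
    exact this.2
  refine (abs_add_le _ _).trans (add_le_add ((abs_add_le _ _).trans (add_le_add ?_ ?_)) le_rfl)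
  all_goals
    rw [abs_mul]
    gcongr

theorem isCoefficient_lowerCoeff {ε : ℝ}
    (hβ : ∀ z ∈ X.Ω, 1 / 2 ≤ X.beta ε z ∧ X.beta ε z ≤ 2) :
    X.IsCoefficient (X.lowerCoeff ε) :=
  isCoefficient_vec hβ ((X.aemeasurable_beta ε).const_mul _) aemeasurable_const
    (fun z hz => by simpa using abs_mul_beta_le hβ (-(firstEigenvalue X.S / (ε ^ 2 * X.M ^ 2))) 0 0 z hz)
    (fun _ _ => le_rfl)

/-- Forms with coefficients above the lower ones are uniformly bounded from below. -/
theorem exists_lower_bound_of_represents (X : DeformedTube) :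
    ∃ ε₁ : ℝ, 0 < ε₁ ∧ ∀ ε : ℝ, 0 < ε → ε < ε₁ →
      (∀ z ∈ X.Ω, 1 / 2 ≤ X.beta ε z ∧ X.beta ε z ≤ 2) →
      ∀ (a : Fin 4 → Coord → ℝ) (B : X.energySpace →L[ℂ] X.energySpace), X.IsCoefficient a →
        (∀ z ∈ X.Ω, ∀ i, X.lowerCoeff ε i z ≤ a i z) → X.Represents a B →
        (∀ x, ‖X.component 0 x‖ ^ 2 + 1 / 2 * ‖X.component 1 x‖ ^ 2 ≤
          RCLike.re (inner ℂ x (B x))) ∧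
        ∃ δ : ℝ, 0 < δ ∧ ∀ x, δ * ‖x‖ ^ 2 ≤ RCLike.re (inner ℂ x (B x)) := by
  obtain ⟨ε₁, hε₁, h⟩ := X.exists_lower_bound
  refine ⟨ε₁, hε₁, fun ε hε hεε₁ hβ a B ha hle hB => ?_⟩
  have hl := isCoefficient_lowerCoeff hβ
  set L : ℝ := firstEigenvalue X.S / (ε ^ 2 * X.M ^ 2) with hL
  have hL0 : 0 ≤ L := by
    have := firstEigenvalue_pos X.isOpen_section X.isBounded_section
      X.simplyConnected_section.nonempty
    have := X.deformation.max_pos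
    positivity
  let N : Fin 4 → X.energySpace → ℝ := fun i x =>
    ∫ z, X.beta ε z * ‖(x : Lp Chart 2 X.μ) z i‖ ^ 2 ∂X.μ
  have hE : ∀ x, 3 / 4 * ‖X.component 1 x‖ ^ 2 + 1 / ε ^ 2 * (N 2 x + N 3 x) - L * N 0 x ≤
      RCLike.re (inner ℂ x (B x)) := fun x => by
    have h1 : ∑ i, ∫ z, X.lowerCoeff ε i z * ‖(x : Lp Chart 2 X.μ) z i‖ ^ 2 ∂X.μ ≤
        RCLike.re (inner ℂ x (B x)) := by
      rw [hB.re_inner_self ha]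
      refine Finset.sum_le_sum fun i _ => integral_mono_ae
        (hl.integrable i (integrable_component_sq i x))
        (ha.integrable i (integrable_component_sq i x)) ?_
      filter_upwards [X.ae_mem_Ω] with z hz
      exact mul_le_mul_of_nonneg_right (hle z hz i) (sq_nonneg _)
    refine le_of_eq_of_le ?_ h1
    have e0 : ∫ z, X.lowerCoeff ε 0 z * ‖(x : Lp Chart 2 X.μ) z 0‖ ^ 2 ∂X.μ = -L * N 0 x := by
      rw [← integral_const_mul]
      exact integral_congr_ae (Eventually.of_forall fun z => mul_assoc _ _ _)
    have e1 : ∫ z, X.lowerCoeff ε 1 z * ‖(x : Lp Chart 2 X.μ) z 1‖ ^ 2 ∂X.μ =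
        3 / 4 * ‖X.component 1 x‖ ^ 2 := by
      rw [norm_component_sq, ← integral_const_mul]
      rfl
    have e2 : ∫ z, X.lowerCoeff ε 2 z * ‖(x : Lp Chart 2 X.μ) z 2‖ ^ 2 ∂X.μ =
        1 / ε ^ 2 * N 2 x := by
      rw [← integral_const_mul]
      exact integral_congr_ae (Eventually.of_forall fun z => mul_assoc _ _ _)
    have e3 : ∫ z, X.lowerCoeff ε 3 z * ‖(x : Lp Chart 2 X.μ) z 3‖ ^ 2 ∂X.μ =
        1 / ε ^ 2 * N 3 x := by
      rw [← integral_const_mul]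
      exact integral_congr_ae (Eventually.of_forall fun z => mul_assoc _ _ _)
    rw [Fin.sum_univ_four, e0, e1, e2, e3]
    ring
  have hlow : ∀ x, ‖X.component 0 x‖ ^ 2 + 1 / 2 * ‖X.component 1 x‖ ^ 2 ≤
      RCLike.re (inner ℂ x (B x)) := fun x => by
    refine le_trans ?_ (hE x)
    obtain ⟨v, V, hv, hx⟩ := x.2
    have h1 := h ε hε hεε₁ hβ v V hv
    have hN : ∀ (i : Fin 4) (w : Coord → ℝ), ∫ z, w z * ‖(x : Lp Chart 2 X.μ) z i‖ ^ 2 ∂X.μ =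
        ∫ z, w z * ‖X.chart v V z i‖ ^ 2 ∂X.μ := fun i w => by
      refine integral_congr_ae ?_
      filter_upwards [hx] with z hz
      rw [hz]
    have hc : ∀ i, ‖X.component i x‖ ^ 2 = ∫ z, ‖X.chart v V z i‖ ^ 2 ∂X.μ := fun i => by
      rw [norm_component_sq]
      refine integral_congr_ae ?_
      filter_upwards [hx] with z hz
      rw [hz]
    simp only [N, hN, hc, chart_zero, chart_one, chart_two, chart_three]
    linarith
  -- Components `0` and `1` contribute at most `2E` to `‖x‖²`, where `E` is the form at `x`; the
  -- transverse ones contribute at most `2 ε² (1 + 2L) E`. This constant depends on `ε`, but only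
  -- the existence of the inverse relies on it.
  refine ⟨hlow, 1 / (2 + 2 * ε ^ 2 * (1 + 2 * L)), by positivity, fun x => ?_⟩
  have h0 := hlow x
  have h1 := hE x
  have hN0 : N 0 x ≤ 2 * ‖X.component 0 x‖ ^ 2 := by
    rw [norm_component_sq, ← integral_const_mul]
    refine integral_mono_ae (integrable_beta_mul hβ (integrable_component_sq 0 x))
      ((integrable_component_sq 0 x).const_mul 2) ?_
    filter_upwards [X.ae_mem_Ω] with z hz
    exact mul_le_mul_of_nonneg_right (hβ z hz).2 (sq_nonneg _)
  have hN2 : ∀ i, 1 / 2 * ‖X.component i x‖ ^ 2 ≤ N i x := fun i => by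
    rw [norm_component_sq, ← integral_const_mul]
    refine integral_mono_ae ((integrable_component_sq i x).const_mul _)
      (integrable_beta_mul hβ (integrable_component_sq i x)) ?_
    filter_upwards [X.ae_mem_Ω] with z hz
    exact mul_le_mul_of_nonneg_right (hβ z hz).1 (sq_nonneg _)
  rw [norm_sq_eq_sum_component, Fin.sum_univ_four, div_mul_eq_mul_div, one_mul,
    div_le_iff₀ (by positivity)]
  set E := RCLike.re (inner ℂ x (B x))
  have h2 := hN2 2
  have h3 := hN2 3
  have h4 : N 2 x + N 3 x ≤ ε ^ 2 * (E + L * N 0 x) := by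
    have h5 : 1 / ε ^ 2 * (N 2 x + N 3 x) ≤ E + L * N 0 x := by
      linarith [sq_nonneg ‖X.component 1 x‖]
    rw [div_mul_eq_mul_div, one_mul, div_le_iff₀ (by positivity)] at h5
    linarith
  have h5 : L * N 0 x ≤ 2 * L * E := by
    have : N 0 x ≤ 2 * E := by linarith [sq_nonneg ‖X.component 1 x‖]
    nlinarith
  have h6 : ε ^ 2 * (E + L * N 0 x) ≤ ε ^ 2 * (E + 2 * L * E) := by gcongr
  nlinarith [sq_nonneg ‖X.component 0 x‖, sq_nonneg ‖X.component 1 x‖]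

/-- The coefficients of `g_ε`. -/
noncomputable def gCoeff (X : DeformedTube) (c ε : ℝ) : Fin 4 → Coord → ℝ :=
  ![fun z => -(firstEigenvalue X.S / (ε ^ 2 * X.M ^ 2)) * X.beta ε z + c, fun _ => 1,
    fun z => 1 / ε ^ 2 * X.beta ε z, fun z => 1 / ε ^ 2 * X.beta ε z]

/-- The coefficients of `ĝ_ε`. -/
noncomputable def gHatCoeff (X : DeformedTube) (c ε : ℝ) : Fin 4 → Coord → ℝ :=
  ![fun z => -(firstEigenvalue X.S / (ε ^ 2 * X.M ^ 2)) * X.beta ε z + c * X.beta ε z,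
    fun z => 1 / X.beta ε z, fun z => 1 / ε ^ 2 * X.beta ε z, fun z => 1 / ε ^ 2 * X.beta ε z]

theorem isCoefficient_gCoeff (c : ℝ) {ε : ℝ}
    (hβ : ∀ z ∈ X.Ω, 1 / 2 ≤ X.beta ε z ∧ X.beta ε z ≤ 2) : X.IsCoefficient (X.gCoeff c ε) :=
  isCoefficient_vec hβ (((X.aemeasurable_beta ε).const_mul _).add_const c) aemeasurable_const
    (fun z hz => by
      simpa using abs_mul_beta_le hβ (-(firstEigenvalue X.S / (ε ^ 2 * X.M ^ 2))) 0 c z hz)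
    (fun _ _ => le_rfl)

theorem isCoefficient_gHatCoeff (c : ℝ) {ε : ℝ}
    (hβ : ∀ z ∈ X.Ω, 1 / 2 ≤ X.beta ε z ∧ X.beta ε z ≤ 2) : X.IsCoefficient (X.gHatCoeff c ε) := by
  have hm := X.aemeasurable_beta ε
  refine isCoefficient_vec (D := 2) hβ ((hm.const_mul _).add (hm.const_mul c))
    (aemeasurable_const.div hm) (fun z hz => by
      simpa using abs_mul_beta_le hβ (-(firstEigenvalue X.S / (ε ^ 2 * X.M ^ 2))) c 0 z hz)
    (fun z hz => ?_)
  have := hβ z hz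
  have h0 : 0 < X.beta ε z := by linarith
  rw [abs_of_pos (by positivity), div_le_iff₀ h0]
  linarith

theorem lowerCoeff_le_gCoeff {c ε : ℝ} (hc : 0 ≤ c) (z : Coord) (i : Fin 4) :
    X.lowerCoeff ε i z ≤ X.gCoeff c ε i z := by
  fin_cases i
  · exact le_add_of_nonneg_right hc
  · exact (by norm_num : (3 / 4 : ℝ) ≤ 1)
  · exact le_rfl
  · exact le_rfl

/-- The bound `β_ε ≤ 4/3` is what turns `1/β_ε` into at least `3/4`, and the term with `c` is
dropped by its sign. -/
theorem lowerCoeff_le_gHatCoeff {c ε : ℝ} (hc : 0 ≤ c) {z : Coord}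
    (hβ : 0 < X.beta ε z ∧ X.beta ε z ≤ 4 / 3) (i : Fin 4) :
    X.lowerCoeff ε i z ≤ X.gHatCoeff c ε i z := by
  fin_cases i
  · exact le_add_of_nonneg_right (mul_nonneg hc hβ.1.le)
  · change 3 / 4 ≤ 1 / X.beta ε z
    rw [le_div_iff₀ hβ.1]
    linarith [hβ.2]
  · exact le_rfl
  · exact le_rfl

theorem g_eq_chartForm (c ε : ℝ) : X.g c ε = X.chartForm (X.gCoeff c ε) := by
  funext v V u U
  refine integral_congr_ae (Eventually.of_forall fun z => ?_)
  simp only [Fin.sum_univ_four, chart_zero, chart_one, chart_two, chart_three, gCoeff,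
    gradYInner, Fin.sum_univ_two, Matrix.cons_val, map_div₀, Complex.conj_ofReal]
  push_cast
  ring

theorem gHat_eq_chartForm (c ε : ℝ) : X.gHat c ε = X.chartForm (X.gHatCoeff c ε) := by
  funext v V u U
  refine integral_congr_ae (Eventually.of_forall fun z => ?_)
  simp only [Fin.sum_univ_four, chart_zero, chart_one, chart_two, chart_three, gHatCoeff,
    gradYInner, Fin.sum_univ_two, Matrix.cons_val, map_div₀, Complex.conj_ofReal]
  push_cast
  ring

end DeformedTube

end ThinTube

/-! ### Associated operators in comparable `L²` spaces -/

namespace ThinTube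

/-- Comparable measures have the same square integrable functions. -/
theorem exists_lp_equiv {α : Type*} [MeasurableSpace α] {μ ν : Measure α}
    (h₁ : ν ≤ (2 : ENNReal) • μ) (h₂ : μ ≤ (2 : ENNReal) • ν) :
    ∃ J : Lp ℂ 2 ν ≃L[ℂ] Lp ℂ 2 μ, ∀ u, J u =ᵐ[μ] u := by
  have hc : (2 : ENNReal) ≠ ⊤ := ENNReal.ofNat_ne_top
  have hμν : μ ≪ ν := Measure.absolutelyContinuous_of_le_smul h₂
  have hνμ : ν ≪ μ := Measure.absolutelyContinuous_of_le_smul h₁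
  let F : Lp ℂ 2 ν →L[ℝ] Lp ℂ 2 μ := Lp.LpToLpOfMeasureLeSMul hc h₂
  let F' : Lp ℂ 2 μ →L[ℝ] Lp ℂ 2 ν := Lp.LpToLpOfMeasureLeSMul hc h₁
  have hF : ∀ u, F u =ᵐ[μ] u := Lp.coeFn_LpToLpOfMeasureLeSMul hc h₂
  have hF' : ∀ u, F' u =ᵐ[ν] u := Lp.coeFn_LpToLpOfMeasureLeSMul hc h₁
  let e : Lp ℂ 2 ν ≃L[ℂ] Lp ℂ 2 μ :=
    { toFun := F
      invFun := F'
      map_add' := map_add F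
      -- `F` is given as a real linear map; complex homogeneity is checked almost everywhere.
      map_smul' := fun a u => by
        refine Lp.ext ?_
        filter_upwards [hF (a • u), hF u, hμν.ae_eq (Lp.coeFn_smul a u), Lp.coeFn_smul a (F u)]
          with z h1 h2 h3 h4
        rw [h1, h3, RingHom.id_apply, h4, Pi.smul_apply, Pi.smul_apply, h2]
      left_inv := fun u => Lp.ext (by
        filter_upwards [hF' (F u), hνμ.ae_eq (hF u)] with z h1 h2
        rw [h1, h2])
      right_inv := fun u => Lp.ext (by
        filter_upwards [hF (F' u), hμν.ae_eq (hF' u)] with z h1 h2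
        rw [h1, h2])
      continuous_toFun := F.continuous
      continuous_invFun := F'.continuous }
  exact ⟨e, hF⟩

namespace DeformedTube

variable {X : DeformedTube}

theorem chart_congr {v w : Coord → ℂ} (h : v =ᵐ[X.μ] w) (V : Coord → Coord →L[ℝ] ℂ) :
    X.chart v V =ᵐ[X.μ] X.chart w V := by
  filter_upwards [h] with z hz
  simp only [chart, longitudinal, hz]

/-- The self-adjoint operator in `L²(ν)` associated with a coercive form. -/
theorem exists_isAssociated {ν : Measure Coord} (hν : ν ≪ X.μ)
    (J : Lp ℂ 2 ν ≃L[ℂ] Lp ℂ 2 X.μ) (hJ : ∀ u, J u =ᵐ[X.μ] u) {a : Fin 4 → Coord → ℝ}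
    {B : X.energySpace →L[ℂ] X.energySpace} (hB : X.Represents a B) {δ : ℝ} (hδ : 0 < δ)
    (hcoer : ∀ x, δ * ‖x‖ ^ 2 ≤ RCLike.re (inner ℂ x (B x))) :
    ∃ (A : Lp ℂ 2 ν →ₗ.[ℂ] Lp ℂ 2 ν) (T : Lp ℂ 2 ν →L[ℂ] X.energySpace),
      X.IsAssociated ν (X.chartForm a) A ∧ IsSelfAdjoint A ∧
      IsBoundedInverse A ((J.symm : Lp ℂ 2 X.μ →L[ℂ] Lp ℂ 2 ν) ∘L X.component 0 ∘L T) ∧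
      ∀ f y, inner ℂ y (B (T f)) = ∫ z, starRingEnd ℂ (X.component 0 y z) * f z ∂ν := by
  -- The same form space serves every `ν`; only the embedding into the `L²` space, and hence the
  -- right hand side of the equation, changes.
  let j : X.energySpace →L[ℂ] Lp ℂ 2 ν :=
    (J.symm : Lp ℂ 2 X.μ →L[ℂ] Lp ℂ 2 ν) ∘L X.component 0
  have hj : DenseRange j :=
    J.symm.surjective.denseRange.comp denseRange_component_zero J.symm.continuous
  have hjJ : ∀ x u, j x = u ↔ X.component 0 x = J u := fun x u => J.symm_apply_eq
  have hinner : ∀ y f, inner ℂ (j y) f = ∫ z, starRingEnd ℂ (X.component 0 y z) * f z ∂ν := by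
    intro y f
    rw [L2.inner_def]
    refine integral_congr_ae ?_
    have h1 : X.component 0 y =ᵐ[X.μ] j y := by
      rw [(hjJ y (j y)).1 rfl]
      exact hJ (j y)
    filter_upwards [hν.ae_eq h1] with z hz
    rw [hz, RCLike.inner_apply, mul_comm]
  obtain ⟨A, T, hA, hinv, hT, hgraph⟩ := exists_operator_of_coercive B hB.symmetric hδ hcoer j hj
  refine ⟨A, T, fun u f => ?_, hA, hinv, fun f y => by rw [hT, hinner]⟩
  rw [hgraph]
  have hval : ∀ {y : X.energySpace} {v : Coord → ℂ} {V : Coord → Coord →L[ℝ] ℂ},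
      (y : Lp Chart 2 X.μ) =ᵐ[X.μ] X.chart v V → X.component 0 y =ᵐ[X.μ] v := by
    intro y v V hy
    filter_upwards [coeFn_component 0 y, hy] with z h1 h2
    rw [h1, h2, chart_zero]
  have hrhs : ∀ {y : X.energySpace} {v : Coord → ℂ} {V : Coord → Coord →L[ℝ] ℂ},
      (y : Lp Chart 2 X.μ) =ᵐ[X.μ] X.chart v V →
      inner ℂ (j y) f = ∫ z, starRingEnd ℂ (v z) * f z ∂ν := by
    intro y v V hy
    rw [hinner]
    refine integral_congr_ae ?_
    filter_upwards [hν.ae_eq (hval hy)] with z hz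
    rw [hz]
  constructor
  · rintro ⟨x, hxu, hx⟩
    obtain ⟨v, V, hv, hxv⟩ := x.2
    have hvu : v =ᵐ[X.μ] u := by
      have h1 := hval hxv
      rw [(hjJ x u).1 hxu] at h1
      exact h1.symm.trans (hJ u)
    -- The gradient field is kept and only the representative of the function is exchanged.
    refine ⟨V, hv.congr hvu, fun w W hw => ?_⟩
    obtain ⟨y, hy⟩ := exists_energySpace hw
    rw [← hB.inner_eq_chartForm (hxv.trans (chart_congr hvu V)) hy, hx, hrhs hy]
  · rintro ⟨U, hU, h⟩
    obtain ⟨x, hx⟩ := exists_energySpace hU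
    refine ⟨x, (hjJ x u).2 (Lp.ext ((hval hx).trans (hJ u).symm)), fun y => ?_⟩
    obtain ⟨v, V, hv, hy⟩ := y.2
    rw [hB.inner_eq_chartForm hx hy, h v V hv, hrhs hy]

/-! ### The weighted space -/

section Weighted

variable {ε : ℝ}

theorem betaMeasure_le (hβ : ∀ z ∈ X.Ω, 1 / 2 ≤ X.beta ε z ∧ X.beta ε z ≤ 2) :
    X.betaMeasure ε ≤ (2 : ENNReal) • X.μ := by
  rw [← withDensity_const]
  refine withDensity_mono ?_
  filter_upwards [X.ae_mem_Ω] with z hz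
  exact ENNReal.ofReal_le_of_le_toReal (by simpa using (hβ z hz).2)

theorem le_betaMeasure (hβ : ∀ z ∈ X.Ω, 1 / 2 ≤ X.beta ε z ∧ X.beta ε z ≤ 2) :
    X.μ ≤ (2 : ENNReal) • X.betaMeasure ε := by
  rw [betaMeasure, ← withDensity_smul' _ _ ENNReal.ofNat_ne_top]
  conv_lhs => rw [← withDensity_one (μ := X.μ)]
  refine withDensity_mono ?_
  filter_upwards [X.ae_mem_Ω] with z hz
  have h := (hβ z hz).1
  simp only [Pi.one_apply, Pi.smul_apply, smul_eq_mul]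
  rw [← ENNReal.ofReal_ofNat 2, ← ENNReal.ofReal_mul (by norm_num), ← ENNReal.ofReal_one]
  exact ENNReal.ofReal_le_ofReal (by linarith)

theorem integral_betaMeasure (hβ : ∀ z ∈ X.Ω, 1 / 2 ≤ X.beta ε z ∧ X.beta ε z ≤ 2)
    (f : Coord → ℂ) :
    ∫ z, f z ∂X.betaMeasure ε = ∫ z, (X.beta ε z : ℂ) * f z ∂X.μ := by
  rw [betaMeasure, integral_withDensity_eq_integral_toReal_smul₀
    (X.aemeasurable_beta ε).ennreal_ofReal (Eventually.of_forall fun _ => ENNReal.ofReal_lt_top)]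
  refine integral_congr_ae ?_
  filter_upwards [X.ae_mem_Ω] with z hz
  rw [ENNReal.toReal_ofReal (by linarith [(hβ z hz).1]), Complex.real_smul]

/-- A right hand side `f` in the weighted space acts like `β_ε f` in the unweighted one, and this
differs from `f` by a relative error `η`. -/
theorem exists_beta_mul (hβ : ∀ z ∈ X.Ω, 1 / 2 ≤ X.beta ε z ∧ X.beta ε z ≤ 2)
    {η : ℝ} (hη : ∀ z ∈ X.Ω, |X.beta ε z - 1| ≤ η) (f : Lp ℂ 2 X.μ) :
    ∃ f' : Lp ℂ 2 X.μ, (f' =ᵐ[X.μ] fun z => (X.beta ε z : ℂ) * f z) ∧ ‖f' - f‖ ≤ η * ‖f‖ := by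
  have hm : MemLp (fun z => (X.beta ε z : ℂ) * f z) 2 X.μ := by
    refine (Lp.memLp f).of_le_mul (c := 2) ((Complex.measurable_ofReal.comp_aemeasurable
      (X.aemeasurable_beta ε)).aestronglyMeasurable.mul (Lp.memLp f).1) ?_
    filter_upwards [X.ae_mem_Ω] with z hz
    have := hβ z hz
    rw [norm_mul, Complex.norm_real, Real.norm_of_nonneg (by linarith)]
    gcongr
    exact this.2
  refine ⟨hm.toLp, hm.coeFn_toLp, Lp.norm_le_mul_norm_of_ae_le_mul ?_⟩
  filter_upwards [Lp.coeFn_sub hm.toLp f, hm.coeFn_toLp, X.ae_mem_Ω] with z h1 h2 hz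
  rw [h1, Pi.sub_apply, h2]
  calc ‖(X.beta ε z : ℂ) * f z - f z‖ = |X.beta ε z - 1| * ‖f z‖ := by
        rw [← Real.norm_eq_abs, ← Complex.norm_real, ← norm_mul]
        congr 1
        push_cast
        ring
    _ ≤ η * ‖f z‖ := by gcongr; exact hη z hz

end Weighted

end DeformedTube

end ThinTube

/-! ### Comparison of the inverses -/

namespace ThinTube

namespace DeformedTube

variable {X : DeformedTube}

/-- Bounds for `β_ε` that make the forms comparable. -/
structure IsSmall (X : DeformedTube) (c ε η : ℝ) : Prop where
  eta_le : η ≤ 1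
  half_le : ∀ z ∈ X.Ω, 1 / 2 ≤ X.beta ε z
  le_four_thirds : ∀ z ∈ X.Ω, X.beta ε z ≤ 4 / 3
  abs_sub_one_le : ∀ z ∈ X.Ω, |X.beta ε z - 1| ≤ η
  const_mul_le : ∀ z ∈ X.Ω, |c - c * X.beta ε z| ≤ η
  inv_le : ∀ z ∈ X.Ω, |1 - 1 / X.beta ε z| ≤ η

theorem exists_isSmall (X : DeformedTube) (c : ℝ) : ∃ ε₂ D : ℝ, 0 < ε₂ ∧ 0 < D ∧
    ∀ ε : ℝ, 0 < ε → ε < ε₂ → (∀ z ∈ X.I ×ˢ X.S, 0 < X.beta ε z) ∧ X.IsSmall c ε (D * ε) := by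
  obtain ⟨C, hC1, hC⟩ := X.exists_abs_beta_sub_one_le
  have hD : 0 < (2 + |c|) * C := by positivity
  -- For such `ε`, `|β_ε - 1| ≤ 1/8`. In `(2 + |c|) C` the `2` pays for `|1 - 1/β_ε| ≤ 2 |β_ε - 1|`,
  -- and `|c|` for the zeroth order term.
  refine ⟨1 / (4 * ((2 + |c|) * C)), (2 + |c|) * C, by positivity, hD, fun ε hε hlt => ?_⟩
  rw [lt_div_iff₀ (by positivity)] at hlt
  have hCε : 0 < C * ε := by positivity
  have hcC : 0 ≤ |c| * (C * ε) := by positivity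
  have hsmall : C * ε ≤ 1 / 8 := by nlinarith
  have habs := fun z hz => abs_le.1 (hC ε hε z hz)
  have hsub : X.Ω ⊆ X.I ×ˢ X.S := fun z hz => ⟨X.mem_I hz, X.mem_S hz⟩
  refine ⟨fun z hz => by linarith [(habs z hz).1], ?_, fun z hz => ?_, fun z hz => ?_,
    fun z hz => ?_, fun z hz => ?_, fun z hz => ?_⟩
  · nlinarith
  · linarith [(habs z (hsub hz)).1]
  · linarith [(habs z (hsub hz)).2]
  · refine (hC ε hε z (hsub hz)).trans ?_
    nlinarith
  · have h := hC ε hε z (hsub hz)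
    rw [show c - c * X.beta ε z = c * (1 - X.beta ε z) by ring, abs_mul, abs_sub_comm]
    nlinarith [abs_nonneg c]
  · have h := hC ε hε z (hsub hz)
    have hb : 1 / 2 ≤ X.beta ε z := by linarith [(habs z (hsub hz)).1]
    rw [show 1 - 1 / X.beta ε z = (X.beta ε z - 1) / X.beta ε z by field_simp, abs_div,
      abs_of_pos (by linarith : 0 < X.beta ε z), div_le_iff₀ (by linarith)]
    nlinarith

theorem norm_component_sub_le {c ε η : ℝ} (hη : 0 ≤ η) (h : X.IsSmall c ε η)
    {B B' : X.energySpace →L[ℂ] X.energySpace} (hB : X.Represents (X.gCoeff c ε) B)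
    (hB' : X.Represents (X.gHatCoeff c ε) B')
    (hlow : ∀ x, ‖X.component 0 x‖ ^ 2 + 1 / 2 * ‖X.component 1 x‖ ^ 2 ≤
      RCLike.re (inner ℂ x (B x)))
    (hlow' : ∀ x, ‖X.component 0 x‖ ^ 2 + 1 / 2 * ‖X.component 1 x‖ ^ 2 ≤
      RCLike.re (inner ℂ x (B' x)))
    {f f' : Lp ℂ 2 X.μ} (hf : ‖f' - f‖ ≤ η * ‖f‖) {x x' : X.energySpace}
    (hx : ∀ y, inner ℂ y (B x) = ∫ z, starRingEnd ℂ (X.component 0 y z) * f z ∂X.μ)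
    (hx' : ∀ y, inner ℂ y (B' x') = ∫ z, starRingEnd ℂ (X.component 0 y z) * f' z ∂X.μ) :
    ‖X.component 0 x' - X.component 0 x‖ ≤ 5 * η * ‖f‖ := by
  have hβ : ∀ z ∈ X.Ω, 1 / 2 ≤ X.beta ε z ∧ X.beta ε z ≤ 2 := fun z hz =>
    ⟨h.half_le z hz, (h.le_four_thirds z hz).trans (by norm_num)⟩
  have hinner : ∀ g k : Lp ℂ 2 X.μ, ∫ z, starRingEnd ℂ (g z) * k z ∂X.μ = inner ℂ g k := by
    intro g k
    rw [L2.inner_def]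
    simp only [RCLike.inner_apply, mul_comm]
  refine norm_sub_le_of_forms B B' (X.component 0) (X.component 1) hη h.eta_le hlow hlow'
    (fun x y => ?_) hf (fun y => by rw [hx, hinner]) (fun y => by rw [hx', hinner])
  refine Represents.norm_inner_sub_le (isCoefficient_gCoeff c hβ) (isCoefficient_gHatCoeff c hβ)
    hB hB' hη (fun z hz => ?_) (fun z hz => h.inv_le z hz) rfl rfl x y
  refine le_of_eq_of_le ?_ (h.const_mul_le z hz)
  simp [gCoeff, gHatCoeff]

/-- Resolvent comparison for a fixed small `ε`. -/
theorem exists_operators {c ε η : ℝ} (hη : 0 ≤ η) (h : X.IsSmall c ε η)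
    {B B' : X.energySpace →L[ℂ] X.energySpace} (hB : X.Represents (X.gCoeff c ε) B)
    (hB' : X.Represents (X.gHatCoeff c ε) B')
    (hlow : ∀ x, ‖X.component 0 x‖ ^ 2 + 1 / 2 * ‖X.component 1 x‖ ^ 2 ≤
      RCLike.re (inner ℂ x (B x)))
    (hlow' : ∀ x, ‖X.component 0 x‖ ^ 2 + 1 / 2 * ‖X.component 1 x‖ ^ 2 ≤
      RCLike.re (inner ℂ x (B' x)))
    (hcoer : ∃ δ : ℝ, 0 < δ ∧ ∀ x, δ * ‖x‖ ^ 2 ≤ RCLike.re (inner ℂ x (B x)))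
    (hcoer' : ∃ δ : ℝ, 0 < δ ∧ ∀ x, δ * ‖x‖ ^ 2 ≤ RCLike.re (inner ℂ x (B' x))) :
    ∃ (G : Lp ℂ 2 X.μ →ₗ.[ℂ] Lp ℂ 2 X.μ) (Ginv : Lp ℂ 2 X.μ →L[ℂ] Lp ℂ 2 X.μ),
      X.IsAssociated X.μ (X.g c ε) G ∧ IsSelfAdjoint G ∧ IsBoundedInverse G Ginv ∧
      (∃ (GHat : Lp ℂ 2 X.μ →ₗ.[ℂ] Lp ℂ 2 X.μ) (GHatInv : Lp ℂ 2 X.μ →L[ℂ] Lp ℂ 2 X.μ),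
        X.IsAssociated X.μ (X.gHat c ε) GHat ∧ IsSelfAdjoint GHat ∧
        IsBoundedInverse GHat GHatInv ∧ ‖GHatInv - Ginv‖ ≤ 5 * η) ∧
      (∃ (GHat : Lp ℂ 2 (X.betaMeasure ε) →ₗ.[ℂ] Lp ℂ 2 (X.betaMeasure ε))
        (GHatInv : Lp ℂ 2 (X.betaMeasure ε) →L[ℂ] Lp ℂ 2 (X.betaMeasure ε))
        (J : Lp ℂ 2 (X.betaMeasure ε) ≃L[ℂ] Lp ℂ 2 X.μ),
        X.IsAssociated (X.betaMeasure ε) (X.gHat c ε) GHat ∧ IsSelfAdjoint GHat ∧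
        IsBoundedInverse GHat GHatInv ∧
        (∀ u : Lp ℂ 2 (X.betaMeasure ε), J u =ᵐ[X.μ] u) ∧
        ‖(J : Lp ℂ 2 (X.betaMeasure ε) →L[ℂ] Lp ℂ 2 X.μ) ∘L GHatInv ∘L
          (J.symm : Lp ℂ 2 X.μ →L[ℂ] Lp ℂ 2 (X.betaMeasure ε)) - Ginv‖ ≤ 5 * η) := by
  have hβ : ∀ z ∈ X.Ω, 1 / 2 ≤ X.beta ε z ∧ X.beta ε z ≤ 2 := fun z hz =>
    ⟨h.half_le z hz, (h.le_four_thirds z hz).trans (by norm_num)⟩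
  obtain ⟨δ, hδ, hcoer⟩ := hcoer
  obtain ⟨δ', hδ', hcoer'⟩ := hcoer'
  have hν : X.betaMeasure ε ≪ X.μ := withDensity_absolutelyContinuous _ _
  obtain ⟨J, hJ⟩ := exists_lp_equiv (betaMeasure_le hβ) (le_betaMeasure hβ)
  obtain ⟨G, T, hG, hGs, hGi, hT⟩ := exists_isAssociated Measure.AbsolutelyContinuous.rfl
    (ContinuousLinearEquiv.refl ℂ (Lp ℂ 2 X.μ)) (fun _ => ae_eq_rfl) hB hδ hcoer
  obtain ⟨G₁, T₁, hG₁, hGs₁, hGi₁, hT₁⟩ := exists_isAssociated Measure.AbsolutelyContinuous.rfl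
    (ContinuousLinearEquiv.refl ℂ (Lp ℂ 2 X.μ)) (fun _ => ae_eq_rfl) hB' hδ' hcoer'
  obtain ⟨G₂, T₂, hG₂, hGs₂, hGi₂, hT₂⟩ := exists_isAssociated hν J hJ hB' hδ' hcoer'
  rw [← g_eq_chartForm] at hG
  rw [← gHat_eq_chartForm] at hG₁ hG₂
  refine ⟨G, _, hG, hGs, hGi, ⟨G₁, _, hG₁, hGs₁, hGi₁, ?_⟩, ⟨G₂, _, J, hG₂, hGs₂, hGi₂, hJ, ?_⟩⟩
  · refine ContinuousLinearMap.opNorm_le_bound _ (by positivity) fun f => ?_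
    -- In the unweighted space both equations have the same right hand side.
    exact norm_component_sub_le (f' := f) hη h hB hB' hlow hlow' (by
      rw [sub_self, norm_zero]
      positivity) (hT f) (hT₁ f)
  · refine ContinuousLinearMap.opNorm_le_bound _ (by positivity) fun f => ?_
    obtain ⟨f', hf', hle⟩ := exists_beta_mul hβ h.abs_sub_one_le f
    -- In the weighted space the density moves to the right hand side, which becomes `β_ε f`.
    have h1 := norm_component_sub_le hη h hB hB' hlow hlow' hle (hT f)
      (x' := T₂ (J.symm f)) fun y => by
        rw [hT₂, integral_betaMeasure hβ]
        refine integral_congr_ae ?_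
        have h2 := hJ (J.symm f)
        rw [J.apply_symm_apply] at h2
        filter_upwards [h2, hf'] with z hz hz'
        rw [hz', ← hz]
        ring
    refine le_of_eq_of_le (congrArg norm ?_) h1
    change J (J.symm (X.component 0 (T₂ (J.symm f)))) - X.component 0 (T f) = _
    rw [J.apply_symm_apply]

end DeformedTube

end ThinTube

/-! ### Choice of constants uniform in `ε` -/

theorem mainTheorem8 (X : ThinTube.DeformedTube) (c : ℝ) (hc : 0 < c) :
    TendstoUniformlyOn (fun (ε : ℝ) (z : ThinTube.Coord) => X.beta ε z) (fun _ => 1)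
      (𝓝[>] (0 : ℝ)) (X.I ×ˢ X.S) ∧
    ∃ ε₀ C : ℝ, 0 < ε₀ ∧ 0 < C ∧ ∀ ε : ℝ, 0 < ε → ε < ε₀ →
      (∀ z ∈ X.I ×ˢ X.S, 0 < X.beta ε z) ∧
      ∃ (G : Lp ℂ 2 X.μ →ₗ.[ℂ] Lp ℂ 2 X.μ) (Ginv : Lp ℂ 2 X.μ →L[ℂ] Lp ℂ 2 X.μ),
        X.IsAssociated X.μ (X.g c ε) G ∧ IsSelfAdjoint G ∧ ThinTube.IsBoundedInverse G Ginv ∧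
        -- `Ĝ_ε` as an operator in the unweighted space `L²(I × S)`
        (∃ (GHat : Lp ℂ 2 X.μ →ₗ.[ℂ] Lp ℂ 2 X.μ) (GHatInv : Lp ℂ 2 X.μ →L[ℂ] Lp ℂ 2 X.μ),
          X.IsAssociated X.μ (X.gHat c ε) GHat ∧ IsSelfAdjoint GHat ∧
          ThinTube.IsBoundedInverse GHat GHatInv ∧
          ‖GHatInv - Ginv‖ ≤ C * ε) ∧
        -- `Ĝ_ε` as an operator in the weighted space `L²(I × S, β_ε)`, which has the same elements
        (∃ (GHat : Lp ℂ 2 (X.betaMeasure ε) →ₗ.[ℂ] Lp ℂ 2 (X.betaMeasure ε))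
          (GHatInv : Lp ℂ 2 (X.betaMeasure ε) →L[ℂ] Lp ℂ 2 (X.betaMeasure ε))
          (J : Lp ℂ 2 (X.betaMeasure ε) ≃L[ℂ] Lp ℂ 2 X.μ),
          X.IsAssociated (X.betaMeasure ε) (X.gHat c ε) GHat ∧ IsSelfAdjoint GHat ∧
          ThinTube.IsBoundedInverse GHat GHatInv ∧
          (∀ u : Lp ℂ 2 (X.betaMeasure ε), J u =ᵐ[X.μ] u) ∧
          ‖(J : Lp ℂ 2 (X.betaMeasure ε) →L[ℂ] Lp ℂ 2 X.μ) ∘L GHatInv ∘L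
            (J.symm : Lp ℂ 2 X.μ →L[ℂ] Lp ℂ 2 (X.betaMeasure ε)) - Ginv‖ ≤ C * ε) := by
  obtain ⟨ε₁, hε₁, hlow⟩ := X.exists_lower_bound_of_represents
  obtain ⟨ε₂, D, hε₂, hD, hsmall⟩ := X.exists_isSmall c
  refine ⟨X.tendstoUniformlyOn_beta, min ε₁ ε₂, 5 * D, lt_min hε₁ hε₂, by positivity,
    fun ε hε hlt => ?_⟩
  obtain ⟨hpos, h⟩ := hsmall ε hε (hlt.trans_le (min_le_right _ _))
  refine ⟨hpos, ?_⟩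
  have hβ : ∀ z ∈ X.Ω, 1 / 2 ≤ X.beta ε z ∧ X.beta ε z ≤ 2 := fun z hz =>
    ⟨h.half_le z hz, (h.le_four_thirds z hz).trans (by norm_num)⟩
  have ha := ThinTube.DeformedTube.isCoefficient_gCoeff c hβ
  have ha' := ThinTube.DeformedTube.isCoefficient_gHatCoeff c hβ
  obtain ⟨B, hB⟩ := ThinTube.DeformedTube.exists_operator ha
  obtain ⟨B', hB'⟩ := ThinTube.DeformedTube.exists_operator ha'
  obtain ⟨hB1, hB2⟩ := hlow ε hε (hlt.trans_le (min_le_left _ _)) hβ _ B ha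
    (fun z _ i => ThinTube.DeformedTube.lowerCoeff_le_gCoeff hc.le z i) hB
  obtain ⟨hB1', hB2'⟩ := hlow ε hε (hlt.trans_le (min_le_left _ _)) hβ _ B' ha'
    (fun z hz i => ThinTube.DeformedTube.lowerCoeff_le_gHatCoeff hc.le
      ⟨by linarith [hβ z hz], h.le_four_thirds z hz⟩ i) hB'
  rw [mul_assoc]
  exact ThinTube.DeformedTube.exists_operators (by positivity) h hB hB' hB1 hB1' hB2 hB2'
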